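/- **Corollary 3.3 (Riemannian structures).** Let $(M,\sigma)$ be a smooth Riemannian manifold of dimension $n$ (without boundary), with Levi-Civita connection $\nabla^{LC}$ and curvature $R(X,Y)Z=\nabla^{LC}_X\nabla^{LC}_YZ-\nabla^{LC}_Y\nabla^{LC}_XZ-\nabla^{LC}_{[X,Y]}Z$. Let $\mathfrak g\subset J^1(TM)$ be the Lie algebroid of one-jets of infinitesimal isometries: its fiber over $m$ consists of the one-jets $[V]^1_m$ of vector fields $V$ defined near $m$ with $(\mathcal L_V\sigma)(m)=0$, and its anchor $\#$ is the restriction of the projection $J^1(TM)\to TM$. The kernel $\mathfrak h\subset T^*M\otimes TM$ of $\#$ is the bundle of $\sigma$-skew-symmetric endomorphisms of the tangent spaces. Sections of $J^1(TM)$ are written uniquely as $J^1V+\phi$, where $V$ is a vector field and $\phi$ is a section of $T^*M\otimes TM\cong\mathrm{Hom}(TM,TM)$; here $T^*M\otimes TM\subset J^1(TM)$ via $df\otimes W\mapsto J^1(fW)-fJ^1W$. The bracket is $$[J^1V+\phi,\,J^1W+\psi]=J^1[V,W]+(\psi\circ\phi-\phi\circ\psi)+\kappa_V\psi-\kappa_W\phi,\qquad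 (\kappa_V\psi)(Z)=[V,\psi(Z)]+\psi([Z,V]),$$ and the adjoint representation on $TM$ is $\mathrm{ad}_{J^1V+\phi}Y=[V,Y]-\phi(Y)$. Let $t\colon TM\to\mathfrak g$, $tY=J^1Y-\nabla^{LC}_{\cdot}Y$, be the splitting of $\#$ given by the Levi-Civita connection, and let $\nabla$ be the Cartan connection on $\mathfrak g$ defined by $$\nabla_YX=t(\mathrm{ad}_XY)+[tY,X].$$ Call $(M,\sigma)$ *locally maximally homogeneous* if every point of $M$ has a connected open neighborhood $U$ such that the Lie algebra of Killing fields of $(U,\sigma|_U)$ has the maximal dimension $n(n+1)/2$. Call $(\mathfrak g,\nabla)$ *locally symmetric* if every point of $M$ has a connected open neighborhood $U$ such that every element of $\mathfrak g|_U$ is the value of a $\nabla$-parallel section of $\mathfrak g|_U$ (that is, $(\mathfrak g,\nabla)|_U$ coincides with its symmetric part). Then each of the two conditions 1. $(M,\sigma)$ is locally maximally homogeneous, 2. $(\mathfrak g,\nabla)$ is locally symmetric, holds if and only if $R$ is both $\mathfrak h$-invariant and parallel, that is, if and only if $$A\,R(u,v)w=R(Au,v)w+R(u,Av)w+R(u,v)Aw$$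 for all $m\in M$, $A\in\mathfrak h_m$ and $u,v,w\in T_mM$, and $\nabla^{LC}R=0$. -/

import Mathlib

open Bundle Manifold VectorField Set
open scoped ContDiff Topology

namespace RiemannCartan

noncomputable section

variable {E : Type*} [NormedAddCommGroup E] [NormedSpace ℝ E]
  {M : Type*} [TopologicalSpace M] [ChartedSpace E M]

variable (E M) in
/-- Vector fields on `M` (no regularity imposed). -/
abbrev VField : Type _ := Π x : M, TangentSpace 𝓘(ℝ, E) x

variable (E M) in
/-- Fields of endomorphisms of the tangent spaces of `M`, that is sections of `T*M ⊗ TM`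
(no regularity imposed). -/
abbrev EndField : Type _ := Π x : M, TangentSpace 𝓘(ℝ, E) x →L[ℝ] TangentSpace 𝓘(ℝ, E) x

variable [IsManifold 𝓘(ℝ, E) ∞ M]

/-- `X` is a smooth vector field on `U`. -/
def SmoothOn (X : VField E M) (U : Set M) : Prop :=
  ContMDiffOn 𝓘(ℝ, E) 𝓘(ℝ, E).tangent ∞ (fun x ↦ (⟨x, X x⟩ : TangentBundle 𝓘(ℝ, E) M)) U

/-- `X` is a smooth vector field on some open neighborhood of `x`. -/
def SmoothNear (X : VField E M) (x : M) : Prop :=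
  ∃ U : Set M, IsOpen U ∧ x ∈ U ∧ SmoothOn X U

theorem SmoothOn.mdiffAt {X : VField E M} {U : Set M} (h : SmoothOn X U) (hU : IsOpen U) {x : M}
    (hx : x ∈ U) : MDiffAt (T% X) x :=
  ((h x hx).contMDiffAt (hU.mem_nhds hx)).mdifferentiableAt (by simp)

/-- `φ` is a smooth section of `T*M ⊗ TM = Hom(TM, TM)` over `U`. -/
def EndSmoothOn (φ : EndField E M) (U : Set M) : Prop :=
  ContMDiffOn 𝓘(ℝ, E) (𝓘(ℝ, E).prod 𝓘(ℝ, E →L[ℝ] E)) ∞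
    (fun x ↦ (⟨x, φ x⟩ : TotalSpace (E →L[ℝ] E)
      (fun y : M ↦ TangentSpace 𝓘(ℝ, E) y →L[ℝ] TangentSpace 𝓘(ℝ, E) y))) U

/-! ### The Levi-Civita connection -/

section LeviCivita

variable [RiemannianBundle (fun x : M ↦ TangentSpace 𝓘(ℝ, E) x)]

/-- The right-hand side of the Koszul formula for `2 ⟪∇_X Y, Z⟫` at `x`. -/
def koszul (Y X Z : VField E M) (x : M) : ℝ :=
  d% (fun y ↦ inner ℝ (Y y) (Z y)) x (X x) + d% (fun y ↦ inner ℝ (Z y) (X y)) x (Y x)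
    - d% (fun y ↦ inner ℝ (X y) (Y y)) x (Z x)
    + inner ℝ (mlieBracket 𝓘(ℝ, E) X Y x) (Z x) - inner ℝ (mlieBracket 𝓘(ℝ, E) Y Z x) (X x)
    + inner ℝ (mlieBracket 𝓘(ℝ, E) Z X x) (Y x)

variable [IsContMDiffRiemannianBundle 𝓘(ℝ, E) ∞ E (fun x : M ↦ TangentSpace 𝓘(ℝ, E) x)]

theorem mdiff_inner {x : M} {X Y : VField E M} (hX : MDiffAt (T% X) x) (hY : MDiffAt (T% Y) x) :
    MDiffAt (fun y ↦ inner ℝ (X y) (Y y)) x :=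
  MDifferentiableAt.inner_bundle (F := E) (E := fun x : M ↦ TangentSpace 𝓘(ℝ, E) x) (b := id)
    hX hY

variable [FiniteDimensional ℝ E]

theorem koszul_tensorial_left {x : M} {Y Z : VField E M} (hY : MDiffAt (T% Y) x)
    (hZ : MDiffAt (T% Z) x) : TensorialAt 𝓘(ℝ, E) E (fun X ↦ koszul Y X Z x) x where
  smul {f X} hf hX := by
    have := FiniteDimensional.complete ℝ E
    have e1 : (fun y ↦ inner ℝ (Z y) ((f • X) y)) = fun y ↦ f y * inner ℝ (Z y) (X y) := by
      ext y; simp [inner_smul_right]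
    have e2 : (fun y ↦ inner ℝ ((f • X) y) (Y y)) = fun y ↦ f y * inner ℝ (X y) (Y y) := by
      ext y; simp [inner_smul_left]
    simp only [koszul, e1, e2, mvfderiv_fun_mul hf (mdiff_inner hZ hX),
      mvfderiv_fun_mul hf (mdiff_inner hX hY), mlieBracket_smul_left hf hX,
      mlieBracket_smul_right hf hX]
    simp [inner_add_left, inner_smul_left, inner_smul_right, real_inner_comm]
    ring
  add {X X'} hX hX' := by
    have := FiniteDimensional.complete ℝ E
    have e1 : (fun y ↦ inner ℝ (Z y) ((X + X') y)) =
        fun y ↦ inner ℝ (Z y) (X y) + inner ℝ (Z y) (X' y) := by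
      ext y; simp [inner_add_right]
    have e2 : (fun y ↦ inner ℝ ((X + X') y) (Y y)) =
        fun y ↦ inner ℝ (X y) (Y y) + inner ℝ (X' y) (Y y) := by
      ext y; simp [inner_add_left]
    simp only [koszul, e1, e2, mvfderiv_fun_add (mdiff_inner hZ hX) (mdiff_inner hZ hX'),
      mvfderiv_fun_add (mdiff_inner hX hY) (mdiff_inner hX' hY), mlieBracket_add_left hX hX',
      mlieBracket_add_right hX hX']
    simp [inner_add_left, inner_add_right]
    ring

theorem koszul_tensorial_right {x : M} {Y X : VField E M} (hY : MDiffAt (T% Y) x)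
    (hX : MDiffAt (T% X) x) : TensorialAt 𝓘(ℝ, E) E (fun Z ↦ koszul Y X Z x) x where
  smul {f Z} hf hZ := by
    have := FiniteDimensional.complete ℝ E
    have e1 : (fun y ↦ inner ℝ (Y y) ((f • Z) y)) = fun y ↦ f y * inner ℝ (Y y) (Z y) := by
      ext y; simp [inner_smul_right]
    have e2 : (fun y ↦ inner ℝ ((f • Z) y) (X y)) = fun y ↦ f y * inner ℝ (Z y) (X y) := by
      ext y; simp [inner_smul_left]
    simp only [koszul, e1, e2, mvfderiv_fun_mul hf (mdiff_inner hY hZ),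
      mvfderiv_fun_mul hf (mdiff_inner hZ hX), mlieBracket_smul_left hf hZ,
      mlieBracket_smul_right hf hZ]
    simp [inner_add_left, inner_smul_left, inner_smul_right, real_inner_comm]
    ring
  add {Z Z'} hZ hZ' := by
    have := FiniteDimensional.complete ℝ E
    have e1 : (fun y ↦ inner ℝ (Y y) ((Z + Z') y)) =
        fun y ↦ inner ℝ (Y y) (Z y) + inner ℝ (Y y) (Z' y) := by
      ext y; simp [inner_add_right]
    have e2 : (fun y ↦ inner ℝ ((Z + Z') y) (X y)) =
        fun y ↦ inner ℝ (Z y) (X y) + inner ℝ (Z' y) (X y) := by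
      ext y; simp [inner_add_left]
    simp only [koszul, e1, e2, mvfderiv_fun_add (mdiff_inner hY hZ) (mdiff_inner hY hZ'),
      mvfderiv_fun_add (mdiff_inner hZ hX) (mdiff_inner hZ' hX), mlieBracket_add_left hZ hZ',
      mlieBracket_add_right hZ hZ']
    simp [inner_add_left, inner_add_right]
    ring

open Classical in
/-- `∇Y` at `x`: the endomorphism `v ↦ ∇_v Y` of `T_x M` given by the Koszul formula
(`0` by convention where `Y` is not differentiable). -/
def leviCivitaFun (Y : VField E M) (x : M) :
    TangentSpace 𝓘(ℝ, E) x →L[ℝ] TangentSpace 𝓘(ℝ, E) x :=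
  if hY : MDiffAt (T% Y) x then
    haveI : FiniteDimensional ℝ (TangentSpace 𝓘(ℝ, E) x) := inferInstanceAs (FiniteDimensional ℝ E)
    haveI : CompleteSpace (TangentSpace 𝓘(ℝ, E) x) := FiniteDimensional.complete ℝ _
    LinearMap.toContinuousLinearMap
      { toFun := fun v ↦ (InnerProductSpace.toDual ℝ (TangentSpace 𝓘(ℝ, E) x)).symm
          ((1 / 2 : ℝ) • TensorialAt.mkHom₂ (fun X Z ↦ koszul Y X Z x) x
            (fun _ hZ ↦ koszul_tensorial_left hY hZ) (fun _ hX ↦ koszul_tensorial_right hY hX) v)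
        map_add' := fun v w ↦ by simp
        map_smul' := fun c v ↦ by
          simp [smul_comm (_ : ℝ) c, -smul_eq_mul] }
  else 0

theorem inner_leviCivitaFun {x : M} {X Y Z : VField E M} (hX : MDiffAt (T% X) x)
    (hY : MDiffAt (T% Y) x) (hZ : MDiffAt (T% Z) x) :
    inner ℝ (leviCivitaFun Y x (X x)) (Z x) = (1 / 2 : ℝ) * koszul Y X Z x := by
  have : FiniteDimensional ℝ (TangentSpace 𝓘(ℝ, E) x) := inferInstanceAs (FiniteDimensional ℝ E)
  have : CompleteSpace (TangentSpace 𝓘(ℝ, E) x) := FiniteDimensional.complete ℝ _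
  simp only [leviCivitaFun, hY, dite_true]
  erw [InnerProductSpace.toDual_symm_apply]
  erw [smul_apply]
  rw [TensorialAt.mkHom₂_apply _ _ hX hZ]
  rfl

theorem leviCivitaFun_eq {x : M} {Y : VField E M} (hY : MDiffAt (T% Y) x)
    {T : TangentSpace 𝓘(ℝ, E) x →L[ℝ] TangentSpace 𝓘(ℝ, E) x}
    (hT : ∀ X Z : VField E M, MDiffAt (T% X) x → MDiffAt (T% Z) x →
      inner ℝ (T (X x)) (Z x) = (1 / 2 : ℝ) * koszul Y X Z x) : leviCivitaFun Y x = T := by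
  ext v
  refine ext_inner_right ℝ fun w ↦ ?_
  have h1 := hT (FiberBundle.extend E v) (FiberBundle.extend E w)
    (FiberBundle.mdifferentiableAt_extend ..)
    (FiberBundle.mdifferentiableAt_extend ..)
  have h2 := inner_leviCivitaFun (X := FiberBundle.extend E v) (Z := FiberBundle.extend E w)
    (FiberBundle.mdifferentiableAt_extend ..) hY (FiberBundle.mdifferentiableAt_extend ..)
  simp only [FiberBundle.extend_apply_self] at h1 h2
  rw [h1, h2]

variable (E M) in
/-- The Levi-Civita connection of the Riemannian metric. -/
def leviCivita : CovariantDerivative 𝓘(ℝ, E) E (TangentSpace 𝓘(ℝ, E) : M → Type _) where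
  toFun := leviCivitaFun
  isCovariantDerivativeOnUniv :=
    { add := by
        intro Y Y' x hY hY' _
        have := FiniteDimensional.complete ℝ E
        refine leviCivitaFun_eq (mdifferentiableAt_add_section hY hY') fun X Z hX hZ ↦ ?_
        rw [add_apply, inner_add_left, inner_leviCivitaFun hX hY hZ,
          inner_leviCivitaFun hX hY' hZ]
        have e1 : (fun y ↦ inner ℝ ((Y + Y') y) (Z y)) =
            fun y ↦ inner ℝ (Y y) (Z y) + inner ℝ (Y' y) (Z y) := by
          ext y; simp [inner_add_left]
        have e2 : (fun y ↦ inner ℝ (X y) ((Y + Y') y)) =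
            fun y ↦ inner ℝ (X y) (Y y) + inner ℝ (X y) (Y' y) := by
          ext y; simp [inner_add_right]
        simp only [koszul, e1, e2, mvfderiv_fun_add (mdiff_inner hY hZ) (mdiff_inner hY' hZ),
          mvfderiv_fun_add (mdiff_inner hX hY) (mdiff_inner hX hY'),
          mlieBracket_add_left hY hY', mlieBracket_add_right hY hY']
        simp [inner_add_left, inner_add_right]
        ring
      leibniz := by
        intro Y f x hY hf _
        have := FiniteDimensional.complete ℝ E
        refine leviCivitaFun_eq (hf.smul_section hY) fun X Z hX hZ ↦ ?_
        have e1 : (fun y ↦ inner ℝ ((f • Y) y) (Z y)) = fun y ↦ f y * inner ℝ (Y y) (Z y) := by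
          ext y; simp [inner_smul_left]
        have e2 : (fun y ↦ inner ℝ (X y) ((f • Y) y)) = fun y ↦ f y * inner ℝ (X y) (Y y) := by
          ext y; simp [inner_smul_right]
        simp only [add_apply, smul_apply, inner_add_left, inner_smul_left, koszul, e1, e2,
          inner_leviCivitaFun hX hY hZ, mvfderiv_fun_mul hf (mdiff_inner hY hZ),
          mvfderiv_fun_mul hf (mdiff_inner hX hY), mlieBracket_smul_left hf hY,
          mlieBracket_smul_right hf hY]
        simp [inner_smul_left, inner_smul_right, real_inner_comm]
        ring }

/-- The Levi-Civita connection is metric. -/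
theorem leviCivita_metric {x : M} {X Y Z : VField E M} (hX : MDiffAt (T% X) x)
    (hY : MDiffAt (T% Y) x) (hZ : MDiffAt (T% Z) x) :
    d% (fun y ↦ inner ℝ (Y y) (Z y)) x (X x) =
      inner ℝ (leviCivita E M Y x (X x)) (Z x) + inner ℝ (Y x) (leviCivita E M Z x (X x)) := by
  change _ = inner ℝ (leviCivitaFun Y x (X x)) (Z x) + inner ℝ (Y x) (leviCivitaFun Z x (X x))
  rw [real_inner_comm _ (Y x), inner_leviCivitaFun hX hY hZ, inner_leviCivitaFun hX hZ hY]
  have e (A B : VField E M) : (fun y ↦ inner ℝ (A y) (B y)) = fun y ↦ inner ℝ (B y) (A y) := by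
    ext y; exact real_inner_comm _ _
  simp only [koszul, e Z Y, e Y X, e X Z, mlieBracket_swap_apply (V := Y) (W := X),
    mlieBracket_swap_apply (V := Z) (W := Y), mlieBracket_swap_apply (V := X) (W := Z),
    inner_neg_left]
  ring

/-- The Levi-Civita connection is torsion free. -/
theorem leviCivita_torsionFree {x : M} {X Y : VField E M} (hX : MDiffAt (T% X) x)
    (hY : MDiffAt (T% Y) x) :
    leviCivita E M Y x (X x) - leviCivita E M X x (Y x) = mlieBracket 𝓘(ℝ, E) X Y x := by
  change leviCivitaFun Y x (X x) - leviCivitaFun X x (Y x) = _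
  refine ext_inner_right ℝ fun w ↦ ?_
  obtain ⟨Z, hZ, rfl⟩ : ∃ Z : VField E M, MDiffAt (T% Z) x ∧ Z x = w :=
    ⟨FiberBundle.extend E w, FiberBundle.mdifferentiableAt_extend .., by simp⟩
  rw [inner_sub_left, inner_leviCivitaFun hX hY hZ, inner_leviCivitaFun hY hX hZ]
  have e (A B : VField E M) : (fun y ↦ inner ℝ (A y) (B y)) = fun y ↦ inner ℝ (B y) (A y) := by
    ext y; exact real_inner_comm _ _
  simp only [koszul, e Z Y, e Y X, e X Z, mlieBracket_swap_apply (V := Y) (W := X),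
    mlieBracket_swap_apply (V := Z) (W := Y), mlieBracket_swap_apply (V := X) (W := Z),
    inner_neg_left]
  ring

/-- `R(X, Y)Z = ∇_X ∇_Y Z - ∇_Y ∇_X Z - ∇_[X, Y] Z` on vector fields, for the Levi-Civita
connection. -/
def curvatureOp (X Y Z : VField E M) (x : M) : TangentSpace 𝓘(ℝ, E) x :=
  leviCivita E M (fun y ↦ leviCivita E M Z y (Y y)) x (X x)
    - leviCivita E M (fun y ↦ leviCivita E M Z y (X y)) x (Y x)
    - leviCivita E M Z x (mlieBracket 𝓘(ℝ, E) X Y x)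

/-- The curvature tensor `R(u, v)w` of the Levi-Civita connection at `x`. The operator
`R(X, Y)Z` being tensorial, it is evaluated on local extensions of `u, v, w` to vector fields
that are smooth near `x`. -/
def curvature (x : M) (u v w : TangentSpace 𝓘(ℝ, E) x) : TangentSpace 𝓘(ℝ, E) x :=
  curvatureOp (FiberBundle.extend E u) (FiberBundle.extend E v) (FiberBundle.extend E w) x

variable (E M) in
/-- The curvature of the Levi-Civita connection is `𝔥`-invariant: it is annihilated by the
natural action of every skew-symmetric endomorphism `A` of a tangent space, the fiber `𝔥_x`
consisting of all those. -/
def CurvatureInvariant : Prop :=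
  ∀ (x : M) (A : TangentSpace 𝓘(ℝ, E) x →L[ℝ] TangentSpace 𝓘(ℝ, E) x),
    (∀ v w, inner ℝ (A v) w + inner ℝ v (A w) = 0) →
    ∀ u v w, A (curvature x u v w)
      - curvature x (A u) v w - curvature x u (A v) w - curvature x u v (A w) = 0

variable (E M) in
/-- The curvature of the Levi-Civita connection is parallel:
`(∇_v R)(X, Y)Z = ∇_v (R(X, Y)Z) - R(∇_v X, Y)Z - R(X, ∇_v Y)Z - R(X, Y)∇_v Z` vanishes. -/
def CurvatureParallel : Prop :=
  ∀ (x : M) (X Y Z : VField E M), SmoothNear X x → SmoothNear Y x → SmoothNear Z x →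
    ∀ v : TangentSpace 𝓘(ℝ, E) x,
      leviCivita E M (fun y ↦ curvature y (X y) (Y y) (Z y)) x v
        - curvature x (leviCivita E M X x v) (Y x) (Z x)
        - curvature x (X x) (leviCivita E M Y x v) (Z x)
        - curvature x (X x) (Y x) (leviCivita E M Z x v) = 0

end LeviCivita
/-! ### Killing fields -/

section Killing

variable [RiemannianBundle (fun x : M ↦ TangentSpace 𝓘(ℝ, E) x)]

/-- The Lie derivative `(L_V σ)(A, B) = V(σ(A, B)) - σ([V, A], B) - σ(A, [V, B])` of the
metric `σ`, at `x`. -/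
def lieMetric (V A B : VField E M) (x : M) : ℝ :=
  d% (fun y ↦ inner ℝ (A y) (B y)) x (V x)
    - inner ℝ (mlieBracket 𝓘(ℝ, E) V A x) (B x) - inner ℝ (A x) (mlieBracket 𝓘(ℝ, E) V B x)

/-- `L_V σ` vanishes at the point `x`. -/
def LieMetricVanishesAt (V : VField E M) (x : M) : Prop :=
  ∀ A B : VField E M, SmoothNear A x → SmoothNear B x → lieMetric V A B x = 0

/-- `V` is a Killing field on `U`. -/
def IsKillingOn (V : VField E M) (U : Set M) : Prop :=
  SmoothOn V U ∧ ∀ x ∈ U, LieMetricVanishesAt V x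

variable [IsContMDiffRiemannianBundle 𝓘(ℝ, E) ∞ E (fun x : M ↦ TangentSpace 𝓘(ℝ, E) x)]
  [FiniteDimensional ℝ E]

/-- The space of Killing fields on the open set `U`. A vector field on `U` is
represented by its extension by zero outside `U`. -/
def killingFields (U : TopologicalSpace.Opens M) : Submodule ℝ (VField E M) where
  carrier := {V | IsKillingOn V (U : Set M) ∧ ∀ x ∉ U, V x = 0}
  zero_mem' := by
    refine ⟨⟨(contMDiff_zeroSection ℝ _).contMDiffOn, fun x _ A B _ _ ↦ ?_⟩, fun _ _ ↦ rfl⟩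
    simp [lieMetric]
  add_mem' := by
    rintro V W ⟨⟨hV, hV'⟩, hV0⟩ ⟨⟨hW, hW'⟩, hW0⟩
    have := FiniteDimensional.complete ℝ E
    refine ⟨⟨hV.add_section hW, fun x hx A B hA hB ↦ ?_⟩, fun x hx ↦ by
      simp [hV0 x hx, hW0 x hx]⟩
    have h1 := hV' x hx A B hA hB
    have h2 := hW' x hx A B hA hB
    have hVx := hV.mdiffAt U.isOpen hx
    have hWx := hW.mdiffAt U.isOpen hx
    simp only [lieMetric] at h1 h2 ⊢
    rw [mlieBracket_add_left hVx hWx, mlieBracket_add_left hVx hWx]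
    simp only [Pi.add_apply, map_add, inner_add_left, inner_add_right]
    linarith
  smul_mem' := by
    rintro c V ⟨⟨hV, hV'⟩, hV0⟩
    have := FiniteDimensional.complete ℝ E
    refine ⟨⟨hV.const_smul_section, fun x hx A B hA hB ↦ ?_⟩, fun x hx ↦ by simp [hV0 x hx]⟩
    have h1 := hV' x hx A B hA hB
    have hVx := hV.mdiffAt U.isOpen hx
    simp only [lieMetric] at h1 ⊢
    rw [mlieBracket_const_smul_left hVx, mlieBracket_const_smul_left hVx]
    simp only [Pi.smul_apply, map_smul, inner_smul_left, inner_smul_right, smul_eq_mul,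
      conj_trivial]
    linear_combination c * h1

variable (E M) in
/-- `M` is locally maximally homogeneous: every point has a connected open neighborhood on which
the Lie algebra of Killing fields has the maximal dimension `n(n+1)/2`, where `n = dim M`. -/
def LocallyMaximallyHomogeneous : Prop :=
  ∀ m : M, ∃ U : TopologicalSpace.Opens M, m ∈ U ∧ IsConnected (U : Set M) ∧
    Module.finrank ℝ (killingFields (E := E) U) =
      Module.finrank ℝ E * (Module.finrank ℝ E + 1) / 2

end Killing

/-! ### The Cartan algebroid `(𝔤, ∇)` of a Riemannian metric -/

section Jets

/-- The fiber at `x` of the first jet bundle `J¹(TM)`: the one-jet at `x` of a vector field is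
recorded by its value and its derivative at `x`, in the preferred trivialization of the tangent
bundle at `x`. The subspace `T*M ⊗ TM` is `{0} × Hom(T_xM, T_xM)`, and the projection onto `TM`
is the first component. -/
abbrev JetFiber (x : M) : Type _ :=
  TangentSpace 𝓘(ℝ, E) x × (TangentSpace 𝓘(ℝ, E) x →L[ℝ] TangentSpace 𝓘(ℝ, E) x)


/-- The one-jet `[V]¹_x` of the vector field `V` at `x`. -/
def jet (V : VField E M) (x : M) : JetFiber (E := E) x :=
  (V x, (trivializationAt E (TangentSpace 𝓘(ℝ, E)) x).symmL ℝ x ∘L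
    d% (fun y ↦ (trivializationAt E (TangentSpace 𝓘(ℝ, E)) x
      (⟨y, V y⟩ : TangentBundle 𝓘(ℝ, E) M)).2) x)

variable (E M) in
/-- A section of `J¹(TM)`, written (uniquely) as `J¹V + φ` with `V` a vector field and `φ` a
section of `T*M ⊗ TM`. The inclusion of `T*M ⊗ TM` in `J¹(TM)` maps `df ⊗ W` to
`J¹(fW) - f J¹W`. -/
structure JetSection where
  /-- the vector field `V`, which is also the image of the section under the anchor `#` -/
  field : VField E M
  /-- the endomorphism field `φ` -/
  endo : EndField E M

/-- The value at `x` of the section `J¹V + φ`, in the fiber of `J¹(TM)`. -/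
def JetSection.eval (s : JetSection E M) (x : M) : JetFiber (E := E) x :=
  jet s.field x + (0, s.endo x)

open Classical in
/-- The endomorphism field determined by a tensorial operator on vector fields (`0` by convention
at points where the operator is not tensorial). -/
def EndField.ofOperator [FiniteDimensional ℝ E] (Φ : VField E M → VField E M) : EndField E M :=
  fun x ↦ if h : TensorialAt 𝓘(ℝ, E) E (fun Z ↦ Φ Z x) x then
    TensorialAt.mkHom (fun Z ↦ Φ Z x) x h else 0

/-- `κ_X φ`, defined by `(κ_X φ)(Z) = [X, φ(Z)] + φ([Z, X])`. -/
def kappa [FiniteDimensional ℝ E] (X : VField E M) (φ : EndField E M) : EndField E M :=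
  EndField.ofOperator fun Z x ↦
    mlieBracket 𝓘(ℝ, E) X (fun y ↦ φ y (Z y)) x + φ x (mlieBracket 𝓘(ℝ, E) Z X x)

/-- The formula for `κ_X φ` holds wherever `X`, `φ` and `Z` are smooth. -/
theorem kappa_apply [FiniteDimensional ℝ E] {X Z : VField E M} {φ : EndField E M} {U : Set M}
    (hU : IsOpen U) (hX : SmoothOn X U) (hφ : EndSmoothOn φ U) (hZ : SmoothOn Z U) {x : M}
    (hx : x ∈ U) : kappa X φ x (Z x) =
      mlieBracket 𝓘(ℝ, E) X (fun y ↦ φ y (Z y)) x + φ x (mlieBracket 𝓘(ℝ, E) Z X x) := by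
  have := FiniteDimensional.complete ℝ E
  have hXx := hX.mdiffAt hU hx
  have hφx : MDifferentiableAt 𝓘(ℝ, E) (𝓘(ℝ, E).prod 𝓘(ℝ, E →L[ℝ] E))
      (fun x ↦ (⟨x, φ x⟩ : TotalSpace (E →L[ℝ] E)
        (fun y : M ↦ TangentSpace 𝓘(ℝ, E) y →L[ℝ] TangentSpace 𝓘(ℝ, E) y))) x :=
    ((hφ x hx).contMDiffAt (hU.mem_nhds hx)).mdifferentiableAt (by simp)
  have key {W : VField E M} (hW : MDiffAt (T% W) x) : MDiffAt (T% (fun y ↦ φ y (W y))) x :=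
    MDifferentiableAt.clm_bundle_apply (b := fun y ↦ y) hφx hW
  have h : TensorialAt 𝓘(ℝ, E) E (fun Z : VField E M ↦
      mlieBracket 𝓘(ℝ, E) X (fun y ↦ φ y (Z y)) x + φ x (mlieBracket 𝓘(ℝ, E) Z X x)) x :=
    { smul := by
        intro f W hf hW
        have e : (fun y ↦ φ y ((f • W) y)) = f • fun y ↦ φ y (W y) := by ext y; simp
        rw [e, mlieBracket_smul_right hf (key hW), mlieBracket_smul_left hf hW]
        simp
        module
      add := by
        intro W W' hW hW'
        have e : (fun y ↦ φ y ((W + W') y)) = (fun y ↦ φ y (W y)) + fun y ↦ φ y (W' y) := by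
          ext y; simp
        rw [e, mlieBracket_add_right (key hW) (key hW'), mlieBracket_add_left hW hW']
        simp
        abel }
  simp only [kappa, EndField.ofOperator, h, dite_true]
  exact TensorialAt.mkHom_apply h (hZ.mdiffAt hU hx)

/-- The Lie algebroid bracket of `J¹(TM)`:
`[J¹V + φ, J¹W + ψ] = J¹[V, W] + [φ, ψ] + κ_V ψ - κ_W φ`, with `[φ, ψ] = ψ ∘ φ - φ ∘ ψ`. -/
def JetSection.bracket [FiniteDimensional ℝ E] (s t : JetSection E M) : JetSection E M where
  field := mlieBracket 𝓘(ℝ, E) s.field t.field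
  endo x := (t.endo x ∘L s.endo x - s.endo x ∘L t.endo x)
    + kappa s.field t.endo x - kappa t.field s.endo x

/-- The adjoint representation of `J¹(TM)` on `TM`, determined by `ad_{J¹V} Y = [V, Y]` and
`ad_φ Y = -φ(Y)` for `φ` a section of `T*M ⊗ TM`. -/
def JetSection.ad (s : JetSection E M) (Y : VField E M) : VField E M :=
  fun x ↦ mlieBracket 𝓘(ℝ, E) s.field Y x - s.endo x (Y x)

variable [RiemannianBundle (fun x : M ↦ TangentSpace 𝓘(ℝ, E) x)]

/-- The fiber at `x` of the Lie algebroid `𝔤 ⊆ J¹(TM)` of one-jets of infinitesimal isometries: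
the one-jets at `x` of vector fields `V` such that `L_V σ` vanishes at `x`. -/
def isometryJets (x : M) : Set (JetFiber (E := E) x) :=
  {ξ | ∃ V : VField E M, SmoothNear V x ∧ LieMetricVanishesAt V x ∧ jet V x = ξ}

/-- `s` is a smooth section of `𝔤` over `U`. -/
structure JetSection.IsIsometrySectionOn (s : JetSection E M) (U : Set M) : Prop where
  smooth_field : SmoothOn s.field U
  smooth_endo : EndSmoothOn s.endo U
  mem : ∀ x ∈ U, s.eval x ∈ isometryJets x

variable [FiniteDimensional ℝ E]
  [IsContMDiffRiemannianBundle 𝓘(ℝ, E) ∞ E (fun x : M ↦ TangentSpace 𝓘(ℝ, E) x)]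

/-- The splitting `t : TM → 𝔤` corresponding to the Levi-Civita connection, `tY = J¹Y - ∇Y`. -/
def splitting (Y : VField E M) : JetSection E M where
  field := Y
  endo x := -leviCivita E M Y x

/-- The Cartan connection on `𝔤`: `∇_Y s = t (ad_s Y) + [tY, s]`. -/
def cartanConnection (Y : VField E M) (s : JetSection E M) : JetSection E M where
  field := (splitting (s.ad Y)).field + ((splitting Y).bracket s).field
  endo := (splitting (s.ad Y)).endo + ((splitting Y).bracket s).endo

/-- `s` is parallel over `U` for the Cartan connection. -/
def JetSection.IsParallelOn (s : JetSection E M) (U : Set M) : Prop :=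
  ∀ Y : VField E M, SmoothOn Y U → ∀ x ∈ U, (cartanConnection Y s).eval x = 0

variable (E M) in
/-- The Cartan algebroid `(𝔤, ∇)` is locally symmetric: every point has a connected open
neighborhood `U` over which `(𝔤, ∇)` coincides with its symmetric part, that is, every element
of `𝔤` over `U` is the value of a section of `𝔤` over `U` that is parallel. -/
def LocallySymmetric : Prop :=
  ∀ m : M, ∃ U : TopologicalSpace.Opens M, m ∈ U ∧ IsConnected (U : Set M) ∧
    ∀ x ∈ U, ∀ ξ ∈ isometryJets (E := E) x, ∃ s : JetSection E M,
      s.IsIsometrySectionOn U ∧ s.IsParallelOn U ∧ s.eval x = ξ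

end Jets

end
end RiemannCartan

/-! Both conditions are compared with a third, `HasAllKillingJets`: near each point `x` there are
Killing fields `V` for which `V x` and the skew endomorphism `∇V x` take any prescribed values. By
`lieMetricVanishesAt_iff` and `jet_eq_jet_iff`, such pairs are exactly the elements of the fiber of
the algebroid at `x`.

Homogeneity: on a connected open set a Killing field is determined by its value and covariant
derivative at one point, because its components satisfy a closed second-order linear system
(`IsKillingOn.eq_zero_of_isPreconnected`). The space of pairs has dimension `n(n+1)/2`, so maximal
dimension means that every pair occurs (`finrank_killingFields_iff`).

Symmetry: for `s = J¹V + φ` the anchor of `∇_Y s` is `-φ(Y)`, so a parallel section is the jet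
prolongation of a Killing field. Conversely the jet of a Killing field is parallel, because Killing
fields are affine: `[V, ∇_X Y] = ∇_[V,X] Y + ∇_X [V,Y]`.

From Killing fields to curvature: affine fields preserve `R`, and expanding `L_V R = 0` gives `∇_V R
= (∇V)·R` (`IsKillingOn.leviCivita_curvature`). Fields with `V x = 0` give invariance, fields with
`∇V x = 0` give parallelism.

From curvature to Killing fields: invariance under all skew endomorphisms forces `R(u,v)w = k(⟪v,w⟫u
- ⟪u,w⟫v)` at each point (`exists_eq_smul_of_invariant`), and parallelism makes `k` locally constant
in every dimension (`exists_hasCurvature_ball`). The system `∇_v W = -k f v`, `df v = ⟪W,v⟫` on `TM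
⊕ ℝ` is then flat (`killingSystem_flat`), so it has local solutions with any value at any point
(`exists_flat_solution`). For two solutions, `f₁W₂ - f₂W₁` is a Killing field whose covariant
derivative is the elementary skew map of `W₂` and `W₁`. Linear combinations of such fields realize
all pairs (`exists_killingFields_of_curvature`). In the model spaces this is the passage from an
ambient vector space of dimension `n+1` to its exterior square. -/

namespace RiemannCartan

/-! ### Flat linear systems of partial differential equations -/

section FlatSystem

set_option maxSynthPendingDepth 3

variable {E F : Type*} [NormedAddCommGroup E] [NormedSpace ℝ E] [NormedAddCommGroup F]
  [NormedSpace ℝ F] {A : E → E →L[ℝ] F →L[ℝ] F}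

/-- The linear system `ds = A s` has a solution along the segment from `p` to `p + x` if this
segment lies in a ball where `A` is bounded by the inverse of twice the radius. -/
theorem exists_radial_solution [CompleteSpace F] {p : E} {ρ K : ℝ}
    (hcont : ContinuousOn A (Metric.ball p ρ)) (hK : ∀ z ∈ Metric.ball p ρ, ‖A z‖ ≤ K)
    (hKρ : K * ρ ≤ 1 / 2) (s₀ : F) {x : E} (hx : ‖x‖ < ρ) :
    ∃ u : ℝ → F, u 0 = s₀ ∧ ∀ t ∈ Icc (0 : ℝ) 1,
      HasDerivWithinAt u (A (p + t • x) x (u t)) (Icc 0 1) t := by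
  have hmem : ∀ t ∈ Icc (0 : ℝ) 1, p + t • x ∈ Metric.ball p ρ := fun t ht ↦ by
    rw [mem_ball_iff_norm, add_sub_cancel_left, norm_smul, Real.norm_of_nonneg ht.1]
    exact (mul_le_of_le_one_left (norm_nonneg _) ht.2).trans_lt hx
  have hρ : 0 < ρ := (norm_nonneg x).trans_lt hx
  have hK0 : 0 ≤ K := (norm_nonneg _).trans (hK p (Metric.mem_ball_self hρ))
  have hop : ∀ t ∈ Icc (0 : ℝ) 1, ‖A (p + t • x) x‖ ≤ 1 / 2 := fun t ht ↦ by
    refine ((A (p + t • x)).le_opNorm x).trans (le_trans ?_ hKρ)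
    exact mul_le_mul (hK _ (hmem t ht)) hx.le (norm_nonneg _) hK0
  -- Within distance `‖s₀‖ + 1` of `s₀` one has `‖u‖ ≤ 2‖s₀‖ + 1`, so the velocity is at most half
  -- of that, hence at most `‖s₀‖ + 1`: the solution cannot leave this ball in unit time.
  have hPL : IsPicardLindelof (fun t u ↦ A (p + t • x) x u)
      (⟨0, by simp⟩ : Icc (0 : ℝ) 1) s₀ (‖s₀‖₊ + 1) 0 (‖s₀‖₊ + 1) 1 := by
    refine ⟨fun t ht ↦ ?_, fun u _ ↦ ?_, fun t ht u hu ↦ ?_, by simp⟩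
    · refine ((A (p + t • x) x).lipschitz.weaken ?_).lipschitzOnWith
      have := hop t ht
      rw [← NNReal.coe_le_coe]
      simp only [coe_nnnorm, NNReal.coe_one]
      linarith
    · have h1 : ContinuousOn (fun t : ℝ ↦ A (p + t • x)) (Icc 0 1) :=
        hcont.comp (by fun_prop) hmem
      exact (h1.clm_apply continuousOn_const).clm_apply continuousOn_const
    · have h1 : ‖u‖ ≤ 2 * ‖s₀‖ + 1 := by
        have h2 : ‖u - s₀‖ ≤ ‖s₀‖ + 1 := by simpa [dist_eq_norm] using hu
        have := norm_sub_norm_le u s₀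
        linarith
      refine ((A (p + t • x) x).le_opNorm u).trans ?_
      have := mul_le_mul (hop t ht) h1 (norm_nonneg u) (by norm_num)
      simp only [NNReal.coe_add, coe_nnnorm, NNReal.coe_one]
      linarith
  simpa using hPL.exists_eq_forall_mem_Icc_hasDerivWithinAt₀

/-- Mean value inequality on the segment from `a` to `b`, where the derivative differs from `f' a`
by at most `C ‖b - a‖`. -/
theorem norm_taylor_le {G : Type*} [NormedAddCommGroup G] [NormedSpace ℝ G] {f : E → G}
    {f' : E → E →L[ℝ] G} {s : Set E} (hs : Convex ℝ s) (hf : ∀ z ∈ s, HasFDerivAt f (f' z) z)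
    {C : ℝ} (hC : 0 ≤ C) (hlip : ∀ y ∈ s, ∀ z ∈ s, ‖f' y - f' z‖ ≤ C * ‖y - z‖)
    {a b : E} (ha : a ∈ s) (hb : b ∈ s) :
    ‖f b - f a - f' a (b - a)‖ ≤ C * ‖b - a‖ * ‖b - a‖ := by
  have hsub : segment ℝ a b ⊆ s := hs.segment_subset ha hb
  refine Convex.norm_image_sub_le_of_norm_hasFDerivWithin_le' (s := segment ℝ a b)
    (fun z hz ↦ (hf z (hsub hz)).hasFDerivWithinAt) (fun z hz ↦ ?_) (convex_segment a b)
    (left_mem_segment ℝ a b) (right_mem_segment ℝ a b)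
  refine (hlip z (hsub hz) a ha).trans (mul_le_mul_of_nonneg_left ?_ hC)
  obtain ⟨θ, hθ, rfl⟩ := (segment_eq_image' ℝ a b ▸ hz :)
  rw [add_sub_cancel_left, norm_smul, Real.norm_of_nonneg hθ.1]
  exact mul_le_of_le_one_left (norm_nonneg _) hθ.2

/-- The radial solutions of a flat linear system `ds = A s` fit together to a solution: their end
points depend differentiably on the end point of the segment. -/
theorem hasFDerivAt_of_radial_solutions {A' : E → E →L[ℝ] E →L[ℝ] F →L[ℝ] F} {p : E}
    {ρ K K₁ K₂ : ℝ}
    (hA : ∀ z ∈ Metric.ball p ρ, HasFDerivAt A (A' z) z)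
    (hK : ∀ z ∈ Metric.ball p ρ, ‖A z‖ ≤ K)
    (hK₁ : ∀ y ∈ Metric.ball p ρ, ∀ z ∈ Metric.ball p ρ, ‖A y - A z‖ ≤ K₁ * ‖y - z‖)
    (hK₂ : ∀ y ∈ Metric.ball p ρ, ∀ z ∈ Metric.ball p ρ, ‖A' y - A' z‖ ≤ K₂ * ‖y - z‖)
    (hK₁0 : 0 ≤ K₁) (hK₂0 : 0 ≤ K₂) (hρ1 : ρ ≤ 1) (hKρ : K * ρ ≤ 1 / 2)
    (flat : ∀ z ∈ Metric.ball p ρ, ∀ (u v : E) (s : F),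
      A' z u v s + A z v (A z u s) = A' z v u s + A z u (A z v s))
    {s₀ : F} {U : E → ℝ → F}
    (hU0 : ∀ x, ‖x‖ < ρ → U x 0 = s₀)
    (hU : ∀ x, ‖x‖ < ρ → ∀ t ∈ Icc (0 : ℝ) 1,
      HasDerivWithinAt (U x) (A (p + t • x) x (U x t)) (Icc 0 1) t)
    {x : E} (hx : ‖x‖ < ρ) :
    HasFDerivAt (fun x ↦ U x 1) ((A (p + x)).flip (U x 1)) x := by
  have hρ : 0 < ρ := (norm_nonneg x).trans_lt hx
  have hK0 : 0 ≤ K := (norm_nonneg _).trans (hK p (Metric.mem_ball_self hρ))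
  have hmem : ∀ x : E, ‖x‖ < ρ → ∀ t ∈ Icc (0 : ℝ) 1, p + t • x ∈ Metric.ball p ρ :=
    fun x hx t ht ↦ by
      rw [mem_ball_iff_norm, add_sub_cancel_left, norm_smul, Real.norm_of_nonneg ht.1]
      exact (mul_le_of_le_one_left (norm_nonneg _) ht.2).trans_lt hx
  have hUc : ∀ x, ‖x‖ < ρ → ContinuousOn (U x) (Icc 0 1) :=
    fun x hx t ht ↦ (hU x hx t ht).continuousWithinAt
  obtain ⟨N, hN⟩ := isCompact_Icc.exists_bound_of_continuousOn (hUc x hx)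
  have hN0 : 0 ≤ N := (norm_nonneg _).trans (hN 0 (by simp))
  set C : ℝ := K₂ * N + K₁ * N + K₁ * (2 * (K * N)) + K * (K * N) with hC
  have hC0 : 0 ≤ C := by positivity
  have key : ∀ v : E, ‖x + v‖ < ρ → ‖v‖ ≤ 1 →
      ‖U (x + v) 1 - U x 1 - A (p + x) v (U x 1)‖ ≤ gronwallBound 0 1 C 1 * ‖v‖ ^ 2 := by
    intro v hxv hv1
    -- If a solution `s` exists, its derivative along `t • v` at `p + t • x` is `t • A v s`. So `D`
    -- is the error of the expected first-order approximation, and it suffices to bound it by a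
    -- multiple of `‖v‖ ^ 2`.
    set D : ℝ → F := fun t ↦ U (x + v) t - (U x t + t • A (p + t • x) v (U x t)) with hD
    set D' : ℝ → F := fun t ↦ A (p + t • (x + v)) (x + v) (U (x + v) t) -
      (A (p + t • x) x (U x t) + (t • (A' (p + t • x) x v (U x t) +
        A (p + t • x) v (A (p + t • x) x (U x t))) + A (p + t • x) v (U x t))) with hD'
    have hDD : ∀ t ∈ Icc (0 : ℝ) 1, HasDerivWithinAt D (D' t) (Icc 0 1) t := by
      intro t ht
      refine (hU _ hxv t ht).sub ((hU _ hx t ht).add ?_)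
      have h1 : HasDerivWithinAt (fun t : ℝ ↦ A (p + t • x)) (A' (p + t • x) x) (Icc 0 1) t := by
        have h2 : HasDerivAt (fun t : ℝ ↦ p + t • x) x t := by
          simpa using ((hasDerivAt_id t).smul_const x).const_add p
        exact ((hA _ (hmem x hx t ht)).comp_hasDerivAt t h2).hasDerivWithinAt
      have h3 : HasDerivWithinAt (fun t : ℝ ↦ A (p + t • x) v) (A' (p + t • x) x v)
          (Icc 0 1) t := by
        simpa using h1.clm_apply (hasDerivWithinAt_const t _ v)
      have h4 := h3.clm_apply (hU _ hx t ht)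
      simpa using! (hasDerivWithinAt_id t _).smul h4
    have hbound : ∀ t ∈ Icc (0 : ℝ) 1, ‖D' t‖ ≤ 1 * ‖D t‖ + C * ‖v‖ ^ 2 := by
      intro t ht
      set a := p + t • x with ha
      have haB : a ∈ Metric.ball p ρ := hmem x hx t ht
      have hbB : p + t • (x + v) ∈ Metric.ball p ρ := hmem _ hxv t ht
      set b := p + t • (x + v) with hb
      have hba : b - a = t • v := by rw [ha, hb]; module
      have hbn : ‖b - a‖ ≤ ‖v‖ := by
        rw [hba, norm_smul, Real.norm_of_nonneg ht.1]
        exact mul_le_of_le_one_left (norm_nonneg _) ht.2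
      set u := U x t with hu
      have hun : ‖u‖ ≤ N := hN t ht
      have hB : ‖A b - A a - A' a (t • v)‖ ≤ K₂ * ‖v‖ * ‖v‖ := by
        have := norm_taylor_le (convex_ball p ρ) hA hK₂0 hK₂ haB hbB
        rw [hba] at this hbn
        refine this.trans ?_
        gcongr
      have hA1 : ‖A b - A a‖ ≤ K₁ * ‖v‖ := (hK₁ b hbB a haB).trans (by gcongr)
      have hAv : ‖A a v u‖ ≤ K * ‖v‖ * N := by
        refine ((A a v).le_opNorm u).trans ?_
        have := ((A a).le_opNorm v).trans (mul_le_mul_of_nonneg_right (hK a haB) (norm_nonneg v))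
        gcongr
      have hflat := flat a haB x v u
      -- Flatness exchanges `x` and `v` in `A'`, which cancels every term of first order in `v`.
      -- What remains is linear in `D`, plus four terms quadratic in `v` whose bounds add up to `C
      -- ‖v‖ ^ 2`; Grönwall's inequality applies.
      have e : D' t = A b (x + v) (D t) + ((A b - A a - A' a (t • v)) x u + (A b - A a) v u
          + t • (A b - A a) (x + v) (A a v u) + t • A a v (A a v u)) := by
        have hflat' : A' a x v u = A' a v x u + A a x (A a v u) - A a v (A a x u) := by
          rw [← hflat]; abel
        simp only [hD', hD, ← ha, ← hb, ← hu, hflat', map_sub, map_add, map_smul, sub_apply,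
          add_apply, smul_apply]
        module
      have hxvn : ‖x + v‖ ≤ 1 := hxv.le.trans hρ1
      have hxn : ‖x‖ ≤ 1 := hx.le.trans hρ1
      have n0 : ‖A b (x + v) (D t)‖ ≤ 1 * ‖D t‖ := by
        refine ((A b (x + v)).le_opNorm _).trans (mul_le_mul_of_nonneg_right ?_ (norm_nonneg _))
        refine ((A b).le_opNorm _).trans ?_
        have := mul_le_mul (hK b hbB) hxv.le (norm_nonneg _) hK0
        linarith
      have n1 : ‖(A b - A a - A' a (t • v)) x u‖ ≤ K₂ * N * ‖v‖ ^ 2 := by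
        calc _ ≤ ‖A b - A a - A' a (t • v)‖ * ‖x‖ * ‖u‖ := ContinuousLinearMap.le_opNorm₂ _ _ _
          _ ≤ (K₂ * ‖v‖ * ‖v‖) * 1 * N := by gcongr
          _ = _ := by ring
      have n2 : ‖(A b - A a) v u‖ ≤ K₁ * N * ‖v‖ ^ 2 := by
        calc _ ≤ ‖A b - A a‖ * ‖v‖ * ‖u‖ := ContinuousLinearMap.le_opNorm₂ _ _ _
          _ ≤ (K₁ * ‖v‖) * ‖v‖ * N := by gcongr
          _ = _ := by ring
      have n3 : ‖t • (A b - A a) (x + v) (A a v u)‖ ≤ K₁ * (2 * (K * N)) * ‖v‖ ^ 2 := by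
        rw [norm_smul, Real.norm_of_nonneg ht.1]
        calc _ ≤ 1 * (‖A b - A a‖ * ‖x + v‖ * ‖A a v u‖) := by
              refine mul_le_mul ht.2 (ContinuousLinearMap.le_opNorm₂ _ _ _) (norm_nonneg _) zero_le_one
          _ ≤ 1 * ((K₁ * ‖v‖) * 2 * (K * ‖v‖ * N)) := by
              gcongr
              linarith
          _ = _ := by ring
      have n4 : ‖t • A a v (A a v u)‖ ≤ K * (K * N) * ‖v‖ ^ 2 := by
        rw [norm_smul, Real.norm_of_nonneg ht.1]
        calc _ ≤ 1 * (‖A a‖ * ‖v‖ * ‖A a v u‖) := by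
              refine mul_le_mul ht.2 (ContinuousLinearMap.le_opNorm₂ _ _ _) (norm_nonneg _) zero_le_one
          _ ≤ 1 * (K * ‖v‖ * (K * ‖v‖ * N)) := by
              gcongr
              exact hK a haB
          _ = _ := by ring
      rw [e]
      refine (norm_add_le _ _).trans (add_le_add n0 ?_)
      have := norm_add₄_le (a := (A b - A a - A' a (t • v)) x u) (b := (A b - A a) v u)
        (c := t • (A b - A a) (x + v) (A a v u)) (d := t • A a v (A a v u))
      rw [hC]
      linarith
    have hDc : ContinuousOn D (Icc 0 1) := fun t ht ↦ (hDD t ht).continuousWithinAt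
    have hg := norm_le_gronwallBound_of_norm_deriv_right_le (δ := 0) hDc
      (fun t ht ↦ (hDD t ⟨ht.1, ht.2.le⟩).mono_of_mem_nhdsWithin
        (Icc_mem_nhdsGE_of_mem ⟨ht.1, ht.2⟩))
      (by simp [hD, hU0 x hx, hU0 _ hxv]) (fun t ht ↦ hbound t ⟨ht.1, ht.2.le⟩) 1 (by simp)
    have e2 : gronwallBound 0 1 (C * ‖v‖ ^ 2) (1 - 0) = gronwallBound 0 1 C 1 * ‖v‖ ^ 2 := by
      simp only [gronwallBound_of_K_ne_0 (one_ne_zero)]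
      ring_nf
    rw [e2] at hg
    refine le_of_eq_of_le ?_ hg
    simp only [hD, one_smul]
    congr 1
    abel
  rw [hasFDerivAt_iff_isLittleO_nhds_zero]
  have hO : (fun v ↦ U (x + v) 1 - U x 1 - (A (p + x)).flip (U x 1) v)
      =O[𝓝 0] fun v : E ↦ ‖v‖ ^ 2 := by
    refine Asymptotics.IsBigO.of_bound (gronwallBound 0 1 C 1) ?_
    have h1 : ∀ᶠ v : E in 𝓝 0, ‖x + v‖ < ρ :=
      (by fun_prop : Continuous fun v : E ↦ ‖x + v‖).continuousAt.eventually_lt_const (by simpa)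
    have h2 : ∀ᶠ v : E in 𝓝 0, ‖v‖ < 1 :=
      continuous_norm.continuousAt.eventually_lt_const (by simp)
    filter_upwards [h1, h2] with v hv1 hv2
    simpa using key v hv1 hv2.le
  refine hO.trans_isLittleO ?_
  simpa using (Asymptotics.isLittleO_norm_pow_id one_lt_two : (fun v : E ↦ ‖v‖ ^ 2) =o[𝓝 0] _)

/-- **Frobenius theorem for linear systems.** If the linear system `ds = A s` satisfies the
integrability condition then it has, on a suitable ball around each point, solutions with any
prescribed value at any point of the ball. -/
theorem exists_flat_solution [CompleteSpace F] {Ω : Set E} (hΩ : IsOpen Ω)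
    (hA : ContDiffOn ℝ ∞ A Ω)
    (flat : ∀ z ∈ Ω, ∀ (u v : E) (s : F),
      fderiv ℝ A z u v s + A z v (A z u s) = fderiv ℝ A z v u s + A z u (A z v s))
    {c : E} (hc : c ∈ Ω) :
    ∃ r > 0, Metric.ball c r ⊆ Ω ∧ ∀ p ∈ Metric.ball c r, ∀ s₀ : F, ∃ s : E → F, s p = s₀ ∧
      ∀ z ∈ Metric.ball c r, HasFDerivAt s ((A z).flip (s z)) z := by
  have hAc : ContDiffAt ℝ ∞ A c := hA.contDiffAt (hΩ.mem_nhds hc)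
  have hA'c : ContDiffAt ℝ 1 (fderiv ℝ A) c :=
    hAc.fderiv_right (m := 1) (by norm_num; exact ENat.LEInfty.out)
  obtain ⟨K₁, t₁, ht₁, hK₁⟩ := (hAc.of_le (m := 1) (by exact_mod_cast le_top)).exists_lipschitzOnWith
  obtain ⟨K₂, t₂, ht₂, hK₂⟩ := hA'c.exists_lipschitzOnWith
  have hb : ∀ᶠ z in 𝓝 c, ‖A z‖ < ‖A c‖ + 1 :=
    hAc.continuousAt.norm.eventually_lt_const (lt_add_one _)
  obtain ⟨R, hR, hRs⟩ := Metric.mem_nhds_iff.1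
    (Filter.inter_mem (Filter.inter_mem ht₁ ht₂) (Filter.inter_mem hb (hΩ.mem_nhds hc)))
  set K := ‖A c‖ + 1
  have hK : 0 < K := by positivity
  -- The solution is claimed on the ball of radius `ρ / 2`: any two of its points are less than `ρ`
  -- apart, so radial solutions from any `p` in it reach all of it, while the balls of radius `ρ`
  -- around such `p` stay inside the ball of radius `R`, where all bounds hold.
  set ρ := min (min (R / 2) 1) (1 / (2 * K)) with hρdef
  have hρ : 0 < ρ := by positivity
  have hρR : ρ ≤ R / 2 := (min_le_left _ _).trans (min_le_left _ _)
  have hρ1 : ρ ≤ 1 := (min_le_left _ _).trans (min_le_right _ _)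
  have hKρ : K * ρ ≤ 1 / 2 := by
    have : ρ ≤ 1 / (2 * K) := min_le_right _ _
    calc K * ρ ≤ K * (1 / (2 * K)) := by gcongr
      _ = 1 / 2 := by field_simp
  refine ⟨ρ / 2, half_pos hρ, fun z hz ↦ (hRs (Metric.ball_subset_ball (by linarith) hz)).2.2,
    fun p hp s₀ ↦ ?_⟩
  have hsub : Metric.ball p ρ ⊆ Metric.ball c R := by
    refine Metric.ball_subset_ball' ?_
    have := Metric.mem_ball.1 hp
    linarith
  have hd : ∀ z ∈ Metric.ball p ρ, HasFDerivAt A (fderiv ℝ A z) z := fun z hz ↦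
    ((hA.contDiffAt (hΩ.mem_nhds (hRs (hsub hz)).2.2)).differentiableAt (by simp)).hasFDerivAt
  have hKz : ∀ z ∈ Metric.ball p ρ, ‖A z‖ ≤ K := fun z hz ↦ (hRs (hsub hz)).2.1.le
  choose! U hU0 hU using fun (x : E) (hx : ‖x‖ < ρ) ↦ exists_radial_solution (p := p)
    (fun z hz ↦ (hd z hz).continuousAt.continuousWithinAt) hKz hKρ s₀ hx
  have hUx := fun (x : E) (hx : ‖x‖ < ρ) ↦ hasFDerivAt_of_radial_solutions hd hKz
    (fun y hy z hz ↦ (lipschitzOnWith_iff_norm_sub_le.1 hK₁) (hRs (hsub hy)).1.1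
      (hRs (hsub hz)).1.1)
    (fun y hy z hz ↦ (lipschitzOnWith_iff_norm_sub_le.1 hK₂) (hRs (hsub hy)).1.2
      (hRs (hsub hz)).1.2)
    K₁.2 K₂.2 hρ1 hKρ (fun z hz ↦ flat z (hRs (hsub hz)).2.2) hU0 hU hx
  -- Along the degenerate segment the radial equation has zero right-hand side.
  have hzero : U 0 1 = s₀ := by
    have h0 : ‖(0 : E)‖ < ρ := by simpa
    have := constant_of_has_deriv_right_zero (fun t ht ↦ (hU 0 h0 t ht).continuousWithinAt)
      (fun t ht ↦ by
        have := (hU 0 h0 t ⟨ht.1, ht.2.le⟩).mono_of_mem_nhdsWithin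
          (Icc_mem_nhdsGE_of_mem ⟨ht.1, ht.2⟩)
        simpa using this) 1 (by simp)
    rw [this, hU0 0 h0]
  refine ⟨fun z ↦ U (z - p) 1, by simpa, fun z hz ↦ ?_⟩
  have hzp : ‖z - p‖ < ρ := by
    rw [← dist_eq_norm]
    have h1 := Metric.mem_ball.1 hz
    have h2 := Metric.mem_ball'.1 hp
    have := dist_triangle z c p
    linarith
  have h1 := hUx (z - p) hzp
  rw [add_sub_cancel] at h1
  simpa using! h1.comp z ((hasFDerivAt_id z).sub_const p)

/-- Differentiable solutions of a smooth linear system are smooth. -/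
theorem contDiffOn_of_hasFDerivAt_clm {Ω : Set E} (hΩ : IsOpen Ω) (hA : ContDiffOn ℝ ∞ A Ω)
    {s : E → F} (hs : ∀ z ∈ Ω, HasFDerivAt s ((A z).flip (s z)) z) : ContDiffOn ℝ ∞ s Ω := by
  have hd : DifferentiableOn ℝ s Ω := fun z hz ↦ (hs z hz).differentiableAt.differentiableWithinAt
  rw [contDiffOn_infty]
  intro n
  induction n with
  | zero => exact contDiffOn_zero.2 hd.continuousOn
  | succ n ih =>
    push_cast
    rw [contDiffOn_succ_iff_fderiv_of_isOpen hΩ]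
    refine ⟨hd, by simp, ?_⟩
    have h1 : ContDiffOn ℝ n (fun z ↦ (A z).flip) Ω :=
      ((ContinuousLinearMap.flipₗᵢ ℝ E F F).contDiff.comp_contDiffOn
        (hA.of_le (by exact_mod_cast le_top)))
    -- Bootstrapping: the equation expresses the derivative of `s` through `s` itself, so each step
    -- gains one order of differentiability.
    exact (h1.clm_apply ih).congr fun z hz ↦ (hs z hz).fderiv

end FlatSystem

/-! ### Vector fields in charts -/

section Charts

noncomputable section

set_option maxSynthPendingDepth 3
set_option linter.unusedSectionVars false

variable {E : Type*} [NormedAddCommGroup E] [NormedSpace ℝ E]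
  {M : Type*} [TopologicalSpace M] [ChartedSpace E M] [IsManifold 𝓘(ℝ, E) ∞ M]

/-- The tangent vector at `y` with coordinates `v` in the preferred chart at `m`. -/
def fromCoord (m y : M) : E →L[ℝ] TangentSpace 𝓘(ℝ, E) y :=
  (trivializationAt E (TangentSpace 𝓘(ℝ, E)) m).symmL ℝ y

/-- The coordinates of a tangent vector at `y` in the preferred chart at `m`. -/
def toCoord (m y : M) : TangentSpace 𝓘(ℝ, E) y →L[ℝ] E :=
  (trivializationAt E (TangentSpace 𝓘(ℝ, E)) m).continuousLinearMapAt ℝ y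

variable {m y : M}

theorem toCoord_fromCoord (hy : y ∈ (chartAt E m).source) (v : E) :
    toCoord m y (fromCoord m y v) = v :=
  (trivializationAt E (TangentSpace 𝓘(ℝ, E)) m).continuousLinearMapAt_symmL hy v

theorem fromCoord_toCoord (hy : y ∈ (chartAt E m).source) (v : TangentSpace 𝓘(ℝ, E) y) :
    fromCoord m y (toCoord m y v) = v :=
  (trivializationAt E (TangentSpace 𝓘(ℝ, E)) m).symmL_continuousLinearMapAt hy v

theorem toCoord_apply (hy : y ∈ (chartAt E m).source) (v : TangentSpace 𝓘(ℝ, E) y) :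
    toCoord m y v =
      (trivializationAt E (TangentSpace 𝓘(ℝ, E)) m (⟨y, v⟩ : TangentBundle 𝓘(ℝ, E) M)).2 :=
  Trivialization.continuousLinearMapAt_apply_of_mem ℝ _ hy v

theorem toCoord_eq_mfderiv (hy : y ∈ (chartAt E m).source) :
    toCoord m y = mfderiv% (extChartAt 𝓘(ℝ, E) m) y :=
  TangentBundle.continuousLinearMapAt_trivializationAt hy

theorem inverse_toCoord (hy : y ∈ (chartAt E m).source) :
    (toCoord (E := E) m y).inverse = fromCoord (E := E) m y :=
  ContinuousLinearMap.inverse_eq (ContinuousLinearMap.ext fun v ↦ toCoord_fromCoord hy v)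
    (ContinuousLinearMap.ext fun v ↦ fromCoord_toCoord hy v)

theorem mpullback_extChartAt (hy : y ∈ (chartAt E m).source)
    (w : Π z : E, TangentSpace 𝓘(ℝ, E) z) :
    mpullback 𝓘(ℝ, E) 𝓘(ℝ, E) (extChartAt 𝓘(ℝ, E) m) w y =
      fromCoord (E := E) m y (w (extChartAt 𝓘(ℝ, E) m y)) := by
  have h := inverse_toCoord hy
  rw [toCoord_eq_mfderiv hy] at h
  exact congrArg (fun L : E →L[ℝ] TangentSpace 𝓘(ℝ, E) y ↦ L (w (extChartAt 𝓘(ℝ, E) m y))) h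

/-- The vector field with components `w` in the preferred chart at `m`. -/
def chartField (m : M) (w : E → E) : VField E M :=
  fun y ↦ fromCoord m y (w (extChartAt 𝓘(ℝ, E) m y))

/-- The components of the vector field `V` in the preferred chart at `m`. -/
def chartRep (m : M) (V : VField E M) (z : E) : E :=
  toCoord m ((extChartAt 𝓘(ℝ, E) m).symm z) (V ((extChartAt 𝓘(ℝ, E) m).symm z))

theorem chartRep_extChartAt (hy : y ∈ (chartAt E m).source) (V : VField E M) :
    chartRep m V (extChartAt 𝓘(ℝ, E) m y) = toCoord m y (V y) := by
  have : (extChartAt 𝓘(ℝ, E) m).symm (extChartAt 𝓘(ℝ, E) m y) = y :=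
    (extChartAt 𝓘(ℝ, E) m).left_inv (by simpa using hy)
  rw [chartRep, this]

theorem symm_mem_source {z : E} (hz : z ∈ (extChartAt 𝓘(ℝ, E) m).target) :
    (extChartAt 𝓘(ℝ, E) m).symm z ∈ (chartAt E m).source := by
  simpa using (extChartAt 𝓘(ℝ, E) m).map_target hz

theorem extChartAt_mem_target (hy : y ∈ (chartAt E m).source) :
    extChartAt 𝓘(ℝ, E) m y ∈ (extChartAt 𝓘(ℝ, E) m).target :=
  (extChartAt 𝓘(ℝ, E) m).map_source (by simpa using hy)

theorem chartRep_chartField {z : E} (hz : z ∈ (extChartAt 𝓘(ℝ, E) m).target) (w : E → E) :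
    chartRep m (chartField m w) z = w z := by
  rw [chartRep, chartField, toCoord_fromCoord (symm_mem_source hz),
    (extChartAt 𝓘(ℝ, E) m).right_inv hz]

theorem chartField_chartRep (hy : y ∈ (chartAt E m).source) (V : VField E M) :
    chartField m (chartRep m V) y = V y := by
  rw [chartField, chartRep_extChartAt hy, fromCoord_toCoord hy]

theorem chartField_chartRep_eventuallyEq (hy : y ∈ (chartAt E m).source) (V : VField E M) :
    V =ᶠ[𝓝 y] chartField m (chartRep m V) := by
  filter_upwards [(chartAt E m).open_source.mem_nhds hy] with x hx
  exact (chartField_chartRep hx V).symm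

theorem isOpen_extChartAt_preimage_inter (m : M) {s : Set E} (hs : IsOpen s) :
    IsOpen ((chartAt E m).source ∩ extChartAt 𝓘(ℝ, E) m ⁻¹' s) := by
  simpa using isOpen_extChartAt_preimage (I := 𝓘(ℝ, E)) m hs

theorem isOpen_target_inter_preimage (m : M) {U : Set M} (hU : IsOpen U) :
    IsOpen ((extChartAt 𝓘(ℝ, E) m).target ∩ (extChartAt 𝓘(ℝ, E) m).symm ⁻¹' U) :=
  (continuousOn_extChartAt_symm m).isOpen_inter_preimage (isOpen_extChartAt_target m) hU

theorem contMDiffOn_comp_extChartAt {G : Type*} [NormedAddCommGroup G] [NormedSpace ℝ G]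
    {w : E → G} {s : Set E} (hw : ContDiffOn ℝ ∞ w s) :
    ContMDiffOn 𝓘(ℝ, E) 𝓘(ℝ, G) ∞ (fun y ↦ w (extChartAt 𝓘(ℝ, E) m y))
      ((chartAt E m).source ∩ extChartAt 𝓘(ℝ, E) m ⁻¹' s) :=
  hw.contMDiffOn.comp ((contMDiffOn_extChartAt (x := m)).mono inter_subset_left) fun _ hy ↦ hy.2

theorem contDiffOn_comp_extChartAt_symm {G : Type*} [NormedAddCommGroup G] [NormedSpace ℝ G]
    {f : M → G} {U : Set M} (hf : ContMDiffOn 𝓘(ℝ, E) 𝓘(ℝ, G) ∞ f U) :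
    ContDiffOn ℝ ∞ (fun z ↦ f ((extChartAt 𝓘(ℝ, E) m).symm z))
      ((extChartAt 𝓘(ℝ, E) m).target ∩ (extChartAt 𝓘(ℝ, E) m).symm ⁻¹' U) :=
  (hf.comp ((contMDiffOn_extChartAt_symm m).mono inter_subset_left) fun _ hy ↦ hy.2).contDiffOn

theorem toCoord_chartField (w : E → E) (hy : y ∈ (chartAt E m).source) :
    (trivializationAt E (TangentSpace 𝓘(ℝ, E)) m
      (⟨y, chartField m w y⟩ : TangentBundle 𝓘(ℝ, E) M)).2 = w (extChartAt 𝓘(ℝ, E) m y) := by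
  rw [← toCoord_apply hy, chartField, toCoord_fromCoord hy]

theorem smoothOn_chartField {w : E → E} {s : Set E} (hs : IsOpen s) (hw : ContDiffOn ℝ ∞ w s) :
    SmoothOn (chartField m w) ((chartAt E m).source ∩ extChartAt 𝓘(ℝ, E) m ⁻¹' s) := by
  refine ((trivializationAt E (TangentSpace 𝓘(ℝ, E)) m).contMDiffOn_section_iff
    (isOpen_extChartAt_preimage_inter m hs) inter_subset_left).2 ?_
  exact (contMDiffOn_comp_extChartAt hw).congr fun x hx ↦ toCoord_chartField w hx.1

theorem smoothOn_chartField_const (m : M) (v : E) :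
    SmoothOn (chartField m fun _ ↦ v) (chartAt E m).source := by
  simpa using smoothOn_chartField (m := m) isOpen_univ (contDiffOn_const (c := v))

theorem contDiffOn_chartRep {V : VField E M} {U : Set M} (hU : IsOpen U) (hV : SmoothOn V U) :
    ContDiffOn ℝ ∞ (chartRep m V)
      ((extChartAt 𝓘(ℝ, E) m).target ∩ (extChartAt 𝓘(ℝ, E) m).symm ⁻¹' U) := by
  have h := ((trivializationAt E (TangentSpace 𝓘(ℝ, E)) m).contMDiffOn_section_iff (IB := 𝓘(ℝ, E))
    (hU.inter (chartAt E m).open_source) inter_subset_right).1 (hV.mono inter_subset_left)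
  refine ((contDiffOn_comp_extChartAt_symm h).mono fun z hz ↦
    ⟨hz.1, hz.2, symm_mem_source hz.1⟩).congr fun z hz ↦ ?_
  exact toCoord_apply (symm_mem_source hz.1) _

theorem mdiffAt_comp_extChartAt {G : Type*} [NormedAddCommGroup G] [NormedSpace ℝ G]
    (hy : y ∈ (chartAt E m).source) {w : E → G}
    (hw : DifferentiableAt ℝ w (extChartAt 𝓘(ℝ, E) m y)) :
    MDiffAt (fun x ↦ w (extChartAt 𝓘(ℝ, E) m x)) y :=
  hw.mdifferentiableAt.comp y (mdifferentiableAt_extChartAt hy)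

theorem mdiffAt_chartField (hy : y ∈ (chartAt E m).source) {w : E → E}
    (hw : DifferentiableAt ℝ w (extChartAt 𝓘(ℝ, E) m y)) : MDiffAt (T% (chartField m w)) y := by
  refine ((trivializationAt E (TangentSpace 𝓘(ℝ, E)) m).mdifferentiableAt_section_iff
    𝓘(ℝ, E) _ hy).2 ?_
  refine (mdiffAt_comp_extChartAt hy hw).congr_of_eventuallyEq ?_
  filter_upwards [(chartAt E m).open_source.mem_nhds hy] with x hx
  exact toCoord_chartField w hx

theorem differentiableAt_chartRep (hy : y ∈ (chartAt E m).source) {V : VField E M}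
    (hV : MDiffAt (T% V) y) : DifferentiableAt ℝ (chartRep m V) (extChartAt 𝓘(ℝ, E) m y) := by
  have h := ((trivializationAt E (TangentSpace 𝓘(ℝ, E)) m).mdifferentiableAt_section_iff
    𝓘(ℝ, E) _ hy).1 hV
  have hsymm : (extChartAt 𝓘(ℝ, E) m).symm (extChartAt 𝓘(ℝ, E) m y) = y :=
    (extChartAt 𝓘(ℝ, E) m).left_inv (by simpa using hy)
  have h2 : MDiffAt (extChartAt 𝓘(ℝ, E) m).symm (extChartAt 𝓘(ℝ, E) m y) :=
    ((contMDiffOn_extChartAt_symm (n := 1) m).contMDiffAt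
      ((isOpen_extChartAt_target m).mem_nhds (extChartAt_mem_target hy))).mdifferentiableAt
      one_ne_zero
  have h3 := (MDifferentiableAt.comp (I' := 𝓘(ℝ, E)) _ (by rw [hsymm]; exact h) h2).differentiableAt
  refine h3.congr_of_eventuallyEq ?_
  filter_upwards [(isOpen_extChartAt_target m).mem_nhds (extChartAt_mem_target hy)] with z hz
  exact toCoord_apply (symm_mem_source hz) _

theorem mvfderiv_comp_extChartAt {G : Type*} [NormedAddCommGroup G] [NormedSpace ℝ G]
    (hy : y ∈ (chartAt E m).source) {w : E → G}
    (hw : DifferentiableAt ℝ w (extChartAt 𝓘(ℝ, E) m y)) (v : TangentSpace 𝓘(ℝ, E) y) :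
    d% (fun x ↦ w (extChartAt 𝓘(ℝ, E) m x)) y v =
      fderiv ℝ w (extChartAt 𝓘(ℝ, E) m y) (toCoord m y v) := by
  have h := mfderiv_comp (I' := 𝓘(ℝ, E)) y hw.mdifferentiableAt
    (mdifferentiableAt_extChartAt (I := 𝓘(ℝ, E)) hy)
  rw [toCoord_eq_mfderiv hy]
  change mfderiv% (w ∘ extChartAt 𝓘(ℝ, E) m) y v = _
  rw [h, mfderiv_eq_fderiv]
  rfl

variable [CompleteSpace E]

/-- The bracket is natural under pullback by the chart, and on the model space it is the commutator
of directional derivatives. -/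
theorem mlieBracket_chartField (hy : y ∈ (chartAt E m).source) {u w : E → E}
    (hu : DifferentiableAt ℝ u (extChartAt 𝓘(ℝ, E) m y))
    (hw : DifferentiableAt ℝ w (extChartAt 𝓘(ℝ, E) m y)) :
    mlieBracket 𝓘(ℝ, E) (chartField m u) (chartField m w) y =
      fromCoord m y (fderiv ℝ w (extChartAt 𝓘(ℝ, E) m y) (u (extChartAt 𝓘(ℝ, E) m y)) -
        fderiv ℝ u (extChartAt 𝓘(ℝ, E) m y) (w (extChartAt 𝓘(ℝ, E) m y))) := by
  have hpull (w : Π z : E, TangentSpace 𝓘(ℝ, E) z) :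
      chartField m w =ᶠ[𝓝 y] mpullback 𝓘(ℝ, E) 𝓘(ℝ, E) (extChartAt 𝓘(ℝ, E) m) w := by
    filter_upwards [(chartAt E m).open_source.mem_nhds hy] with x hx
    exact (mpullback_extChartAt hx w).symm
  have hsec {w : Π z : E, TangentSpace 𝓘(ℝ, E) z}
      (hw : DifferentiableAt ℝ (fun z ↦ (w z : E)) (extChartAt 𝓘(ℝ, E) m y)) :
      MDiffAt (T% w) (extChartAt 𝓘(ℝ, E) m y) := by
    rw [mdifferentiableAt_section]
    simpa using! hw.mdifferentiableAt
  have hM : IsManifold 𝓘(ℝ, E) (minSmoothness ℝ 2) M := by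
    rw [minSmoothness_of_isRCLikeNormedField]
    exact IsManifold.of_le (n := ∞) ENat.LEInfty.out
  have h := mpullback_mlieBracket (n := minSmoothness ℝ 2) (hsec hu) (hsec hw)
    (contMDiffAt_extChartAt' (I := 𝓘(ℝ, E)) hy) le_rfl
  refine ((hpull u).mlieBracket_vectorField_eq (hpull w)).trans (h.symm.trans ?_)
  rw [mpullback_extChartAt hy]
  refine congrArg (fromCoord (E := E) m y) ?_
  exact (congrFun (mlieBracketWithin_univ (V := u) (W := w)).symm _).trans
    ((congrFun (mlieBracketWithin_eq_lieBracketWithin (V := u) (W := w)) _).trans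
      (congrFun (lieBracketWithin_univ (V := u) (W := w)) _))

end

end Charts

/-! ### Smooth vector fields -/

section SmoothFields

noncomputable section

set_option maxSynthPendingDepth 3
set_option linter.unusedSectionVars false

variable {E : Type*} [NormedAddCommGroup E] [NormedSpace ℝ E]
  {M : Type*} [TopologicalSpace M] [ChartedSpace E M] [IsManifold 𝓘(ℝ, E) ∞ M]
  {X Y Z V W : VField E M} {U U' : Set M} {m x y : M} {f g : M → ℝ}

theorem SmoothOn.mono (h : SmoothOn X U) (hs : U' ⊆ U) : SmoothOn X U' := ContMDiffOn.mono h hs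

theorem SmoothOn.congr (h : SmoothOn X U) (hs : ∀ y ∈ U, Y y = X y) : SmoothOn Y U :=
  ContMDiffOn.congr h fun y hy ↦ by rw [hs y hy]

theorem SmoothOn.add (hX : SmoothOn X U) (hY : SmoothOn Y U) : SmoothOn (X + Y) U :=
  ContMDiffOn.add_section hX hY

theorem SmoothOn.sub (hX : SmoothOn X U) (hY : SmoothOn Y U) : SmoothOn (X - Y) U :=
  ContMDiffOn.sub_section hX hY

theorem SmoothOn.neg (hX : SmoothOn X U) : SmoothOn (-X) U := ContMDiffOn.neg_section hX

theorem SmoothOn.smul (hf : CMDiff[U] ∞ f) (hX : SmoothOn X U) : SmoothOn (f • X) U :=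
  ContMDiffOn.smul_section hf hX

theorem SmoothOn.const_smul (c : ℝ) (hX : SmoothOn X U) : SmoothOn (c • X) U :=
  ContMDiffOn.const_smul_section hX

theorem smoothOn_zero : SmoothOn (0 : VField E M) U := (contMDiff_zeroSection ℝ _).contMDiffOn

theorem SmoothOn.smoothNear (h : SmoothOn X U) (hU : IsOpen U) (hx : x ∈ U) : SmoothNear X x :=
  ⟨U, hU, hx, h⟩

theorem SmoothNear.mdiffAt (h : SmoothNear X x) : MDiffAt (T% X) x :=
  let ⟨_, hU, hx, hX⟩ := h
  hX.mdiffAt hU hx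

/-- The extension has constant components in the preferred chart at `x`. -/
theorem smoothOn_extend (v : TangentSpace 𝓘(ℝ, E) x) :
    SmoothOn (FiberBundle.extend E v : VField E M) (chartAt E x).source := by
  refine (smoothOn_chartField_const x (toCoord x x v)).congr fun y hy ↦ ?_
  rw [chartField, fromCoord, Trivialization.symmL_apply _ hy,
    toCoord_apply (mem_chart_source E x)]
  rfl

theorem smoothNear_extend (v : TangentSpace 𝓘(ℝ, E) x) :
    SmoothNear (FiberBundle.extend E v : VField E M) x :=
  (smoothOn_extend v).smoothNear (chartAt E x).open_source (mem_chart_source E x)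

theorem exists_smoothNear (v : TangentSpace 𝓘(ℝ, E) x) :
    ∃ X : VField E M, SmoothNear X x ∧ X x = v :=
  ⟨FiberBundle.extend E v, smoothNear_extend v, by simp⟩

theorem SmoothNear.exists_smoothOn (hX : SmoothNear X x) (hY : SmoothNear Y x) :
    ∃ U : Set M, IsOpen U ∧ x ∈ U ∧ SmoothOn X U ∧ SmoothOn Y U := by
  obtain ⟨U, hU, hxU, hX⟩ := hX
  obtain ⟨U', hU', hxU', hY⟩ := hY
  exact ⟨U ∩ U', hU.inter hU', ⟨hxU, hxU'⟩, hX.mono inter_subset_left, hY.mono inter_subset_right⟩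

theorem SmoothNear.exists_smoothOn₃ (hX : SmoothNear X x) (hY : SmoothNear Y x)
    (hZ : SmoothNear Z x) :
    ∃ U : Set M, IsOpen U ∧ x ∈ U ∧ SmoothOn X U ∧ SmoothOn Y U ∧ SmoothOn Z U := by
  obtain ⟨U, hU, hxU, hX, hY⟩ := hX.exists_smoothOn hY
  obtain ⟨U', hU', hxU', hZ⟩ := hZ
  exact ⟨U ∩ U', hU.inter hU', ⟨hxU, hxU'⟩, hX.mono inter_subset_left, hY.mono inter_subset_left,
    hZ.mono inter_subset_right⟩

theorem mdiffAt_of_contMDiffOn (hf : CMDiff[U] ∞ f) (hU : IsOpen U) (hx : x ∈ U) : MDiffAt f x :=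
  ((hf x hx).contMDiffAt (hU.mem_nhds hx)).mdifferentiableAt (by simp)

theorem comp_extChartAt_symm_eventuallyEq (hy : y ∈ (chartAt E m).source) (f : M → ℝ) :
    f =ᶠ[𝓝 y] fun x ↦ (fun z ↦ f ((extChartAt 𝓘(ℝ, E) m).symm z)) (extChartAt 𝓘(ℝ, E) m x) := by
  filter_upwards [(chartAt E m).open_source.mem_nhds hy] with x hx
  exact congrArg f ((extChartAt 𝓘(ℝ, E) m).left_inv (by simpa using hx)).symm

theorem mvfderiv_congr {f g : M → ℝ} (h : f =ᶠ[𝓝 x] g) : d% f x = d% g x := by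
  ext v
  exact congrArg (fun L : TangentSpace 𝓘(ℝ, E) x →L[ℝ] ℝ ↦ L v) h.mfderiv_eq

theorem contDiffAt_comp_extChartAt_symm (hU : IsOpen U) (hf : CMDiff[U] ∞ f) (hyU : y ∈ U)
    (hy : y ∈ (chartAt E m).source) :
    ContDiffAt ℝ ∞ (fun z ↦ f ((extChartAt 𝓘(ℝ, E) m).symm z)) (extChartAt 𝓘(ℝ, E) m y) := by
  refine (contDiffOn_comp_extChartAt_symm hf).contDiffAt
    ((isOpen_target_inter_preimage m hU).mem_nhds ⟨extChartAt_mem_target hy, ?_⟩)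
  rwa [mem_preimage, (extChartAt 𝓘(ℝ, E) m).left_inv (by simpa using hy)]

theorem mvfderiv_eq_fderiv (hU : IsOpen U) (hf : CMDiff[U] ∞ f) (hyU : y ∈ U)
    (hy : y ∈ (chartAt E m).source) (v : TangentSpace 𝓘(ℝ, E) y) :
    d% f y v = fderiv ℝ (fun z ↦ f ((extChartAt 𝓘(ℝ, E) m).symm z)) (extChartAt 𝓘(ℝ, E) m y)
      (toCoord m y v) := by
  rw [mvfderiv_congr (comp_extChartAt_symm_eventuallyEq hy f)]
  exact mvfderiv_comp_extChartAt hy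
    ((contDiffAt_comp_extChartAt_symm hU hf hyU hy).differentiableAt (by simp)) v

theorem SmoothOn.contDiffAt_chartRep (hU : IsOpen U) (hX : SmoothOn X U) (hyU : y ∈ U)
    (hy : y ∈ (chartAt E m).source) :
    ContDiffAt ℝ ∞ (chartRep m X) (extChartAt 𝓘(ℝ, E) m y) := by
  refine (contDiffOn_chartRep hU hX).contDiffAt
    ((isOpen_target_inter_preimage m hU).mem_nhds ⟨extChartAt_mem_target hy, ?_⟩)
  rwa [mem_preimage, (extChartAt 𝓘(ℝ, E) m).left_inv (by simpa using hy)]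

/-- The derivative of a smooth function along a smooth vector field is smooth. -/
theorem SmoothOn.contMDiffOn_mvfderiv (hU : IsOpen U) (hX : SmoothOn X U) (hf : CMDiff[U] ∞ f) :
    CMDiff[U] ∞ (fun y ↦ d% f y (X y)) := by
  intro m hm
  have hms := mem_chart_source E m
  have h1 : ContDiffAt ℝ ∞ (fun z ↦ fderiv ℝ (fun z ↦ f ((extChartAt 𝓘(ℝ, E) m).symm z)) z
      (chartRep m X z)) (extChartAt 𝓘(ℝ, E) m m) :=
    ((contDiffAt_comp_extChartAt_symm hU hf hm hms).fderiv_right (m := ∞) (by simp)).clm_apply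
      (hX.contDiffAt_chartRep hU hm hms)
  have h2 := h1.contMDiffAt.comp m (contMDiffAt_extChartAt (I := 𝓘(ℝ, E)) (x := m))
  refine (h2.congr_of_eventuallyEq ?_).contMDiffWithinAt
  filter_upwards [hU.mem_nhds hm, (chartAt E m).open_source.mem_nhds hms] with y hyU hy
  rw [mvfderiv_eq_fderiv hU hf hyU hy]
  exact congrArg _ (chartRep_extChartAt hy X).symm

variable [CompleteSpace E]

theorem SmoothOn.mlieBracket (hU : IsOpen U) (hX : SmoothOn X U) (hY : SmoothOn Y U) :
    SmoothOn (mlieBracket 𝓘(ℝ, E) X Y) U := fun y hy ↦ by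
  have hM : IsManifold 𝓘(ℝ, E) ((⊤ : ℕ∞) + 1) M := by
    simpa using (inferInstance : IsManifold 𝓘(ℝ, E) ∞ M)
  have hM2 : IsManifold 𝓘(ℝ, E) (minSmoothness ℝ 2) M := by
    rw [minSmoothness_of_isRCLikeNormedField]
    exact IsManifold.of_le (n := ∞) ENat.LEInfty.out
  exact (ContMDiffAt.mlieBracket_vectorField (m := ⊤) (n := ⊤)
    ((hX y hy).contMDiffAt (hU.mem_nhds hy)) ((hY y hy).contMDiffAt (hU.mem_nhds hy))
    (by simp [minSmoothness_of_isRCLikeNormedField])).contMDiffWithinAt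

/-- The Lie bracket of vector fields is the commutator of the corresponding derivations. -/
theorem mvfderiv_mlieBracket (hU : IsOpen U) (hX : SmoothOn X U) (hY : SmoothOn Y U)
    (hf : CMDiff[U] ∞ f) (hx : x ∈ U) :
    d% f x (VectorField.mlieBracket 𝓘(ℝ, E) X Y x) =
      d% (fun y ↦ d% f y (Y y)) x (X x) - d% (fun y ↦ d% f y (X y)) x (Y x) := by
  have hxs := mem_chart_source E x
  set z := extChartAt 𝓘(ℝ, E) x x with hz
  set w : E → ℝ := fun z ↦ f ((extChartAt 𝓘(ℝ, E) x).symm z) with hw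
  have hwd : ContDiffAt ℝ ∞ w z := contDiffAt_comp_extChartAt_symm hU hf hx hxs
  have hwd' : DifferentiableAt ℝ (fderiv ℝ w) z :=
    (hwd.fderiv_right (m := ∞) (by simp)).differentiableAt (by simp)
  have hXd := hX.contDiffAt_chartRep hU hx hxs
  have hYd := hY.contDiffAt_chartRep hU hx hxs
  -- In coordinates the iterated derivative splits into a Hessian term, symmetric in the two fields
  -- and hence absent from the commutator, and a first-order term that yields the bracket.
  have key {Y X : VField E M} (hY : SmoothOn Y U)
      (hYd : ContDiffAt ℝ ∞ (chartRep x Y) z) :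
      d% (fun y ↦ d% f y (Y y)) x (X x) =
        fderiv ℝ (fderiv ℝ w) z (chartRep x X z) (chartRep x Y z) +
          fderiv ℝ w z (fderiv ℝ (chartRep x Y) z (chartRep x X z)) := by
    have e : (fun y ↦ d% f y (Y y)) =ᶠ[𝓝 x]
        fun y ↦ (fun z ↦ fderiv ℝ w z (chartRep x Y z)) (extChartAt 𝓘(ℝ, E) x y) := by
      filter_upwards [hU.mem_nhds hx, (chartAt E x).open_source.mem_nhds hxs] with y hyU hy
      rw [mvfderiv_eq_fderiv hU hf hyU hy]
      exact congrArg _ (chartRep_extChartAt hy Y).symm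
    rw [mvfderiv_congr e, mvfderiv_comp_extChartAt hxs
      (hwd'.clm_apply (hYd.differentiableAt (by simp))),
      fderiv_clm_apply hwd' (hYd.differentiableAt (by simp))]
    simp only [add_apply, ContinuousLinearMap.coe_comp, Function.comp_apply,
      ContinuousLinearMap.flip_apply]
    rw [hz, chartRep_extChartAt hxs, chartRep_extChartAt hxs]
    ring
  rw [key hY hYd, key hX hXd,
    (chartField_chartRep_eventuallyEq hxs X).mlieBracket_vectorField_eq
      (chartField_chartRep_eventuallyEq hxs Y),
    mlieBracket_chartField hxs (hXd.differentiableAt (by simp)) (hYd.differentiableAt (by simp)),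
    mvfderiv_eq_fderiv hU hf hx hxs, toCoord_fromCoord hxs,
    second_derivative_symmetric_of_eventually (f := w) (f' := fderiv ℝ w) (x := z) ?_
      hwd'.hasFDerivAt (chartRep x X z)]
  · simp only [← hz, ← hw, map_sub]
    ring
  · have := (hwd.of_le (m := 1) ENat.LEInfty.out).eventually (by simp)
    filter_upwards [this] with z hz
    exact (hz.differentiableAt (by simp)).hasFDerivAt

theorem jacobi_mlieBracket (hU : IsOpen U) (hX : SmoothOn X U) (hY : SmoothOn Y U)
    (hZ : SmoothOn Z U) (hx : x ∈ U) :
    VectorField.mlieBracket 𝓘(ℝ, E) X (VectorField.mlieBracket 𝓘(ℝ, E) Y Z) x =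
      VectorField.mlieBracket 𝓘(ℝ, E) (VectorField.mlieBracket 𝓘(ℝ, E) X Y) Z x +
      VectorField.mlieBracket 𝓘(ℝ, E) Y (VectorField.mlieBracket 𝓘(ℝ, E) X Z) x := by
  have hM : IsManifold 𝓘(ℝ, E) (minSmoothness ℝ 3) M := by
    rw [minSmoothness_of_isRCLikeNormedField]
    exact IsManifold.of_le (n := ∞) ENat.LEInfty.out
  have h {X : VField E M} (hX : SmoothOn X U) : CMDiffAt (minSmoothness ℝ 2) (T% X) x := by
    rw [minSmoothness_of_isRCLikeNormedField]
    exact ((hX x hx).contMDiffAt (hU.mem_nhds hx)).of_le ENat.LEInfty.out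
  exact leibniz_identity_mlieBracket_apply (h hX) (h hY) (h hZ)

end

end SmoothFields

/-! ### Smoothness of the Levi-Civita connection -/

section LeviCivitaSmooth

noncomputable section

set_option maxSynthPendingDepth 3
set_option linter.unusedSectionVars false

variable {E : Type*} [NormedAddCommGroup E] [NormedSpace ℝ E]
  {M : Type*} [TopologicalSpace M] [ChartedSpace E M] [IsManifold 𝓘(ℝ, E) ∞ M]
  {X Y Z V W : VField E M} {U U' : Set M} {m x y : M} {f g : M → ℝ}
  [RiemannianBundle (fun x : M ↦ TangentSpace 𝓘(ℝ, E) x)]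
  [IsContMDiffRiemannianBundle 𝓘(ℝ, E) ∞ E (fun x : M ↦ TangentSpace 𝓘(ℝ, E) x)]

theorem SmoothOn.inner (hX : SmoothOn X U) (hY : SmoothOn Y U) :
    CMDiff[U] ∞ (fun y ↦ inner ℝ (X y) (Y y)) :=
  ContMDiffOn.inner_bundle (F := E) (E := fun x : M ↦ TangentSpace 𝓘(ℝ, E) x) (b := id) hX hY

variable [FiniteDimensional ℝ E]

theorem leviCivita_add (hX : MDiffAt (T% X) x) (hY : MDiffAt (T% Y) x) :
    leviCivita E M (X + Y) x = leviCivita E M X x + leviCivita E M Y x :=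
  (leviCivita E M).isCovariantDerivativeOnUniv.add hX hY

theorem leviCivita_smul (hf : MDiffAt f x) (hX : MDiffAt (T% X) x) (v : TangentSpace 𝓘(ℝ, E) x) :
    leviCivita E M (f • X) x v = f x • leviCivita E M X x v + d% f x v • X x := by
  rw [(leviCivita E M).isCovariantDerivativeOnUniv.leibniz hX hf]
  simp

theorem leviCivita_const_smul (c : ℝ) (hX : MDiffAt (T% X) x) :
    leviCivita E M (c • X) x = c • leviCivita E M X x :=
  (leviCivita E M).isCovariantDerivativeOnUniv.smul_const c hX

theorem leviCivita_neg (hX : MDiffAt (T% X) x) :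
    leviCivita E M (-X) x = -leviCivita E M X x := by
  simpa using! leviCivita_const_smul (-1) hX

theorem leviCivita_sub (hX : MDiffAt (T% X) x) (hY : MDiffAt (T% Y) x) :
    leviCivita E M (X - Y) x = leviCivita E M X x - leviCivita E M Y x := by
  rw [sub_eq_add_neg, leviCivita_add hX (mdifferentiableAt_neg_section hY), leviCivita_neg hY,
    sub_eq_add_neg]

theorem leviCivita_zero : leviCivita E M 0 x = 0 := by
  rw [(leviCivita E M).zero]; rfl

theorem leviCivita_sum {ι : Type*} {t : Finset ι} {X : ι → VField E M}
    (hX : ∀ i ∈ t, MDiffAt (T% (X i)) x) :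
    leviCivita E M (∑ i ∈ t, X i) x = ∑ i ∈ t, leviCivita E M (X i) x := by
  classical
  induction t using Finset.induction_on with
  | empty => simp [leviCivita_zero]
  | insert i t hi ih =>
    have h : MDiffAt (T% (∑ i ∈ t, X i)) x :=
      (MDifferentiableAt.sum_section fun i hi ↦ hX i (Finset.mem_insert_of_mem hi)).congr_of_eventuallyEq
        (Filter.Eventually.of_forall fun y ↦ by simp)
    rw [Finset.sum_insert hi, Finset.sum_insert hi,
      leviCivita_add (hX i (Finset.mem_insert_self i t)) h,
      ih fun j hj ↦ hX j (Finset.mem_insert_of_mem hj)]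

/-- Differentiability need not be assumed: it depends only on the germ, and where it fails both
sides are the default value `0`. -/
theorem leviCivita_congr (h : X =ᶠ[𝓝 x] Y) : leviCivita E M X x = leviCivita E M Y x := by
  have h' : (T% X) =ᶠ[𝓝 x] (T% Y) := h.mono fun y hy ↦ by simp [hy]
  by_cases hX : MDiffAt (T% X) x
  · exact (leviCivita E M).isCovariantDerivativeOnUniv.congr_of_eventuallyEq hX
      (hX.congr_of_eventuallyEq h'.symm) Filter.univ_mem h
  · have hY : ¬ MDiffAt (T% Y) x := fun hY ↦ hX (hY.congr_of_eventuallyEq h')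
    change leviCivitaFun X x = leviCivitaFun Y x
    simp only [leviCivitaFun, hX, hY, dite_false]

theorem leviCivita_metric_apply (hY : MDiffAt (T% Y) x) (hZ : MDiffAt (T% Z) x)
    (v : TangentSpace 𝓘(ℝ, E) x) :
    d% (fun y ↦ inner ℝ (Y y) (Z y)) x v =
      inner ℝ (leviCivita E M Y x v) (Z x) + inner ℝ (Y x) (leviCivita E M Z x v) := by
  simpa using leviCivita_metric (X := FiberBundle.extend E v)
    (FiberBundle.mdifferentiableAt_extend ..) hY hZ

/-- The matrix of the metric in the preferred chart at `m`. -/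
def chartMetric (m : M) (z : E) : E →L[ℝ] E →L[ℝ] ℝ :=
  (innerSL ℝ (E := TangentSpace 𝓘(ℝ, E) ((extChartAt 𝓘(ℝ, E) m).symm z))).bilinearComp
    (fromCoord m _) (fromCoord m _)

theorem chartMetric_apply (m : M) (z v w : E) : chartMetric m z v w =
    inner ℝ (fromCoord (E := E) m ((extChartAt 𝓘(ℝ, E) m).symm z) v)
      (fromCoord (E := E) m ((extChartAt 𝓘(ℝ, E) m).symm z) w) := rfl

theorem chartMetric_extChartAt (hy : y ∈ (chartAt E m).source) (v w : E) :
    chartMetric m (extChartAt 𝓘(ℝ, E) m y) v w =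
    inner ℝ (fromCoord (E := E) m y v) (fromCoord (E := E) m y w) := by
  have : (extChartAt 𝓘(ℝ, E) m).symm (extChartAt 𝓘(ℝ, E) m y) = y :=
    (extChartAt 𝓘(ℝ, E) m).left_inv (by simpa using hy)
  rw [chartMetric_apply, this]

theorem contDiffOn_chartMetric (m : M) :
    ContDiffOn ℝ ∞ (chartMetric m) (extChartAt 𝓘(ℝ, E) m).target := by
  refine contDiffOn_clm_apply.2 fun v ↦ contDiffOn_clm_apply.2 fun w ↦ ?_
  have h := contDiffOn_comp_extChartAt_symm (m := m)
    ((smoothOn_chartField_const m v).inner (smoothOn_chartField_const m w))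
  refine (h.mono fun z hz ↦ ⟨hz, symm_mem_source hz⟩).congr fun z _ ↦ ?_
  rfl

/-- Positive definiteness gives injectivity, and the dimensions agree. Invertibility is what
recovers a field smoothly from its inner products. -/
theorem exists_chartMetric_eq {z : E} (hz : z ∈ (extChartAt 𝓘(ℝ, E) m).target) :
    ∃ e : E ≃L[ℝ] E →L[ℝ] ℝ, (e : E →L[ℝ] E →L[ℝ] ℝ) = chartMetric m z := by
  have hinj : Function.Injective (chartMetric m z) := by
    refine (injective_iff_map_eq_zero _).2 fun v hv ↦ ?_
    have h : fromCoord (E := E) m ((extChartAt 𝓘(ℝ, E) m).symm z) v = 0 := by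
      have := congrArg (fun L : E →L[ℝ] ℝ ↦ L v) hv
      exact inner_self_eq_zero.1 (this : inner ℝ _ _ = (0 : ℝ))
    rw [← toCoord_fromCoord (symm_mem_source hz) v, h, map_zero]
  have hdim : Module.finrank ℝ E = Module.finrank ℝ (E →L[ℝ] ℝ) := by
    rw [← (LinearMap.toContinuousLinearMap (𝕜 := ℝ) (E := E) (F' := ℝ)).finrank_eq]
    exact (Subspace.dual_finrank_eq (K := ℝ) (V := E)).symm
  exact ⟨(LinearMap.linearEquivOfInjective (chartMetric m z : E →ₗ[ℝ] E →L[ℝ] ℝ) hinj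
    hdim).toContinuousLinearEquiv, by ext; rfl⟩

/-- A vector field is smooth if its inner products with coordinate fields are. -/
theorem smoothOn_of_inner (hU : IsOpen U)
    (h : ∀ m ∈ U, ∀ v : E, CMDiff[U ∩ (chartAt E m).source] ∞
      (fun y ↦ inner ℝ (W y) (chartField m (fun _ ↦ v) y))) : SmoothOn W U := by
  have := FiniteDimensional.complete ℝ E
  intro m hm
  have hms := mem_chart_source E m
  have hmt := extChartAt_mem_target (E := E) hms
  have hop := isOpen_target_inter_preimage (E := E) m (hU.inter (chartAt E m).open_source)
  have hmem : extChartAt 𝓘(ℝ, E) m m ∈ (extChartAt 𝓘(ℝ, E) m).target ∩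
      (extChartAt 𝓘(ℝ, E) m).symm ⁻¹' (U ∩ (chartAt E m).source) := by
    refine ⟨hmt, ?_⟩
    rw [mem_preimage, extChartAt_to_inv (I := 𝓘(ℝ, E))]
    exact ⟨hm, hms⟩
  have hrep : ContDiffOn ℝ ∞ (chartRep m W) ((extChartAt 𝓘(ℝ, E) m).target ∩
      (extChartAt 𝓘(ℝ, E) m).symm ⁻¹' (U ∩ (chartAt E m).source)) := by
    have h1 : ContDiffOn ℝ ∞ (fun z ↦ chartMetric m z (chartRep m W z))
        ((extChartAt 𝓘(ℝ, E) m).target ∩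
          (extChartAt 𝓘(ℝ, E) m).symm ⁻¹' (U ∩ (chartAt E m).source)) := by
      refine contDiffOn_clm_apply.2 fun v ↦
        (contDiffOn_comp_extChartAt_symm (h m hm v)).congr fun z hz ↦ ?_
      have hzs := symm_mem_source hz.1
      rw [chartMetric_apply, chartRep, fromCoord_toCoord hzs, chartField]
    intro z hz
    obtain ⟨e, he⟩ := exists_chartMetric_eq hz.1
    have h2 : ContDiffWithinAt ℝ ∞ (fun z ↦ (chartMetric m z).inverse)
        ((extChartAt 𝓘(ℝ, E) m).target ∩
          (extChartAt 𝓘(ℝ, E) m).symm ⁻¹' (U ∩ (chartAt E m).source)) z := by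
      have := contDiffAt_map_inverse (n := ∞) e
      rw [he] at this
      exact this.comp_contDiffWithinAt z
        (((contDiffOn_chartMetric m).mono inter_subset_left) z hz)
    refine (h2.clm_apply (h1 z hz)).congr_of_mem (fun z hz ↦ ?_) hz
    obtain ⟨e, he⟩ := exists_chartMetric_eq hz.1
    rw [← he, ContinuousLinearMap.inverse_equiv]
    simp
  have := smoothOn_chartField (m := m) hop hrep
  refine ContMDiffAt.contMDiffWithinAt ?_
  refine (((this m ⟨hms, hmem⟩).contMDiffAt
    ((isOpen_extChartAt_preimage_inter m hop).mem_nhds ⟨hms, hmem⟩))).congr_of_eventuallyEq ?_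
  filter_upwards [(chartAt E m).open_source.mem_nhds hms] with y hy
  rw [chartField_chartRep hy]

/-- The Koszul formula gives the inner products with coordinate fields as smooth functions, and
`smoothOn_of_inner` concludes. -/
theorem SmoothOn.leviCivita (hU : IsOpen U) (hX : SmoothOn X U) (hY : SmoothOn Y U) :
    SmoothOn (fun y ↦ leviCivita E M Y y (X y)) U := by
  have := FiniteDimensional.complete ℝ E
  refine smoothOn_of_inner hU fun m _ v ↦ ?_
  have hU' := hU.inter (chartAt E m).open_source
  have hZ : SmoothOn (chartField m fun _ ↦ v) (U ∩ (chartAt E m).source) :=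
    (smoothOn_chartField_const m v).mono inter_subset_right
  generalize (chartField m fun _ ↦ v) = Z at hZ
  have hX := hX.mono (inter_subset_left (t := (chartAt E m).source))
  have hY := hY.mono (inter_subset_left (t := (chartAt E m).source))
  refine ContMDiffOn.congr (f := fun y ↦ (1 / 2 : ℝ) * koszul Y X Z y) ?_ fun y hy ↦
    inner_leviCivitaFun (hX.mdiffAt hU' hy) (hY.mdiffAt hU' hy) (hZ.mdiffAt hU' hy)
  unfold koszul
  refine contMDiffOn_const.mul ?_
  exact (((((hX.contMDiffOn_mvfderiv hU' (hY.inner hZ)).add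
    (hY.contMDiffOn_mvfderiv hU' (hZ.inner hX))).sub
    (hZ.contMDiffOn_mvfderiv hU' (hX.inner hY))).add ((hX.mlieBracket hU' hY).inner hZ)).sub
    ((hY.mlieBracket hU' hZ).inner hX)).add ((hZ.mlieBracket hU' hX).inner hY)

theorem SmoothNear.leviCivita (hX : SmoothNear X x) (hY : SmoothNear Y x) :
    SmoothNear (fun y ↦ RiemannCartan.leviCivita E M Y y (X y)) x := by
  obtain ⟨U, hU, hxU, hX, hY⟩ := hX.exists_smoothOn hY
  exact (hX.leviCivita hU hY).smoothNear hU hxU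

end

end LeviCivitaSmooth

/-! ### The Levi-Civita connection in a chart, jets and Killing fields -/

section Christoffel

noncomputable section

set_option maxSynthPendingDepth 3
set_option linter.unusedSectionVars false

variable {E : Type*} [NormedAddCommGroup E] [NormedSpace ℝ E]
  {M : Type*} [TopologicalSpace M] [ChartedSpace E M] [IsManifold 𝓘(ℝ, E) ∞ M]
  {X Y Z V W : VField E M} {U U' : Set M} {m x y : M} {f g : M → ℝ}

/-- In finite dimension a family of linear maps is smooth once its value on each fixed vector is, so
coordinate fields suffice as tests. -/
theorem endSmoothOn_of_apply [FiniteDimensional ℝ E] {φ : EndField E M} (hU : IsOpen U)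
    (h : ∀ m ∈ U, ∀ v : E, SmoothOn (fun y ↦ φ y (chartField m (fun _ ↦ v) y))
      (U ∩ (chartAt E m).source)) : EndSmoothOn φ U := by
  intro m hm
  refine ContMDiffAt.contMDiffWithinAt ?_
  have hms := mem_chart_source E m
  have hop := hU.inter (chartAt E m).open_source
  have hop' := isOpen_target_inter_preimage (E := E) m hop
  have hmem : extChartAt 𝓘(ℝ, E) m m ∈ (extChartAt 𝓘(ℝ, E) m).target ∩
      (extChartAt 𝓘(ℝ, E) m).symm ⁻¹' (U ∩ (chartAt E m).source) := by
    refine ⟨extChartAt_mem_target hms, ?_⟩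
    rw [mem_preimage, extChartAt_to_inv (I := 𝓘(ℝ, E))]
    exact ⟨hm, hms⟩
  refine contMDiffAt_totalSpace.2 ⟨contMDiffAt_id, ?_⟩
  have h1 : ContDiffOn ℝ ∞ (fun z ↦ (toCoord (E := E) m ((extChartAt 𝓘(ℝ, E) m).symm z)) ∘L
      (φ ((extChartAt 𝓘(ℝ, E) m).symm z)) ∘L
      (fromCoord (E := E) m ((extChartAt 𝓘(ℝ, E) m).symm z)))
      ((extChartAt 𝓘(ℝ, E) m).target ∩
        (extChartAt 𝓘(ℝ, E) m).symm ⁻¹' (U ∩ (chartAt E m).source)) := by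
    refine contDiffOn_clm_apply.2 fun v ↦ (contDiffOn_chartRep hop (h m hm v)).congr
      fun z hz ↦ ?_
    rfl
  refine ((contMDiffOn_comp_extChartAt (m := m) h1).contMDiffAt
    ((isOpen_extChartAt_preimage_inter m hop').mem_nhds ⟨hms, hmem⟩)).congr_of_eventuallyEq ?_
  filter_upwards [(chartAt E m).open_source.mem_nhds hms] with y hy
  have : (extChartAt 𝓘(ℝ, E) m).symm (extChartAt 𝓘(ℝ, E) m y) = y :=
    (extChartAt 𝓘(ℝ, E) m).left_inv (by simpa using hy)
  rw [this]
  rfl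

/-- The one-jet of a vector field in terms of its components. -/
theorem jet_eq (hV : MDiffAt (T% V) x) : jet V x = (V x, fromCoord x x ∘L
    fderiv ℝ (chartRep x V) (extChartAt 𝓘(ℝ, E) x x) ∘L toCoord x x) := by
  have hxs := mem_chart_source E x
  refine Prod.ext rfl ?_
  refine congrArg (fun L : TangentSpace 𝓘(ℝ, E) x →L[ℝ] E ↦
    (trivializationAt E (TangentSpace 𝓘(ℝ, E)) x).symmL ℝ x ∘L L) ?_
  have e : (fun y ↦ (trivializationAt E (TangentSpace 𝓘(ℝ, E)) x
      (⟨y, V y⟩ : TangentBundle 𝓘(ℝ, E) M)).2) =ᶠ[𝓝 x]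
      fun y ↦ chartRep x V (extChartAt 𝓘(ℝ, E) x y) := by
    filter_upwards [(chartAt E x).open_source.mem_nhds hxs] with y hy
    exact (toCoord_apply hy (V y)).symm.trans (chartRep_extChartAt hy V).symm
  refine Eq.trans (b := d% (fun y ↦ chartRep x V (extChartAt 𝓘(ℝ, E) x y)) x) e.mfderiv_eq ?_
  ext v
  exact mvfderiv_comp_extChartAt hxs (differentiableAt_chartRep hxs hV) v

theorem chartField_eq_sum [FiniteDimensional ℝ E] (m : M) (w : E → E) : chartField m w =
    ∑ i, (fun y : M ↦ (Module.finBasis ℝ E).coord i (w (extChartAt 𝓘(ℝ, E) m y))) •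
      (chartField m fun _ ↦ Module.finBasis ℝ E i) := by
  ext y
  rw [Finset.sum_apply]
  change fromCoord m y _ = ∑ i, (Module.finBasis ℝ E).coord i (w (extChartAt 𝓘(ℝ, E) m y)) •
    fromCoord m y (Module.finBasis ℝ E i)
  conv_lhs => rw [← (Module.finBasis ℝ E).sum_repr (w (extChartAt 𝓘(ℝ, E) m y)), map_sum]
  refine Finset.sum_congr rfl fun i _ ↦ ?_
  rw [map_smul]
  rfl

variable [RiemannianBundle (fun x : M ↦ TangentSpace 𝓘(ℝ, E) x)]
  [IsContMDiffRiemannianBundle 𝓘(ℝ, E) ∞ E (fun x : M ↦ TangentSpace 𝓘(ℝ, E) x)]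
  [FiniteDimensional ℝ E]

/-- The Christoffel symbols `Γ z v u` of the Levi-Civita connection in the preferred chart at `m`:
the components of the derivative along `u` of the coordinate field `v`. -/
def christoffel (m : M) (z : E) : E →L[ℝ] E →L[ℝ] E :=
  ∑ i, ((LinearMap.toContinuousLinearMap ((Module.finBasis ℝ E).coord i)).smulRight
    (toCoord m ((extChartAt 𝓘(ℝ, E) m).symm z) ∘L
      leviCivita E M (chartField m fun _ ↦ Module.finBasis ℝ E i)
        ((extChartAt 𝓘(ℝ, E) m).symm z) ∘L fromCoord m ((extChartAt 𝓘(ℝ, E) m).symm z)))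

theorem christoffel_extChartAt (hy : y ∈ (chartAt E m).source) (v u : E) :
    christoffel m (extChartAt 𝓘(ℝ, E) m y) v u =
      ∑ i, (Module.finBasis ℝ E).coord i v •
        toCoord m y (leviCivita E M (chartField m fun _ ↦ Module.finBasis ℝ E i) y
          (fromCoord m y u)) := by
  have : (extChartAt 𝓘(ℝ, E) m).symm (extChartAt 𝓘(ℝ, E) m y) = y :=
    (extChartAt 𝓘(ℝ, E) m).left_inv (by simpa using hy)
  rw [christoffel, this]
  simp

/-- Leibniz rule applied to the expansion in coordinate fields. The first argument of `christoffel`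
is the field, the second the direction of differentiation. -/
theorem leviCivita_chartField (hy : y ∈ (chartAt E m).source) {w : E → E}
    (hw : DifferentiableAt ℝ w (extChartAt 𝓘(ℝ, E) m y)) (u : TangentSpace 𝓘(ℝ, E) y) :
    leviCivita E M (chartField m w) y u = fromCoord m y
      (fderiv ℝ w (extChartAt 𝓘(ℝ, E) m y) (toCoord m y u) +
        christoffel m (extChartAt 𝓘(ℝ, E) m y) (w (extChartAt 𝓘(ℝ, E) m y)) (toCoord m y u)) := by
  let c (i) : E →L[ℝ] ℝ := LinearMap.toContinuousLinearMap ((Module.finBasis ℝ E).coord i)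
  have hF (i) : MDiffAt (T% (chartField m fun _ ↦ Module.finBasis ℝ E i)) y :=
    mdiffAt_chartField hy (differentiableAt_const _)
  have hcd (i) : DifferentiableAt ℝ (fun z ↦ c i (w z)) (extChartAt 𝓘(ℝ, E) m y) :=
    (c i).differentiableAt.comp _ hw
  have hc (i) : MDiffAt (fun y ↦ c i (w (extChartAt 𝓘(ℝ, E) m y))) y :=
    mdiffAt_comp_extChartAt hy (hcd i)
  have h2 (i) : d% (fun y ↦ c i (w (extChartAt 𝓘(ℝ, E) m y))) y u =
      c i (fderiv ℝ w (extChartAt 𝓘(ℝ, E) m y) (toCoord m y u)) := by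
    have := mvfderiv_comp_extChartAt hy (hcd i) u
    rw [this]
    have h3 := ((c i).hasFDerivAt.comp _ hw.hasFDerivAt).fderiv
    exact congrArg (fun L : E →L[ℝ] ℝ ↦ L (toCoord m y u)) h3
  have key : leviCivita E M (chartField m w) y u =
      ∑ i, (c i (w (extChartAt 𝓘(ℝ, E) m y)) • leviCivita E M
        (chartField m fun _ ↦ Module.finBasis ℝ E i) y u +
        c i (fderiv ℝ w (extChartAt 𝓘(ℝ, E) m y) (toCoord m y u)) •
          chartField m (fun _ ↦ Module.finBasis ℝ E i) y) := by
    rw [chartField_eq_sum m w,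
      leviCivita_sum fun i _ ↦ MDifferentiableAt.smul_section (f := fun y ↦
        (Module.finBasis ℝ E).coord i (w (extChartAt 𝓘(ℝ, E) m y))) (hc i) (hF i), sum_apply]
    refine Finset.sum_congr rfl fun i _ ↦ ?_
    refine (leviCivita_smul (hc i) (hF i) u).trans ?_
    rw [h2]
  rw [key, Finset.sum_add_distrib, map_add, add_comm, christoffel_extChartAt hy, map_sum]
  congr 1
  · conv_rhs => rw [← (Module.finBasis ℝ E).sum_repr
      (fderiv ℝ w (extChartAt 𝓘(ℝ, E) m y) (toCoord m y u)), map_sum]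
    refine Finset.sum_congr rfl fun i _ ↦ ?_
    rw [map_smul]
    rfl
  · refine Finset.sum_congr rfl fun i _ ↦ ?_
    rw [map_smul, fromCoord_toCoord hy, fromCoord_toCoord hy]
    rfl

theorem toCoord_leviCivita (hy : y ∈ (chartAt E m).source) (hV : MDiffAt (T% V) y)
    (u : TangentSpace 𝓘(ℝ, E) y) :
    toCoord m y (leviCivita E M V y u) =
      fderiv ℝ (chartRep m V) (extChartAt 𝓘(ℝ, E) m y) (toCoord m y u) +
        christoffel m (extChartAt 𝓘(ℝ, E) m y) (toCoord m y (V y)) (toCoord m y u) := by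
  rw [leviCivita_congr (chartField_chartRep_eventuallyEq hy V),
    leviCivita_chartField hy (differentiableAt_chartRep hy hV), toCoord_fromCoord hy,
    chartRep_extChartAt hy]

/-- Coordinate fields commute, so vanishing torsion is symmetry of the Christoffel symbols. -/
theorem christoffel_symm {z : E} (hz : z ∈ (extChartAt 𝓘(ℝ, E) m).target) (u v : E) :
    christoffel m z u v = christoffel m z v u := by
  have := FiniteDimensional.complete ℝ E
  obtain ⟨y, hy, rfl⟩ : ∃ y ∈ (chartAt E m).source, extChartAt 𝓘(ℝ, E) m y = z :=
    ⟨_, symm_mem_source hz, (extChartAt 𝓘(ℝ, E) m).right_inv hz⟩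
  have h := leviCivita_torsionFree (X := chartField m fun _ ↦ u) (Y := chartField m fun _ ↦ v)
    (mdiffAt_chartField hy (differentiableAt_const _))
    (mdiffAt_chartField hy (differentiableAt_const _))
  rw [mlieBracket_chartField hy (differentiableAt_const _) (differentiableAt_const _),
    leviCivita_chartField hy (differentiableAt_const _),
    leviCivita_chartField hy (differentiableAt_const _)] at h
  have h := congrArg (toCoord m y) h
  simp only [chartField, map_sub, toCoord_fromCoord hy] at h
  simp only [fderiv_fun_const, Pi.zero_apply, zero_apply, zero_add, sub_self] at h
  exact (sub_eq_zero.1 h).symm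

theorem contDiffOn_christoffel (m : M) :
    ContDiffOn ℝ ∞ (christoffel (E := E) m) (extChartAt 𝓘(ℝ, E) m).target := by
  refine contDiffOn_clm_apply.2 fun v ↦ contDiffOn_clm_apply.2 fun u ↦ ?_
  have h := (contDiffOn_chartRep (m := m) (chartAt E m).open_source
    (SmoothOn.leviCivita (chartAt E m).open_source (smoothOn_chartField_const m u)
      (smoothOn_chartField_const m v)))
  refine (h.mono fun z hz ↦ ⟨hz, symm_mem_source hz⟩).congr fun z hz ↦ ?_
  have hy := symm_mem_source hz
  rw [chartRep, toCoord_leviCivita hy (mdiffAt_chartField hy (differentiableAt_const _)),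
    (extChartAt 𝓘(ℝ, E) m).right_inv hz, chartField, chartField, toCoord_fromCoord hy,
    toCoord_fromCoord hy]
  have : fderiv ℝ (chartRep m (chartField m fun _ ↦ v)) z = 0 := by
    have e : chartRep m (chartField m fun _ ↦ v) =ᶠ[𝓝 z] fun _ ↦ v := by
      filter_upwards [(isOpen_extChartAt_target m).mem_nhds hz] with z hz
      exact chartRep_chartField hz _
    rw [e.fderiv_eq]
    simp
  rw [this]
  simp

/-- The metric is parallel, in a chart. -/
theorem fderiv_chartMetric {z : E} (hz : z ∈ (extChartAt 𝓘(ℝ, E) m).target) (u v w : E) :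
    fderiv ℝ (chartMetric m) z u v w = chartMetric m z (christoffel m z v u) w +
      chartMetric m z v (christoffel m z w u) := by
  obtain ⟨y, hy, rfl⟩ : ∃ y ∈ (chartAt E m).source, extChartAt 𝓘(ℝ, E) m y = z :=
    ⟨_, symm_mem_source hz, (extChartAt 𝓘(ℝ, E) m).right_inv hz⟩
  have hF (v : E) := mdiffAt_chartField (w := fun _ ↦ v) hy (differentiableAt_const _)
  have h := leviCivita_metric_apply (hF v) (hF w) (fromCoord m y u)
  rw [leviCivita_chartField hy (differentiableAt_const _),
    leviCivita_chartField hy (differentiableAt_const _), toCoord_fromCoord hy] at h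
  have hd : DifferentiableAt ℝ (chartMetric (E := E) m) (extChartAt 𝓘(ℝ, E) m y) :=
    ((contDiffOn_chartMetric m).contDiffAt
      ((isOpen_extChartAt_target m).mem_nhds hz)).differentiableAt (by simp)
  have hd1 (v : E) : HasFDerivAt (fun z ↦ chartMetric m z v w) _ _ :=
    (hd.hasFDerivAt.clm_apply (hasFDerivAt_const v _)).clm_apply (hasFDerivAt_const w _)
  have e : (fun x ↦ inner ℝ (chartField m (fun _ ↦ v) x) (chartField m (fun _ ↦ w) x)) =ᶠ[𝓝 y]
      fun x ↦ (fun z ↦ chartMetric m z v w) (extChartAt 𝓘(ℝ, E) m x) := by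
    filter_upwards [(chartAt E m).open_source.mem_nhds hy] with x hx
    exact (chartMetric_extChartAt hx v w).symm
  rw [mvfderiv_congr e, mvfderiv_comp_extChartAt hy (hd1 v).differentiableAt,
    (hd1 v).fderiv, toCoord_fromCoord hy] at h
  simp only [chartMetric_extChartAt hy]
  simpa [chartField] using h

/-- The derivative recorded by the jet and the covariant derivative differ by a term depending only
on `V x`. One-jets may therefore be replaced by pairs of a value and a covariant derivative. -/
theorem leviCivita_eq_jet (hV : MDiffAt (T% V) x) (u : TangentSpace 𝓘(ℝ, E) x) :
    leviCivita E M V x u = (jet V x).2 u + fromCoord x x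
      (christoffel x (extChartAt 𝓘(ℝ, E) x x) (toCoord x x (V x)) (toCoord x x u)) := by
  have hxs := mem_chart_source E x
  rw [← fromCoord_toCoord hxs (leviCivita E M V x u), toCoord_leviCivita hxs hV, jet_eq hV, map_add]
  rfl

theorem jet_eq_jet_iff (hV : MDiffAt (T% V) x) (hW : MDiffAt (T% W) x) :
    jet V x = jet W x ↔ V x = W x ∧ leviCivita E M V x = leviCivita E M W x := by
  constructor
  · intro h
    have h0 : V x = W x := congrArg Prod.fst h
    refine ⟨h0, ContinuousLinearMap.ext fun u ↦ ?_⟩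
    rw [leviCivita_eq_jet hV, leviCivita_eq_jet hW, h, h0]
  · rintro ⟨h0, h1⟩
    refine Prod.ext h0 (ContinuousLinearMap.ext fun u ↦ ?_)
    have h2 := congrArg (fun L : TangentSpace 𝓘(ℝ, E) x →L[ℝ] TangentSpace 𝓘(ℝ, E) x ↦ L u) h1
    simp only [leviCivita_eq_jet hV, leviCivita_eq_jet hW, h0] at h2
    exact add_right_cancel h2

/-- A vector field with prescribed value and covariant derivative at a point. -/
theorem exists_smoothNear_leviCivita (v : TangentSpace 𝓘(ℝ, E) x)
    (Ψ : TangentSpace 𝓘(ℝ, E) x →L[ℝ] TangentSpace 𝓘(ℝ, E) x) :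
    ∃ V : VField E M, SmoothNear V x ∧ V x = v ∧ leviCivita E M V x = Ψ := by
  have hxs := mem_chart_source E x
  -- The field is affine in the chart; subtracting the Christoffel term makes its covariant
  -- derivative, rather than its coordinate derivative, equal to `Ψ`.
  let L : E →L[ℝ] E := toCoord x x ∘L Ψ ∘L fromCoord x x -
    christoffel x (extChartAt 𝓘(ℝ, E) x x) (toCoord x x v)
  let w : E → E := fun z ↦ toCoord x x v + L (z - extChartAt 𝓘(ℝ, E) x x)
  have hw : HasFDerivAt w L (extChartAt 𝓘(ℝ, E) x x) :=
    (L.hasFDerivAt.comp _ (hasFDerivAt_sub_const _)).const_add _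
  have hwx : w (extChartAt 𝓘(ℝ, E) x x) = toCoord x x v := by simp [w]
  refine ⟨chartField x w, ?_, ?_, ContinuousLinearMap.ext fun u ↦ ?_⟩
  · refine SmoothOn.smoothNear (U := (chartAt E x).source) ?_ (chartAt E x).open_source hxs
    simpa using smoothOn_chartField (m := x) (w := w) isOpen_univ (by fun_prop)
  · rw [chartField, hwx, fromCoord_toCoord hxs]
  · rw [leviCivita_chartField hxs hw.differentiableAt, hw.fderiv, hwx]
    simp [L, fromCoord_toCoord hxs]

/-- Metric compatibility expands the derivative of the inner product and vanishing torsion expands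
the brackets; the derivatives along `V` cancel. The Killing equation thus says that `∇V` is skew. -/
theorem lieMetric_eq (hV : MDiffAt (T% V) x) (hX : MDiffAt (T% X) x) (hY : MDiffAt (T% Y) x) :
    lieMetric V X Y x =
      inner ℝ (leviCivita E M V x (X x)) (Y x) + inner ℝ (X x) (leviCivita E M V x (Y x)) := by
  rw [lieMetric, leviCivita_metric_apply hX hY, ← leviCivita_torsionFree hV hX,
    ← leviCivita_torsionFree hV hY, inner_sub_left, inner_sub_right]
  ring

theorem lieMetricVanishesAt_iff (hV : MDiffAt (T% V) x) : LieMetricVanishesAt V x ↔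
    ∀ v w, inner ℝ (leviCivita E M V x v) w + inner ℝ v (leviCivita E M V x w) = 0 := by
  constructor
  · intro h v w
    have := h _ _ (smoothNear_extend v) (smoothNear_extend w)
    rw [lieMetric_eq hV (smoothNear_extend v).mdiffAt (smoothNear_extend w).mdiffAt] at this
    simpa using this
  · intro h X Y hX hY
    rw [lieMetric_eq hV hX.mdiffAt hY.mdiffAt, h]

end

end Christoffel

/-! ### Killing fields are affine; the curvature tensor -/

section Curvature

noncomputable section

set_option maxSynthPendingDepth 3
set_option linter.unusedSectionVars false

variable {E : Type*} [NormedAddCommGroup E] [NormedSpace ℝ E]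
  {M : Type*} [TopologicalSpace M] [ChartedSpace E M] [IsManifold 𝓘(ℝ, E) ∞ M]
  {X Y Z V W X' Y' Z' : VField E M} {U U' : Set M} {m x y : M} {f g : M → ℝ}

theorem mvfderiv_congr_of_isOpen (hU : IsOpen U) (hx : x ∈ U) (h : ∀ y ∈ U, f y = g y) : d% f x = d% g x :=
  mvfderiv_congr (Filter.eventuallyEq_of_mem (hU.mem_nhds hx) h)

theorem mlieBracket_congr (hX : X =ᶠ[𝓝 x] X') (hY : Y =ᶠ[𝓝 x] Y') :
    mlieBracket 𝓘(ℝ, E) X Y x = mlieBracket 𝓘(ℝ, E) X' Y' x :=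
  hX.mlieBracket_vectorField_eq hY

theorem bracket_sub_right [CompleteSpace E] (hX : MDiffAt (T% X) x) (hY : MDiffAt (T% Y) x) :
    mlieBracket 𝓘(ℝ, E) V (X - Y) x = mlieBracket 𝓘(ℝ, E) V X x - mlieBracket 𝓘(ℝ, E) V Y x := by
  have hY' : MDiffAt (T% ((-1 : ℝ) • Y)) x :=
    MDifferentiableAt.smul_section (f := fun _ ↦ (-1 : ℝ)) mdifferentiableAt_const hY
  have e : X - Y = X + (-1 : ℝ) • Y := by rw [neg_one_smul, sub_eq_add_neg]
  rw [e, mlieBracket_add_right hX hY',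
    mlieBracket_const_smul_right hY, neg_one_smul, sub_eq_add_neg]

variable [FiniteDimensional ℝ E]

/-- An operator on vector fields that is linear over the smooth functions depends only on the
value of the field. -/
theorem eq_of_tensorial {G : Type*} [AddCommGroup G] [Module ℝ G] {Φ : VField E M → G}
    (hcongr : ∀ X Y : VField E M, X =ᶠ[𝓝 x] Y → Φ X = Φ Y)
    (hadd : ∀ X Y, SmoothNear X x → SmoothNear Y x → Φ (X + Y) = Φ X + Φ Y)
    (hsmul : ∀ (U : Set M) (f : M → ℝ) X, IsOpen U → x ∈ U → CMDiff[U] ∞ f → SmoothOn X U →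
      Φ (f • X) = f x • Φ X)
    (hX : SmoothNear X x) (hY : SmoothNear Y x) (h : X x = Y x) : Φ X = Φ Y := by
  have hxs := mem_chart_source E x
  let F (i) : VField E M := chartField x fun _ ↦ Module.finBasis ℝ E i
  have hF (i) : SmoothOn (F i) (chartAt E x).source := smoothOn_chartField_const x _
  have h0 : Φ 0 = 0 := by
    simpa using hadd 0 0 (smoothOn_zero.smoothNear isOpen_univ (mem_univ x))
      (smoothOn_zero.smoothNear isOpen_univ (mem_univ x))
  have hsum (t : Finset (Fin (Module.finrank ℝ E))) (W : Fin (Module.finrank ℝ E) → VField E M)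
      (hW : ∀ i, SmoothNear (W i) x) :
      Φ (∑ i ∈ t, W i) = ∑ i ∈ t, Φ (W i) ∧ SmoothNear (∑ i ∈ t, W i) x := by
    classical
    induction t using Finset.induction_on with
    | empty => simpa [h0] using smoothOn_zero.smoothNear isOpen_univ (mem_univ x)
    | insert i t hi ih =>
      rw [Finset.sum_insert hi, Finset.sum_insert hi, hadd _ _ (hW i) ih.2, ih.1]
      obtain ⟨U, hU, hxU, h1, h2⟩ := (hW i).exists_smoothOn ih.2
      exact ⟨rfl, (h1.add h2).smoothNear hU hxU⟩
  -- Expanding `X` in coordinate fields with smooth coefficients leaves only the values of the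
  -- coefficients at `x`.
  have key {X : VField E M} (hX : SmoothNear X x) :
      Φ X = ∑ i, (Module.finBasis ℝ E).coord i (toCoord x x (X x)) • Φ (F i) := by
    obtain ⟨U, hU, hxU, hX⟩ := hX
    set c : Fin (Module.finrank ℝ E) → M → ℝ := fun i y ↦
      (Module.finBasis ℝ E).coord i (chartRep x X (extChartAt 𝓘(ℝ, E) x y)) with hc
    have hop := isOpen_target_inter_preimage (E := E) x hU
    have hcs (i) : CMDiff[(chartAt E x).source ∩ extChartAt 𝓘(ℝ, E) x ⁻¹'
        ((extChartAt 𝓘(ℝ, E) x).target ∩ (extChartAt 𝓘(ℝ, E) x).symm ⁻¹' U)] ∞ (c i) :=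
      contMDiffOn_comp_extChartAt (m := x)
        ((LinearMap.toContinuousLinearMap ((Module.finBasis ℝ E).coord i)).contDiff.comp_contDiffOn
          (contDiffOn_chartRep hU hX))
    have hop' := isOpen_extChartAt_preimage_inter (E := E) x hop
    have hmem : x ∈ (chartAt E x).source ∩ extChartAt 𝓘(ℝ, E) x ⁻¹'
        ((extChartAt 𝓘(ℝ, E) x).target ∩ (extChartAt 𝓘(ℝ, E) x).symm ⁻¹' U) := by
      refine ⟨hxs, extChartAt_mem_target hxs, ?_⟩
      rw [mem_preimage, extChartAt_to_inv (I := 𝓘(ℝ, E))]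
      exact hxU
    have hF' (i) := (hF i).mono (inter_subset_left (t := extChartAt 𝓘(ℝ, E) x ⁻¹'
        ((extChartAt 𝓘(ℝ, E) x).target ∩ (extChartAt 𝓘(ℝ, E) x).symm ⁻¹' U)))
    rw [hcongr _ _ (chartField_chartRep_eventuallyEq hxs X), chartField_eq_sum]
    rw [(hsum _ (fun i ↦ c i • F i)
      fun i ↦ ((hF' i).smul (hcs i)).smoothNear hop' hmem).1]
    refine Finset.sum_congr rfl fun i _ ↦ ?_
    rw [hsmul _ _ _ hop' hmem (hcs i) (hF' i), hc]
    simp only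
    rw [chartRep_extChartAt hxs]
  rw [key hX, key hY, h]

variable [RiemannianBundle (fun x : M ↦ TangentSpace 𝓘(ℝ, E) x)]
  [IsContMDiffRiemannianBundle 𝓘(ℝ, E) ∞ E (fun x : M ↦ TangentSpace 𝓘(ℝ, E) x)]

theorem IsKillingOn.mono (hV : IsKillingOn V U) (h : U' ⊆ U) : IsKillingOn V U' :=
  ⟨hV.1.mono h, fun x hx ↦ hV.2 x (h hx)⟩

theorem IsKillingOn.mvfderiv_inner (hU : IsOpen U) (hV : IsKillingOn V U) (hX : SmoothOn X U)
    (hY : SmoothOn Y U) (hx : x ∈ U) : d% (fun y ↦ inner ℝ (X y) (Y y)) x (V x) =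
      inner ℝ (mlieBracket 𝓘(ℝ, E) V X x) (Y x) + inner ℝ (X x) (mlieBracket 𝓘(ℝ, E) V Y x) := by
  have := hV.2 x hx X Y (hX.smoothNear hU hx) (hY.smoothNear hU hx)
  rw [lieMetric] at this
  linarith

/-- The difference `[V, ∇_X Y] - ∇_[V, X] Y - ∇_X [V, Y]`. -/
def affineDefect (V X Y : VField E M) (x : M) : TangentSpace 𝓘(ℝ, E) x :=
  mlieBracket 𝓘(ℝ, E) V (fun y ↦ leviCivita E M Y y (X y)) x -
    leviCivita E M Y x (mlieBracket 𝓘(ℝ, E) V X x) -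
    leviCivita E M (mlieBracket 𝓘(ℝ, E) V Y) x (X x)

/-- The antisymmetrization in `X` and `Y` is the Jacobi identity, once brackets are written through
the torsion-free connection. -/
theorem affineDefect_symm (hU : IsOpen U) (hV : SmoothOn V U) (hX : SmoothOn X U)
    (hY : SmoothOn Y U) (hx : x ∈ U) : affineDefect V X Y x = affineDefect V Y X x := by
  have := FiniteDimensional.complete ℝ E
  have hj := jacobi_mlieBracket hU hV hX hY hx
  have e : mlieBracket 𝓘(ℝ, E) X Y =ᶠ[𝓝 x]
      (fun y ↦ leviCivita E M Y y (X y)) - (fun y ↦ leviCivita E M X y (Y y)) := by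
    filter_upwards [hU.mem_nhds hx] with y hy
    exact (leviCivita_torsionFree (hX.mdiffAt hU hy) (hY.mdiffAt hU hy)).symm
  rw [mlieBracket_congr (Filter.EventuallyEq.refl _ V) e,
    bracket_sub_right ((hX.leviCivita hU hY).mdiffAt hU hx) ((hY.leviCivita hU hX).mdiffAt hU hx),
    ← leviCivita_torsionFree ((hV.mlieBracket hU hX).mdiffAt hU hx) (hY.mdiffAt hU hx),
    ← leviCivita_torsionFree (hX.mdiffAt hU hx) ((hV.mlieBracket hU hY).mdiffAt hU hx)] at hj
  rw [affineDefect, affineDefect, ← sub_eq_zero]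
  rw [← sub_eq_zero] at hj
  rw [← hj]
  abel

/-- Let `[V, X]` act on the function `⟪Y, Z⟫`, both by metric compatibility and as the commutator of
`V` and `X`. The derivation rule for Killing fields and metric compatibility reduce the comparison
to skewness in the last two fields. -/
theorem inner_affineDefect (hU : IsOpen U) (hV : IsKillingOn V U) (hX : SmoothOn X U)
    (hY : SmoothOn Y U) (hZ : SmoothOn Z U) (hx : x ∈ U) :
    inner ℝ (affineDefect V X Y x) (Z x) = -inner ℝ (affineDefect V X Z x) (Y x) := by
  have := FiniteDimensional.complete ℝ E
  have hb := mvfderiv_mlieBracket hU hV.1 hX (hY.inner hZ) hx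
  have hYx := hY.mdiffAt hU hx
  have hZx := hZ.mdiffAt hU hx
  have hXY := hX.leviCivita hU hY
  have hXZ := hX.leviCivita hU hZ
  have hVY := hV.1.mlieBracket hU hY
  have hVZ := hV.1.mlieBracket hU hZ
  rw [leviCivita_metric_apply hYx hZx,
    mvfderiv_congr_of_isOpen hU hx (f := fun y ↦ d% (fun y ↦ inner ℝ (Y y) (Z y)) y (X y))
      fun y hy ↦ leviCivita_metric_apply (hY.mdiffAt hU hy) (hZ.mdiffAt hU hy) (X y),
    mvfderiv_congr_of_isOpen hU hx (f := fun y ↦ d% (fun y ↦ inner ℝ (Y y) (Z y)) y (V y))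
      fun y hy ↦ hV.mvfderiv_inner hU hY hZ hy,
    mvfderiv_fun_add (mdiff_inner (hXY.mdiffAt hU hx) hZx) (mdiff_inner hYx (hXZ.mdiffAt hU hx)),
    mvfderiv_fun_add (mdiff_inner (hVY.mdiffAt hU hx) hZx) (mdiff_inner hYx (hVZ.mdiffAt hU hx)),
    add_apply, add_apply, hV.mvfderiv_inner hU hXY hZ hx, hV.mvfderiv_inner hU hY hXZ hx,
    leviCivita_metric_apply (hVY.mdiffAt hU hx) hZx,
    leviCivita_metric_apply hYx (hVZ.mdiffAt hU hx)] at hb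
  simp only [affineDefect, inner_sub_left]
  simp only [real_inner_comm (Y x)] at hb ⊢
  linarith

/-- An expression symmetric in its first two arguments and skew in its last two vanishes; this is
the argument for uniqueness of the Levi-Civita connection. -/
theorem IsKillingOn.affineDefect_eq_zero (hU : IsOpen U) (hV : IsKillingOn V U)
    (hX : SmoothOn X U) (hY : SmoothOn Y U) (hx : x ∈ U) : affineDefect V X Y x = 0 := by
  refine ext_inner_right ℝ fun w ↦ ?_
  have hU' := hU.inter (chartAt E x).open_source
  have hx' : x ∈ U ∩ (chartAt E x).source := ⟨hx, mem_chart_source E x⟩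
  have hV := hV.mono (inter_subset_left (t := (chartAt E x).source))
  have hX := hX.mono (inter_subset_left (t := (chartAt E x).source))
  have hY := hY.mono (inter_subset_left (t := (chartAt E x).source))
  have hZ := (smoothOn_extend w).mono (inter_subset_right (s := U))
  have hw : (FiberBundle.extend E w : VField E M) x = w := by simp
  rw [inner_zero_left, ← hw]
  generalize (FiberBundle.extend E w : VField E M) = Z at hZ
  have h1 := inner_affineDefect hU' hV hX hY hZ hx'
  have h2 := inner_affineDefect hU' hV hZ hX hY hx'
  have h3 := inner_affineDefect hU' hV hY hZ hX hx'
  rw [affineDefect_symm hU' hV.1 hX hZ hx'] at h1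
  rw [affineDefect_symm hU' hV.1 hZ hY hx'] at h2
  rw [affineDefect_symm hU' hV.1 hY hX hx'] at h3
  linarith

theorem IsKillingOn.mlieBracket_leviCivita (hU : IsOpen U) (hV : IsKillingOn V U)
    (hX : SmoothOn X U) (hY : SmoothOn Y U) (hx : x ∈ U) :
    mlieBracket 𝓘(ℝ, E) V (fun y ↦ leviCivita E M Y y (X y)) x =
      leviCivita E M Y x (mlieBracket 𝓘(ℝ, E) V X x) +
      leviCivita E M (mlieBracket 𝓘(ℝ, E) V Y) x (X x) := by
  have := hV.affineDefect_eq_zero hU hX hY hx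
  rwa [affineDefect, sub_sub, sub_eq_zero] at this

/-! ### Tensoriality of the curvature -/

theorem curvatureOp_congr (hX : X =ᶠ[𝓝 x] X') (hY : Y =ᶠ[𝓝 x] Y') (hZ : Z =ᶠ[𝓝 x] Z') :
    curvatureOp X Y Z x = curvatureOp X' Y' Z' x := by
  have h1 : (fun y ↦ leviCivita E M Z y (Y y)) =ᶠ[𝓝 x] fun y ↦ leviCivita E M Z' y (Y' y) := by
    filter_upwards [hY, hZ.eventuallyEq_nhds] with y h1 h2
    rw [h1, leviCivita_congr h2]
  have h2 : (fun y ↦ leviCivita E M Z y (X y)) =ᶠ[𝓝 x] fun y ↦ leviCivita E M Z' y (X' y) := by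
    filter_upwards [hX, hZ.eventuallyEq_nhds] with y h1 h2
    rw [h1, leviCivita_congr h2]
  rw [curvatureOp, curvatureOp, leviCivita_congr h1, leviCivita_congr h2, hX.eq_of_nhds,
    hY.eq_of_nhds, mlieBracket_congr hX hY, leviCivita_congr hZ]

theorem curvatureOp_swap : curvatureOp X Y Z x = -curvatureOp Y X Z x := by
  rw [curvatureOp, curvatureOp, mlieBracket_swap_apply, map_neg]
  abel

theorem curvatureOp_add_left (hX : SmoothNear X x) (hX' : SmoothNear X' x)
    (hZ : SmoothNear Z x) :
    curvatureOp (X + X') Y Z x = curvatureOp X Y Z x + curvatureOp X' Y Z x := by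
  have := FiniteDimensional.complete ℝ E
  have e : (fun y ↦ leviCivita E M Z y ((X + X') y)) =
      (fun y ↦ leviCivita E M Z y (X y)) + fun y ↦ leviCivita E M Z y (X' y) := by
    ext y; simp
  rw [curvatureOp, curvatureOp, curvatureOp, e, leviCivita_add (hX.leviCivita hZ).mdiffAt
    (hX'.leviCivita hZ).mdiffAt, mlieBracket_add_left hX.mdiffAt hX'.mdiffAt]
  simp only [Pi.add_apply, map_add, add_apply]
  abel

theorem curvatureOp_smul_left (hU : IsOpen U) (hx : x ∈ U) (hf : CMDiff[U] ∞ f)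
    (hX : SmoothOn X U) (hZ : SmoothNear Z x) :
    curvatureOp (f • X) Y Z x = f x • curvatureOp X Y Z x := by
  have := FiniteDimensional.complete ℝ E
  have e : (fun y ↦ leviCivita E M Z y ((f • X) y)) = f • fun y ↦ leviCivita E M Z y (X y) := by
    ext y; simp
  have hfx := mdiffAt_of_contMDiffOn hf hU hx
  rw [curvatureOp, curvatureOp, e, leviCivita_smul hfx
    ((hX.smoothNear hU hx).leviCivita hZ).mdiffAt, mlieBracket_smul_left hfx (hX.mdiffAt hU hx)]
  simp
  module

theorem curvatureOp_add_right (hX : SmoothNear X x) (hY : SmoothNear Y x) (hZ : SmoothNear Z x)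
    (hZ' : SmoothNear Z' x) :
    curvatureOp X Y (Z + Z') x = curvatureOp X Y Z x + curvatureOp X Y Z' x := by
  obtain ⟨U, hU, hxU, hZU, hZU'⟩ := hZ.exists_smoothOn hZ'
  have e (W : VField E M) : (fun y ↦ leviCivita E M (Z + Z') y (W y)) =ᶠ[𝓝 x]
      (fun y ↦ leviCivita E M Z y (W y)) + fun y ↦ leviCivita E M Z' y (W y) := by
    filter_upwards [hU.mem_nhds hxU] with y hy
    rw [leviCivita_add (hZU.mdiffAt hU hy) (hZU'.mdiffAt hU hy)]
    rfl
  rw [curvatureOp, curvatureOp, curvatureOp, leviCivita_congr (e Y), leviCivita_congr (e X),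
    leviCivita_add (hX.leviCivita hZ).mdiffAt (hX.leviCivita hZ').mdiffAt,
    leviCivita_add (hY.leviCivita hZ).mdiffAt (hY.leviCivita hZ').mdiffAt,
    leviCivita_add hZ.mdiffAt hZ'.mdiffAt]
  simp only [add_apply]
  abel

theorem curvatureOp_smul_right (hU : IsOpen U) (hx : x ∈ U) (hf : CMDiff[U] ∞ f)
    (hX : SmoothOn X U) (hY : SmoothOn Y U) (hZ : SmoothOn Z U) :
    curvatureOp X Y (f • Z) x = f x • curvatureOp X Y Z x := by
  have := FiniteDimensional.complete ℝ E
  have hfU {y} (hy : y ∈ U) := mdiffAt_of_contMDiffOn hf hU hy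
  have e (W : VField E M) : (fun y ↦ leviCivita E M (f • Z) y (W y)) =ᶠ[𝓝 x]
      (f • fun y ↦ leviCivita E M Z y (W y)) + (fun y ↦ d% f y (W y)) • Z := by
    filter_upwards [hU.mem_nhds hx] with y hy
    rw [leviCivita_smul (hfU hy) (hZ.mdiffAt hU hy)]
    rfl
  -- After antisymmetrization the mixed first-derivative terms cancel, and the second derivatives of
  -- `f` combine to its derivative along the bracket, matching the last term of the curvature.
  have h1 {W W' : VField E M} (hW : SmoothOn W U) :
      leviCivita E M (fun y ↦ leviCivita E M (f • Z) y (W y)) x (W' x) =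
      f x • leviCivita E M (fun y ↦ leviCivita E M Z y (W y)) x (W' x) +
        d% f x (W' x) • leviCivita E M Z x (W x) + (d% f x (W x) • leviCivita E M Z x (W' x) +
        d% (fun y ↦ d% f y (W y)) x (W' x) • Z x) := by
    have hWZ := hW.leviCivita hU hZ
    have hWf := hW.contMDiffOn_mvfderiv hU hf
    rw [leviCivita_congr (e W), leviCivita_add ((hWZ.smul hf).mdiffAt hU hx)
      ((hZ.smul hWf).mdiffAt hU hx), add_apply, leviCivita_smul (hfU hx) (hWZ.mdiffAt hU hx),
      leviCivita_smul (mdiffAt_of_contMDiffOn hWf hU hx) (hZ.mdiffAt hU hx)]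
  rw [curvatureOp, curvatureOp, h1 hX, h1 hY, leviCivita_smul (hfU hx) (hZ.mdiffAt hU hx),
    mvfderiv_mlieBracket hU hX hY hf hx]
  module

/-- Tensoriality in the first and third slots is direct; the second slot follows from the first by
antisymmetry. -/
theorem curvatureOp_eq_of_eq (hX : SmoothNear X x) (hX' : SmoothNear X' x) (hY : SmoothNear Y x)
    (hY' : SmoothNear Y' x) (hZ : SmoothNear Z x) (hZ' : SmoothNear Z' x) (h1 : X x = X' x)
    (h2 : Y x = Y' x) (h3 : Z x = Z' x) : curvatureOp X Y Z x = curvatureOp X' Y' Z' x := by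
  have left {X X' Y Z : VField E M} (hX : SmoothNear X x) (hX' : SmoothNear X' x)
      (hZ : SmoothNear Z x) (h1 : X x = X' x) :
      curvatureOp X Y Z x = curvatureOp X' Y Z x :=
    eq_of_tensorial (Φ := fun X ↦ curvatureOp X Y Z x)
      (fun X X' h ↦ curvatureOp_congr h (Filter.EventuallyEq.refl _ Y)
        (Filter.EventuallyEq.refl _ Z))
      (fun X X' hX hX' ↦ curvatureOp_add_left hX hX' hZ)
      (fun U f X hU hx hf hX ↦ curvatureOp_smul_left hU hx hf hX hZ) hX hX' h1
  have right : curvatureOp X Y Z x = curvatureOp X Y Z' x :=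
    eq_of_tensorial (Φ := fun Z ↦ curvatureOp X Y Z x)
      (fun Z Z' h ↦ curvatureOp_congr (Filter.EventuallyEq.refl _ X)
        (Filter.EventuallyEq.refl _ Y) h)
      (fun Z Z' hZ hZ' ↦ curvatureOp_add_right hX hY hZ hZ')
      (fun U f Z hU hx hf hZ ↦ by
        obtain ⟨U', hU', hx', hX, hY⟩ := hX.exists_smoothOn hY
        exact curvatureOp_smul_right (hU.inter hU') ⟨hx, hx'⟩ (hf.mono inter_subset_left)
          (hX.mono inter_subset_right) (hY.mono inter_subset_right) (hZ.mono inter_subset_left))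
      hZ hZ' h3
  rw [right, left hX hX' hZ' h1, curvatureOp_swap, left hY hY' hZ' h2, curvatureOp_swap,
    neg_neg]

/-- Frees `curvature` from the particular extensions in its definition: any fields smooth near the
point may be used. -/
theorem curvature_apply (hX : SmoothNear X x) (hY : SmoothNear Y x) (hZ : SmoothNear Z x) :
    curvature x (X x) (Y x) (Z x) = curvatureOp X Y Z x :=
  curvatureOp_eq_of_eq (smoothNear_extend _) hX (smoothNear_extend _) hY (smoothNear_extend _) hZ
    (by simp) (by simp) (by simp)

theorem SmoothOn.curvatureOp (hU : IsOpen U) (hX : SmoothOn X U) (hY : SmoothOn Y U)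
    (hZ : SmoothOn Z U) : SmoothOn (RiemannCartan.curvatureOp X Y Z) U := by
  have := FiniteDimensional.complete ℝ E
  exact ((hX.leviCivita hU (hY.leviCivita hU hZ)).sub
    (hY.leviCivita hU (hX.leviCivita hU hZ))).sub ((hX.mlieBracket hU hY).leviCivita hU hZ)

theorem SmoothOn.curvature (hU : IsOpen U) (hX : SmoothOn X U) (hY : SmoothOn Y U)
    (hZ : SmoothOn Z U) : SmoothOn (fun y ↦ RiemannCartan.curvature y (X y) (Y y) (Z y)) U :=
  (hX.curvatureOp hU hY hZ).congr fun _ hy ↦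
    curvature_apply (hX.smoothNear hU hy) (hY.smoothNear hU hy) (hZ.smoothNear hU hy)

/-! ### Algebraic symmetries of the curvature tensor -/

section Algebra

variable (u u' v v' w w' : TangentSpace 𝓘(ℝ, E) x) (c : ℝ)

theorem curvature_swap : curvature x u v w = -curvature x v u w := curvatureOp_swap

theorem curvature_add_left : curvature x (u + u') v w = curvature x u v w + curvature x u' v w := by
  obtain ⟨X, hX, rfl⟩ := exists_smoothNear u
  obtain ⟨X', hX', rfl⟩ := exists_smoothNear u'
  obtain ⟨Y, hY, rfl⟩ := exists_smoothNear v
  obtain ⟨Z, hZ, rfl⟩ := exists_smoothNear w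
  obtain ⟨U, hU, hxU, h1, h2⟩ := hX.exists_smoothOn hX'
  have h := curvature_apply ((h1.add h2).smoothNear hU hxU) hY hZ
  rw [curvatureOp_add_left hX hX' hZ, Pi.add_apply] at h
  rw [h, curvature_apply hX hY hZ, curvature_apply hX' hY hZ]

theorem curvature_smul_left : curvature x (c • u) v w = c • curvature x u v w := by
  obtain ⟨X, hX, rfl⟩ := exists_smoothNear u
  obtain ⟨Y, hY, rfl⟩ := exists_smoothNear v
  obtain ⟨Z, hZ, rfl⟩ := exists_smoothNear w
  obtain ⟨U, hU, hxU, hXU⟩ := id hX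
  have h := curvature_apply ((hXU.const_smul c).smoothNear hU hxU) hY hZ
  have e : c • X = (fun _ : M ↦ c) • X := rfl
  rw [Pi.smul_apply, e, curvatureOp_smul_left hU hxU contMDiffOn_const hXU hZ] at h
  rw [h, curvature_apply hX hY hZ]

theorem curvature_add_right :
    curvature x u v (w + w') = curvature x u v w + curvature x u v w' := by
  obtain ⟨X, hX, rfl⟩ := exists_smoothNear u
  obtain ⟨Y, hY, rfl⟩ := exists_smoothNear v
  obtain ⟨Z, hZ, rfl⟩ := exists_smoothNear w
  obtain ⟨Z', hZ', rfl⟩ := exists_smoothNear w'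
  obtain ⟨U, hU, hxU, h1, h2⟩ := hZ.exists_smoothOn hZ'
  have h := curvature_apply hX hY ((h1.add h2).smoothNear hU hxU)
  rw [curvatureOp_add_right hX hY hZ hZ', Pi.add_apply] at h
  rw [h, curvature_apply hX hY hZ, curvature_apply hX hY hZ']

theorem curvature_smul_right : curvature x u v (c • w) = c • curvature x u v w := by
  obtain ⟨X, hX, rfl⟩ := exists_smoothNear u
  obtain ⟨Y, hY, rfl⟩ := exists_smoothNear v
  obtain ⟨Z, hZ, rfl⟩ := exists_smoothNear w
  obtain ⟨U, hU, hxU, hXU, hYU, hZU⟩ := hX.exists_smoothOn₃ hY hZ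
  have h := curvature_apply hX hY ((hZU.const_smul c).smoothNear hU hxU)
  have e : c • Z = (fun _ : M ↦ c) • Z := rfl
  rw [Pi.smul_apply, e, curvatureOp_smul_right hU hxU contMDiffOn_const hXU hYU hZU] at h
  rw [h, curvature_apply hX hY hZ]

theorem curvature_add_middle :
    curvature x u (v + v') w = curvature x u v w + curvature x u v' w := by
  rw [curvature_swap, curvature_add_left, curvature_swap u v, curvature_swap u v']
  abel

theorem curvature_smul_middle : curvature x u (c • v) w = c • curvature x u v w := by
  rw [curvature_swap, curvature_smul_left, curvature_swap u v, smul_neg]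

/-- Apply the bracket of `X` and `Y` to `⟪Z, W⟫`, directly and as a commutator of derivations; the
products of first derivatives are symmetric in `X, Y` and drop out. -/
theorem inner_curvature_skew :
    inner ℝ (curvature x u v w) w' + inner ℝ w (curvature x u v w') = 0 := by
  have := FiniteDimensional.complete ℝ E
  obtain ⟨X, hX, rfl⟩ := exists_smoothNear u
  obtain ⟨Y, hY, rfl⟩ := exists_smoothNear v
  obtain ⟨Z, hZ, rfl⟩ := exists_smoothNear w
  obtain ⟨W, hW, rfl⟩ := exists_smoothNear w'
  rw [curvature_apply hX hY hZ, curvature_apply hX hY hW]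
  obtain ⟨U₁, hU₁, hx₁, hX, hY⟩ := hX.exists_smoothOn hY
  obtain ⟨U₂, hU₂, hx₂, hZ, hW⟩ := hZ.exists_smoothOn hW
  obtain ⟨U, hU, hx, hX, hY, hZ, hW⟩ : ∃ U : Set M, IsOpen U ∧ x ∈ U ∧ SmoothOn X U ∧
      SmoothOn Y U ∧ SmoothOn Z U ∧ SmoothOn W U :=
    ⟨U₁ ∩ U₂, hU₁.inter hU₂, ⟨hx₁, hx₂⟩, hX.mono inter_subset_left, hY.mono inter_subset_left,
      hZ.mono inter_subset_right, hW.mono inter_subset_right⟩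
  have hZx := hZ.mdiffAt hU hx
  have hWx := hW.mdiffAt hU hx
  have key {X Y : VField E M} (hX : SmoothOn X U) (hY : SmoothOn Y U) :
      d% (fun y ↦ d% (fun y ↦ inner ℝ (Z y) (W y)) y (Y y)) x (X x) =
      inner ℝ (leviCivita E M (fun y ↦ leviCivita E M Z y (Y y)) x (X x)) (W x) +
      inner ℝ (leviCivita E M Z x (Y x)) (leviCivita E M W x (X x)) +
      (inner ℝ (leviCivita E M Z x (X x)) (leviCivita E M W x (Y x)) +
      inner ℝ (Z x) (leviCivita E M (fun y ↦ leviCivita E M W y (Y y)) x (X x))) := by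
    have hYZ := (hY.leviCivita hU hZ).mdiffAt hU hx
    have hYW := (hY.leviCivita hU hW).mdiffAt hU hx
    rw [mvfderiv_congr_of_isOpen hU hx
      fun y hy ↦ leviCivita_metric_apply (hZ.mdiffAt hU hy) (hW.mdiffAt hU hy) (Y y),
      mvfderiv_fun_add (mdiff_inner hYZ hWx) (mdiff_inner hZx hYW), add_apply,
      leviCivita_metric_apply hYZ hWx, leviCivita_metric_apply hZx hYW]
  have hb := mvfderiv_mlieBracket hU hX hY (hZ.inner hW) hx
  rw [key hX hY, key hY hX, leviCivita_metric_apply hZx hWx] at hb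
  simp only [RiemannCartan.curvatureOp, inner_sub_left, inner_sub_right]
  linarith

/-- The Jacobi identity with all brackets rewritten through the torsion-free connection. -/
theorem curvature_bianchi :
    curvature x u v w + curvature x v w u + curvature x w u v = 0 := by
  have := FiniteDimensional.complete ℝ E
  obtain ⟨X, hX, rfl⟩ := exists_smoothNear u
  obtain ⟨Y, hY, rfl⟩ := exists_smoothNear v
  obtain ⟨Z, hZ, rfl⟩ := exists_smoothNear w
  rw [curvature_apply hX hY hZ, curvature_apply hY hZ hX, curvature_apply hZ hX hY]
  obtain ⟨U, hU, hx, hX, hY, hZ⟩ := hX.exists_smoothOn₃ hY hZ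
  have key {X Y Z : VField E M} (hX : SmoothOn X U) (hY : SmoothOn Y U) (hZ : SmoothOn Z U) :
      mlieBracket 𝓘(ℝ, E) X (mlieBracket 𝓘(ℝ, E) Y Z) x =
      leviCivita E M (fun y ↦ leviCivita E M Z y (Y y)) x (X x) -
      leviCivita E M (fun y ↦ leviCivita E M Y y (Z y)) x (X x) -
      leviCivita E M X x (mlieBracket 𝓘(ℝ, E) Y Z x) := by
    rw [← leviCivita_torsionFree (hX.mdiffAt hU hx) ((hY.mlieBracket hU hZ).mdiffAt hU hx)]
    have e : mlieBracket 𝓘(ℝ, E) Y Z =ᶠ[𝓝 x]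
        (fun y ↦ leviCivita E M Z y (Y y)) - (fun y ↦ leviCivita E M Y y (Z y)) := by
      filter_upwards [hU.mem_nhds hx] with y hy
      exact (leviCivita_torsionFree (hY.mdiffAt hU hy) (hZ.mdiffAt hU hy)).symm
    rw [leviCivita_congr e, leviCivita_sub ((hY.leviCivita hU hZ).mdiffAt hU hx)
      ((hZ.leviCivita hU hY).mdiffAt hU hx)]
    rfl
  have hj := jacobi_mlieBracket hU hX hY hZ hx
  rw [mlieBracket_swap_apply (V := mlieBracket 𝓘(ℝ, E) X Y) (W := Z), key hX hY hZ, key hZ hX hY,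
    key hY hX hZ, mlieBracket_swap_apply (V := X) (W := Z), map_neg] at hj
  rw [← sub_eq_zero] at hj
  rw [← hj]
  simp only [RiemannCartan.curvatureOp]
  abel

end Algebra

end

end Curvature

/-! ### Algebraic curvature tensors invariant under the orthogonal Lie algebra -/

section InvariantTensor

noncomputable section

set_option maxSynthPendingDepth 3
set_option linter.unusedSectionVars false

variable {T : Type*} [NormedAddCommGroup T] [InnerProductSpace ℝ T]

/-- Skew-symmetric endomorphisms. -/
def IsSkew (A : T →L[ℝ] T) : Prop := ∀ v w, inner ℝ (A v) w + inner ℝ v (A w) = 0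

/-- The skew-symmetric endomorphism `x ↦ ⟪b, x⟫ a - ⟪a, x⟫ b`. -/
def elementarySkew (a b : T) : T →L[ℝ] T :=
  (innerSL ℝ b).smulRight a - (innerSL ℝ a).smulRight b

theorem elementarySkew_apply (a b x : T) :
    elementarySkew a b x = inner ℝ b x • a - inner ℝ a x • b := by
  simp [elementarySkew]

theorem isSkew_elementarySkew (a b : T) : IsSkew (elementarySkew a b) := fun v w ↦ by
  simp only [elementarySkew_apply, inner_sub_left, inner_sub_right, inner_smul_left,
    inner_smul_right, conj_trivial, real_inner_comm v]
  rw [real_inner_comm w a, real_inner_comm w b]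
  ring

variable {R : T →ₗ[ℝ] T →ₗ[ℝ] T →ₗ[ℝ] T}

/-- The classical octahedron argument: add up the four cyclic instances of the Bianchi identity and
cancel with the two skew symmetries. -/
theorem inner_pair_symm (hanti : ∀ u v w, R u v w = -R v u w)
    (hskew : ∀ u v w z, inner ℝ (R u v w) z + inner ℝ w (R u v z) = 0)
    (hbianchi : ∀ u v w, R u v w + R v w u + R w u v = 0) (u v w z : T) :
    inner ℝ (R u v w) z = inner ℝ (R w z u) v := by
  have hb (u v w z : T) :
      inner ℝ (R u v w) z + inner ℝ (R v w u) z + inner ℝ (R w u v) z = 0 := by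
    rw [← inner_add_left, ← inner_add_left, hbianchi, inner_zero_left]
  have ha (u v w z : T) : inner ℝ (R u v w) z = -inner ℝ (R v u w) z := by
    rw [hanti, inner_neg_left]
  have hs (u v w z : T) : inner ℝ (R u v w) z = -inner ℝ (R u v z) w := by
    have := hskew u v w z
    rw [real_inner_comm] at this
    linarith [real_inner_comm (R u v z) w, real_inner_comm (R u v w) z]
  have b1 := hb u v w z
  have b2 := hb v w z u
  have b3 := hb w z u v
  have b4 := hb z u v w
  linarith [hs v w z u, hs w z v u, hs z u w v, hs u v z w, hs u w z v, ha u w v z, hs v z u w,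
    ha v z w u]

variable [FiniteDimensional ℝ T]

/-- A curvature tensor that is invariant under all skew-symmetric endomorphisms has constant
sectional curvature. -/
theorem exists_eq_smul_of_invariant (hanti : ∀ u v w, R u v w = -R v u w)
    (hskew : ∀ u v w z, inner ℝ (R u v w) z + inner ℝ w (R u v z) = 0)
    (hbianchi : ∀ u v w, R u v w + R v w u + R w u v = 0)
    (hinv : ∀ A : T →L[ℝ] T, IsSkew A → ∀ u v w,
      A (R u v w) - R (A u) v w - R u (A v) w - R u v (A w) = 0) :
    ∃ k : ℝ, ∀ u v w, R u v w = k • (inner ℝ v w • u - inner ℝ u w • v) := by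
  have hzero (u w : T) : R u u w = 0 := by
    have : (2 : ℝ) • R u u w = 0 := by
      rw [two_smul]; nth_rewrite 1 [hanti]; rw [neg_add_cancel]
    exact (smul_eq_zero.1 this).resolve_left two_ne_zero
  -- Below dimension 2 the tensor vanishes by antisymmetry. The main argument divides by `n - 1`, so
  -- this case is treated apart.
  rcases Nat.lt_or_ge (Module.finrank ℝ T) 2 with hn | hn
  · obtain ⟨e, he⟩ := finrank_le_one_iff.1 (Nat.le_of_lt_succ hn)
    refine ⟨0, fun u v w ↦ ?_⟩
    obtain ⟨c, rfl⟩ := he u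
    obtain ⟨d, rfl⟩ := he v
    have : R e e w = 0 := hzero e w
    simp [this]
  let e := stdOrthonormalBasis ℝ T
  set n : ℝ := (Module.finrank ℝ T : ℝ) with hnd
  have hn1 : n - 1 ≠ 0 := by
    have : (2 : ℝ) ≤ n := by rw [hnd]; exact_mod_cast hn
    linarith
  have hn0 : n ≠ 0 := by
    have : (2 : ℝ) ≤ n := by rw [hnd]; exact_mod_cast hn
    linarith
  have hcard (x : T) : ∑ _i : Fin (Module.finrank ℝ T), x = n • x := by
    rw [Finset.sum_const, Finset.card_univ, Fintype.card_fin, hnd, Nat.cast_smul_eq_nsmul]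
  -- The Ricci endomorphism.
  let ρ : T →ₗ[ℝ] T := ∑ i, (R.flip (e i)).flip (e i)
  have hρ (v : T) : ρ v = ∑ i, R v (e i) (e i) := by simp [ρ]
  have hsum (x : T) : ∑ i, inner ℝ (e i) x • e i = x := e.sum_repr' x
  have hsum' (x : T) : ∑ i, inner ℝ x (e i) • e i = x := by
    simpa only [real_inner_comm] using hsum x
  -- Apply invariance under the elementary skew map of `a` and `e i` to the arguments `e i, v, w`
  -- and sum over `i`. Pair symmetry and the Bianchi identity collect the terms into a formula for
  -- `R` through its Ricci endomorphism.
  have step1 (a v w : T) :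
      (n - 1) • R a v w = inner ℝ (ρ v) w • a - inner ℝ a w • ρ v := by
    have h := Finset.sum_eq_zero (s := Finset.univ) fun (i : Fin (Module.finrank ℝ T)) _ ↦
      hinv (elementarySkew a (e i)) (isSkew_elementarySkew a (e i)) (e i) v w
    simp only [elementarySkew_apply, map_sub, map_smul, LinearMap.sub_apply, LinearMap.smul_apply,
      Finset.sum_sub_distrib] at h
    have h1 : ∑ i, inner ℝ (e i) (R (e i) v w) • a = inner ℝ (ρ v) w • a := by
      rw [← Finset.sum_smul, hρ, sum_inner]
      congr 1
      refine Finset.sum_congr rfl fun i _ ↦ ?_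
      have := hskew v (e i) (e i) w
      rw [hanti (e i) v w, inner_neg_right]
      linarith
    have h2 : ∑ i, inner ℝ a (R (e i) v w) • e i = -R w a v := by
      rw [← hsum (-R w a v)]
      refine Finset.sum_congr rfl fun i _ ↦ ?_
      congr 1
      rw [real_inner_comm, inner_pair_symm hanti hskew hbianchi, inner_neg_right]
      linarith [hskew w a (e i) v]
    have h3 : ∑ i, inner ℝ (e i) (e i) • R a v w = n • R a v w := by
      rw [← hcard]
      refine Finset.sum_congr rfl fun i _ ↦ ?_
      rw [real_inner_self_eq_norm_sq, e.orthonormal.1 i, one_pow, one_smul]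
    have h4 (a' : T) : ∑ i, inner ℝ a' (e i) • R (e i) v w = R a' v w := by
      conv_rhs => rw [← hsum' a']
      simp
    have h5 (v' : T) : ∑ i, inner ℝ (e i) v' • R (e i) a w = R v' a w := by
      conv_rhs => rw [← hsum v']
      simp
    have h6 : ∑ i, inner ℝ a v • R (e i) (e i) w = 0 :=
      Finset.sum_eq_zero fun i _ ↦ by rw [hzero (e i) w, smul_zero]
    have h7 : ∑ i, inner ℝ (e i) w • R (e i) v a = R w v a := by
      conv_rhs => rw [← hsum w]
      simp
    have h8 : ∑ i, inner ℝ a w • R (e i) v (e i) = -(inner ℝ a w • ρ v) := by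
      rw [← Finset.smul_sum, hρ, ← smul_neg, ← Finset.sum_neg_distrib]
      refine congrArg _ (Finset.sum_congr rfl fun i _ ↦ hanti _ _ _)
    rw [h1, h2, h3, h4, h5, h6, h7, h8] at h
    have hb := hbianchi a v w
    rw [hanti v w a] at hb
    rw [hanti v a w] at h
    rw [← sub_eq_zero, ← neg_eq_zero, ← h]
    have hb' : R w a v = R w v a - R a v w := by
      rw [← sub_eq_zero, ← hb]; abel
    rw [hb']
    module
  -- The formula of `step1` must respect antisymmetry in the first two slots. Tracing the resulting
  -- identity shows that `ρ` is scalar, and substituting this back gives constant curvature.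
  have step2 (v : T) : n • ρ v = (∑ i, inner ℝ (ρ (e i)) (e i)) • v := by
    have h := Finset.sum_congr (s₁ := Finset.univ) rfl fun (i : Fin (Module.finrank ℝ T)) _ ↦
      (step1 (e i) v (e i)).symm.trans
        ((congrArg ((n - 1) • ·) (hanti (e i) v (e i))).trans
          ((smul_neg _ _).trans (congrArg Neg.neg (step1 v (e i) (e i)))))
    simp only [Finset.sum_sub_distrib, Finset.sum_neg_distrib] at h
    have h1 : ∑ i, inner ℝ (e i) (e i) • ρ v = n • ρ v := by
      rw [← hcard]
      refine Finset.sum_congr rfl fun i _ ↦ ?_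
      rw [real_inner_self_eq_norm_sq, e.orthonormal.1 i, one_pow, one_smul]
    have h2 : ∑ i, inner ℝ v (e i) • ρ (e i) = ρ v := by
      conv_rhs => rw [← hsum' v]
      simp
    rw [hsum', h1, h2, ← Finset.sum_smul] at h
    rw [← sub_eq_zero] at h ⊢
    rw [← neg_eq_zero, ← h]
    abel
  refine ⟨(∑ i, inner ℝ (ρ (e i)) (e i)) / (n * (n - 1)), fun u v w ↦ ?_⟩
  have h2 (v : T) : ρ v = ((∑ i, inner ℝ (ρ (e i)) (e i)) / n) • v := by
    rw [div_eq_inv_mul, mul_smul, ← step2, inv_smul_smul₀ hn0]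
  have h3 : R u v w = (n - 1)⁻¹ • ((n - 1) • R u v w) := (inv_smul_smul₀ hn1 _).symm
  rw [h3, step1, h2, inner_smul_left, conj_trivial, smul_comm _ _ v, mul_smul, ← smul_sub,
    smul_smul, div_mul_eq_div_div, div_eq_inv_mul _ (n - 1)]

end

end InvariantTensor

/-! ### Infinitesimal isometries preserve the curvature -/

section LieDerivative

noncomputable section

set_option maxSynthPendingDepth 3
set_option linter.unusedSectionVars false

variable {E : Type*} [NormedAddCommGroup E] [NormedSpace ℝ E]
  {M : Type*} [TopologicalSpace M] [ChartedSpace E M] [IsManifold 𝓘(ℝ, E) ∞ M]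
  {X Y Z V W X' Y' Z' : VField E M} {U U' : Set M} {m x y : M} {f g : M → ℝ}
  [FiniteDimensional ℝ E]
  [RiemannianBundle (fun x : M ↦ TangentSpace 𝓘(ℝ, E) x)]
  [IsContMDiffRiemannianBundle 𝓘(ℝ, E) ∞ E (fun x : M ↦ TangentSpace 𝓘(ℝ, E) x)]

/-- The Lie derivative along `V` is a derivation for the connection, since `V` is affine, and for
brackets, by Jacobi; hence also for the curvature, which is built from these. -/
theorem IsKillingOn.mlieBracket_curvatureOp (hU : IsOpen U) (hV : IsKillingOn V U)
    (hX : SmoothOn X U) (hY : SmoothOn Y U) (hZ : SmoothOn Z U) (hx : x ∈ U) :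
    mlieBracket 𝓘(ℝ, E) V (curvatureOp X Y Z) x =
      curvatureOp (mlieBracket 𝓘(ℝ, E) V X) Y Z x + curvatureOp X (mlieBracket 𝓘(ℝ, E) V Y) Z x +
      curvatureOp X Y (mlieBracket 𝓘(ℝ, E) V Z) x := by
  have := FiniteDimensional.complete ℝ E
  have key {X Y : VField E M} (hX : SmoothOn X U) (hY : SmoothOn Y U) :
      mlieBracket 𝓘(ℝ, E) V
        (fun y ↦ leviCivita E M (fun y ↦ leviCivita E M Z y (Y y)) y (X y)) x =
      leviCivita E M (fun y ↦ leviCivita E M Z y (Y y)) x (mlieBracket 𝓘(ℝ, E) V X x) +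
      (leviCivita E M (fun y ↦ leviCivita E M Z y (mlieBracket 𝓘(ℝ, E) V Y y)) x (X x) +
      leviCivita E M (fun y ↦ leviCivita E M (mlieBracket 𝓘(ℝ, E) V Z) y (Y y)) x (X x)) := by
    have e : mlieBracket 𝓘(ℝ, E) V (fun y ↦ leviCivita E M Z y (Y y)) =ᶠ[𝓝 x]
        (fun y ↦ leviCivita E M Z y (mlieBracket 𝓘(ℝ, E) V Y y)) +
        (fun y ↦ leviCivita E M (mlieBracket 𝓘(ℝ, E) V Z) y (Y y)) := by
      filter_upwards [hU.mem_nhds hx] with y hy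
      exact hV.mlieBracket_leviCivita hU hY hZ hy
    rw [hV.mlieBracket_leviCivita hU hX (hY.leviCivita hU hZ) hx, leviCivita_congr e,
      leviCivita_add (((hV.1.mlieBracket hU hY).leviCivita hU hZ).mdiffAt hU hx)
        ((hY.leviCivita hU (hV.1.mlieBracket hU hZ)).mdiffAt hU hx)]
    rfl
  have hXY := hX.mlieBracket hU hY
  have e : curvatureOp X Y Z =
      ((fun y ↦ leviCivita E M (fun y ↦ leviCivita E M Z y (Y y)) y (X y)) -
      (fun y ↦ leviCivita E M (fun y ↦ leviCivita E M Z y (X y)) y (Y y))) -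
      (fun y ↦ leviCivita E M Z y (mlieBracket 𝓘(ℝ, E) X Y y)) := rfl
  have h1 := hX.leviCivita hU (hY.leviCivita hU hZ)
  have h2 := hY.leviCivita hU (hX.leviCivita hU hZ)
  rw [e, bracket_sub_right ((h1.sub h2).mdiffAt hU hx) ((hXY.leviCivita hU hZ).mdiffAt hU hx),
    bracket_sub_right (h1.mdiffAt hU hx) (h2.mdiffAt hU hx), key hX hY, key hY hX,
    hV.mlieBracket_leviCivita hU hXY hZ hx, jacobi_mlieBracket hU hV.1 hX hY hx, map_add]
  simp only [curvatureOp]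
  abel

/-- The action of the covariant derivative of a Killing field on the curvature. -/
theorem IsKillingOn.leviCivita_curvature (hU : IsOpen U) (hV : IsKillingOn V U) (hx : x ∈ U)
    (hX : SmoothNear X x) (hY : SmoothNear Y x) (hZ : SmoothNear Z x) :
    leviCivita E M (fun y ↦ curvature y (X y) (Y y) (Z y)) x (V x)
        - curvature x (leviCivita E M X x (V x)) (Y x) (Z x)
        - curvature x (X x) (leviCivita E M Y x (V x)) (Z x)
        - curvature x (X x) (Y x) (leviCivita E M Z x (V x)) =
      leviCivita E M V x (curvature x (X x) (Y x) (Z x))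
        - curvature x (leviCivita E M V x (X x)) (Y x) (Z x)
        - curvature x (X x) (leviCivita E M V x (Y x)) (Z x)
        - curvature x (X x) (Y x) (leviCivita E M V x (Z x)) := by
  have := FiniteDimensional.complete ℝ E
  obtain ⟨U', hU', hx', hX, hY, hZ⟩ := hX.exists_smoothOn₃ hY hZ
  have hV := hV.mono (inter_subset_left (t := U'))
  have hX := hX.mono (inter_subset_right (s := U))
  have hY := hY.mono (inter_subset_right (s := U))
  have hZ := hZ.mono (inter_subset_right (s := U))
  have hU := hU.inter hU'
  have hx : x ∈ U ∩ U' := ⟨hx, hx'⟩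
  have near {W : VField E M} (hW : SmoothOn W (U ∩ U')) {y : M} (hy : y ∈ U ∩ U') :
      SmoothNear W y := hW.smoothNear hU hy
  have h := hV.mlieBracket_curvatureOp hU hX hY hZ hx
  have hVX := hV.1.mlieBracket hU hX
  have hVY := hV.1.mlieBracket hU hY
  have hVZ := hV.1.mlieBracket hU hZ
  -- Each bracket with `V` becomes a difference of covariant derivatives: the parts differentiating
  -- along `V` form `∇_V R`, the parts containing `∇V` form its action on `R`.
  rw [← curvature_apply (near hVX hx) (near hY hx) (near hZ hx),
    ← curvature_apply (near hX hx) (near hVY hx) (near hZ hx),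
    ← curvature_apply (near hX hx) (near hY hx) (near hVZ hx),
    ← leviCivita_torsionFree (hV.1.mdiffAt hU hx) ((hX.curvatureOp hU hY hZ).mdiffAt hU hx),
    ← leviCivita_torsionFree (hV.1.mdiffAt hU hx) (hX.mdiffAt hU hx),
    ← leviCivita_torsionFree (hV.1.mdiffAt hU hx) (hY.mdiffAt hU hx),
    ← leviCivita_torsionFree (hV.1.mdiffAt hU hx) (hZ.mdiffAt hU hx),
    ← curvature_apply (near hX hx) (near hY hx) (near hZ hx)] at h
  have e : curvatureOp X Y Z =ᶠ[𝓝 x] fun y ↦ curvature y (X y) (Y y) (Z y) := by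
    filter_upwards [hU.mem_nhds hx] with y hy
    exact (curvature_apply (near hX hy) (near hY hy) (near hZ hy)).symm
  rw [leviCivita_congr e] at h
  have s1 (a b v w : TangentSpace 𝓘(ℝ, E) x) :
      curvature x (a - b) v w = curvature x a v w - curvature x b v w := by
    rw [eq_sub_iff_add_eq, ← curvature_add_left, sub_add_cancel]
  have s2 (a b v w : TangentSpace 𝓘(ℝ, E) x) :
      curvature x v (a - b) w = curvature x v a w - curvature x v b w := by
    rw [eq_sub_iff_add_eq, ← curvature_add_middle, sub_add_cancel]
  have s3 (a b v w : TangentSpace 𝓘(ℝ, E) x) :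
      curvature x v w (a - b) = curvature x v w a - curvature x v w b := by
    rw [eq_sub_iff_add_eq, ← curvature_add_right, sub_add_cancel]
  rw [s1, s2, s3, sub_eq_iff_eq_add] at h
  rw [h]
  abel

variable (E) in
/-- Near `x` there are Killing fields with arbitrary value and arbitrary skew-symmetric covariant
derivative at `x`. -/
def HasAllKillingJets (x : M) : Prop :=
  ∀ (v : TangentSpace 𝓘(ℝ, E) x) (Ψ : TangentSpace 𝓘(ℝ, E) x →L[ℝ] TangentSpace 𝓘(ℝ, E) x),
    IsSkew Ψ → ∃ (U : Set M) (V : VField E M), IsOpen U ∧ x ∈ U ∧ IsKillingOn V U ∧ V x = v ∧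
      leviCivita E M V x = Ψ

/-- A Killing field with `V x = 0` and `∇V x = A` kills the `∇_V R` side, leaving the action of `A`
on the curvature. -/
theorem curvatureInvariant_of_hasAllKillingJets (h : ∀ x : M, HasAllKillingJets E x) :
    CurvatureInvariant E M := by
  intro x A hA u v w
  obtain ⟨U, V, hU, hx, hV, hVx, hVA⟩ := h x 0 A hA
  obtain ⟨X, hX, rfl⟩ := exists_smoothNear u
  obtain ⟨Y, hY, rfl⟩ := exists_smoothNear v
  obtain ⟨Z, hZ, rfl⟩ := exists_smoothNear w
  have key := hV.leviCivita_curvature hU hx hX hY hZ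
  have z1 (v w : TangentSpace 𝓘(ℝ, E) x) : curvature x 0 v w = 0 := by
    simpa using curvature_smul_left 0 v w 0
  have z2 (v w : TangentSpace 𝓘(ℝ, E) x) : curvature x v 0 w = 0 := by
    simpa using curvature_smul_middle v 0 w 0
  have z3 (v w : TangentSpace 𝓘(ℝ, E) x) : curvature x v w 0 = 0 := by
    simpa using curvature_smul_right v w 0 0
  rw [hVx, hVA] at key
  simp only [map_zero, z1, z2, z3, sub_zero] at key
  exact key.symm

/-- A Killing field with `V x = v` and `∇V x = 0` kills the other side of the same identity. -/
theorem curvatureParallel_of_hasAllKillingJets (h : ∀ x : M, HasAllKillingJets E x) :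
    CurvatureParallel E M := by
  intro x X Y Z hX hY hZ v
  obtain ⟨U, V, hU, hx, hV, rfl, hVA⟩ := h x v 0 fun v w ↦ by simp
  have key := hV.leviCivita_curvature hU hx hX hY hZ
  have z1 (v w : TangentSpace 𝓘(ℝ, E) x) : curvature x 0 v w = 0 := by
    simpa using curvature_smul_left 0 v w 0
  have z2 (v w : TangentSpace 𝓘(ℝ, E) x) : curvature x v 0 w = 0 := by
    simpa using curvature_smul_middle v 0 w 0
  have z3 (v w : TangentSpace 𝓘(ℝ, E) x) : curvature x v w 0 = 0 := by
    simpa using curvature_smul_right v w 0 0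
  rw [hVA] at key
  simp only [zero_apply, z1, z2, z3, sub_zero] at key
  exact key

end

end LieDerivative

/-! ### Constant curvature -/

section ConstantCurvature

noncomputable section

set_option maxSynthPendingDepth 3
set_option linter.unusedSectionVars false

variable {E : Type*} [NormedAddCommGroup E] [NormedSpace ℝ E]
  {M : Type*} [TopologicalSpace M] [ChartedSpace E M] [IsManifold 𝓘(ℝ, E) ∞ M]
  {X Y Z V W X' Y' Z' : VField E M} {U U' : Set M} {m x y : M} {f g : M → ℝ}
  [FiniteDimensional ℝ E]
  [RiemannianBundle (fun x : M ↦ TangentSpace 𝓘(ℝ, E) x)]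
  [IsContMDiffRiemannianBundle 𝓘(ℝ, E) ∞ E (fun x : M ↦ TangentSpace 𝓘(ℝ, E) x)]

instance finiteDimensional_tangentSpace (x : M) :
    FiniteDimensional ℝ (TangentSpace 𝓘(ℝ, E) x) :=
  inferInstanceAs (FiniteDimensional ℝ E)

variable (E) in
/-- The curvature tensor at `x` as a trilinear map. -/
def curvatureHom (x : M) : TangentSpace 𝓘(ℝ, E) x →ₗ[ℝ] TangentSpace 𝓘(ℝ, E) x →ₗ[ℝ]
    TangentSpace 𝓘(ℝ, E) x →ₗ[ℝ] TangentSpace 𝓘(ℝ, E) x :=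
  LinearMap.mk₂ ℝ (fun u v ↦
      { toFun := fun w ↦ curvature x u v w
        map_add' := fun w w' ↦ curvature_add_right u v w w'
        map_smul' := fun c w ↦ curvature_smul_right u v w c })
    (fun u u' v ↦ LinearMap.ext fun w ↦ curvature_add_left u u' v w)
    (fun c u v ↦ LinearMap.ext fun w ↦ curvature_smul_left u v w c)
    (fun u v v' ↦ LinearMap.ext fun w ↦ curvature_add_middle u v v' w)
    (fun c u v ↦ LinearMap.ext fun w ↦ curvature_smul_middle u v w c)

/-- The curvature at `x` is that of constant sectional curvature `k`. -/
def HasCurvature (x : M) (k : ℝ) : Prop :=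
  ∀ u v w : TangentSpace 𝓘(ℝ, E) x,
    curvature x u v w = k • (inner ℝ v w • u - inner ℝ u w • v)

theorem CurvatureInvariant.exists_hasCurvature (h : CurvatureInvariant E M) (x : M) :
    ∃ k : ℝ, HasCurvature (E := E) x k :=
  exists_eq_smul_of_invariant (R := curvatureHom E x) (fun u v w ↦ curvature_swap u v w)
    (fun u v w z ↦ inner_curvature_skew u v w z) (fun u v w ↦ curvature_bianchi u v w)
    (fun A hA u v w ↦ h x A hA u v w)

/-- In these dimensions `k` is not determined by the curvature, so one value must be fixed for all
points. -/
theorem hasCurvature_zero (hn : Module.finrank ℝ E < 2) (x : M) :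
    HasCurvature (E := E) x 0 := by
  intro u v w
  obtain ⟨e, he⟩ := finrank_le_one_iff (K := ℝ) (V := TangentSpace 𝓘(ℝ, E) x).1
    (Nat.le_of_lt_succ hn)
  obtain ⟨c, rfl⟩ := he u
  obtain ⟨d, rfl⟩ := he v
  have h0 : curvature x e e w = 0 := by
    have : (2 : ℝ) • curvature x e e w = 0 := by
      rw [two_smul]; nth_rewrite 1 [curvature_swap]; rw [neg_add_cancel]
    exact (smul_eq_zero.1 this).resolve_left two_ne_zero
  rw [curvature_smul_left, curvature_smul_middle, h0]
  simp

/-- The squared area of the parallelogram spanned by `X` and `Y`. -/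
def squaredArea (X Y : VField E M) (y : M) : ℝ :=
  inner ℝ (X y) (X y) * inner ℝ (Y y) (Y y) - inner ℝ (X y) (Y y) * inner ℝ (X y) (Y y)

/-- Since `R` is parallel only the fields get differentiated, and the constant-curvature form is
needed just at `y`: the result is the derivative of `k` times the squared area with `k` frozen. -/
theorem mvfderiv_sectional (hpar : CurvatureParallel E M) (hU : IsOpen U) (hX : SmoothOn X U)
    (hY : SmoothOn Y U) (hy : y ∈ U) {k : ℝ} (hk : HasCurvature (E := E) y k)
    (v : TangentSpace 𝓘(ℝ, E) y) :
    d% (fun y ↦ inner ℝ (curvature y (X y) (Y y) (Y y)) (X y)) y v =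
      k * d% (squaredArea X Y) y v := by
  have hXy := hX.mdiffAt hU hy
  have hYy := hY.mdiffAt hU hy
  have hp := hpar y X Y Y (hX.smoothNear hU hy) (hY.smoothNear hU hy) (hY.smoothNear hU hy) v
  rw [sub_sub, sub_sub, sub_eq_zero] at hp
  have h1 : d% (squaredArea X Y) y v =
      inner ℝ (X y) (X y) * (inner ℝ (leviCivita E M Y y v) (Y y) +
        inner ℝ (Y y) (leviCivita E M Y y v)) +
      inner ℝ (Y y) (Y y) * (inner ℝ (leviCivita E M X y v) (X y) +
        inner ℝ (X y) (leviCivita E M X y v)) -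
      2 * inner ℝ (X y) (Y y) * (inner ℝ (leviCivita E M X y v) (Y y) +
        inner ℝ (X y) (leviCivita E M Y y v)) := by
    unfold squaredArea
    have h2 : MDiffAt (fun y ↦ inner ℝ (X y) (X y) * inner ℝ (Y y) (Y y)) y :=
      (mdiff_inner hXy hXy).mul (mdiff_inner hYy hYy)
    have h3 : MDiffAt (fun y ↦ inner ℝ (X y) (Y y) * inner ℝ (X y) (Y y)) y :=
      (mdiff_inner hXy hYy).mul (mdiff_inner hXy hYy)
    rw [mvfderiv_fun_sub h2 h3,
      mvfderiv_fun_mul (mdiff_inner hXy hXy) (mdiff_inner hYy hYy),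
      mvfderiv_fun_mul (mdiff_inner hXy hYy) (mdiff_inner hXy hYy)]
    simp only [sub_apply, add_apply, smul_apply]
    rw [leviCivita_metric_apply hXy hXy, leviCivita_metric_apply hXy hYy,
      leviCivita_metric_apply hYy hYy]
    simp only [smul_eq_mul]
    ring
  rw [h1, leviCivita_metric_apply ((hX.curvature hU hY hY).mdiffAt hU hy) hXy, hp, hk, hk, hk, hk]
  simp only [inner_add_left, inner_sub_left, inner_smul_left, conj_trivial]
  have c (a b : TangentSpace 𝓘(ℝ, E) y) : inner ℝ a b = inner ℝ b a := real_inner_comm _ _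
  rw [c (leviCivita E M X y v) (X y), c (leviCivita E M X y v) (Y y),
    c (leviCivita E M Y y v) (X y), c (leviCivita E M Y y v) (Y y), c (Y y) (X y)]
  ring

theorem squaredArea_ne_zero (hy : y ∈ (chartAt E m).source) {a b : E}
    (hab : LinearIndependent ℝ ![a, b]) :
    squaredArea (chartField m fun _ ↦ a) (chartField m fun _ ↦ b) y ≠ 0 := by
  intro h
  set X := chartField m (fun _ ↦ a) y with hX
  set Y := chartField m (fun _ ↦ b) y with hY
  -- The equality case of Cauchy–Schwarz: zero area would make the fields dependent.
  have h0 : inner ℝ (inner ℝ X X • Y - inner ℝ X Y • X) (inner ℝ X X • Y - inner ℝ X Y • X) =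
      inner ℝ X X * squaredArea (chartField m fun _ ↦ a) (chartField m fun _ ↦ b) y := by
    rw [squaredArea, ← hX, ← hY]
    simp only [inner_sub_left, inner_sub_right, inner_smul_left, inner_smul_right, conj_trivial,
      real_inner_comm X Y]
    ring
  rw [h, mul_zero, inner_self_eq_zero] at h0
  have h1 := congrArg (toCoord m y) h0
  have hXa : toCoord m y X = a := toCoord_fromCoord hy a
  have hYb : toCoord m y Y = b := toCoord_fromCoord hy b
  rw [map_sub, map_smul, map_smul, map_zero, hXa, hYb] at h1
  have h2 := (LinearIndependent.pair_iff.1 hab) (-inner ℝ X Y) (inner ℝ X X) (by rw [← h1]; module)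
  have h3 : X = 0 := inner_self_eq_zero.1 h2.2
  have h4 : a = 0 := by
    rw [← hXa, h3, map_zero]
  exact hab.ne_zero 0 (by simpa using h4)

/-- A Riemannian metric with invariant and parallel curvature has locally constant sectional
curvature. -/
theorem exists_hasCurvature_ball (hinv : CurvatureInvariant E M) (hpar : CurvatureParallel E M)
    {c : E} {r : ℝ} (hr : Metric.ball c r ⊆ (extChartAt 𝓘(ℝ, E) m).target) :
    ∃ k : ℝ, ∀ z ∈ Metric.ball c r, HasCurvature (E := E) ((extChartAt 𝓘(ℝ, E) m).symm z) k := by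
  rcases Nat.lt_or_ge (Module.finrank ℝ E) 2 with hn | hn
  · exact ⟨0, fun z _ ↦ hasCurvature_zero hn _⟩
  rcases le_or_gt r 0 with hr0 | hr0
  · exact ⟨0, fun z hz ↦ by simp [Metric.ball_eq_empty.2 hr0] at hz⟩
  choose k hk using hinv.exists_hasCurvature (E := E)
  set a := Module.finBasis ℝ E ⟨0, by omega⟩ with ha
  set b := Module.finBasis ℝ E ⟨1, by omega⟩ with hb
  have hab : LinearIndependent ℝ ![a, b] := by
    have := (Module.finBasis ℝ E).linearIndependent.comp
      ![(⟨0, by omega⟩ : Fin (Module.finrank ℝ E)), ⟨1, by omega⟩]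
      (by
        intro i j hij
        fin_cases i <;> fin_cases j <;> simp_all)
    convert this using 1
    ext i
    fin_cases i <;> rfl
  set X : VField E M := chartField m fun _ ↦ a with hX
  set Y : VField E M := chartField m fun _ ↦ b with hY
  have hs := (chartAt E m).open_source
  have hXs : SmoothOn X (chartAt E m).source := smoothOn_chartField_const m a
  have hYs : SmoothOn Y (chartAt E m).source := smoothOn_chartField_const m b
  set P : M → ℝ := fun y ↦ inner ℝ (curvature y (X y) (Y y) (Y y)) (X y) with hP
  have hPk (y : M) : P y = k y * squaredArea X Y y := by
    rw [hP]
    simp only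
    rw [hk, squaredArea, inner_smul_left, inner_sub_left, inner_smul_left, inner_smul_left]
    simp only [conj_trivial, real_inner_comm (X y) (Y y)]
    ring
  have hPs : CMDiff[(chartAt E m).source] ∞ P := (hXs.curvature hs hYs hYs).inner hXs
  have hqs : CMDiff[(chartAt E m).source] ∞ (squaredArea X Y) :=
    ((hXs.inner hXs).mul (hYs.inner hYs)).sub ((hXs.inner hYs).mul (hXs.inner hYs))
  have hq {y} (hy : y ∈ (chartAt E m).source) : squaredArea X Y y ≠ 0 :=
    squaredArea_ne_zero hy hab
  -- Though chosen point by point, `k` is a quotient of smooth functions with nonvanishing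
  -- denominator.
  have hks : CMDiff[(chartAt E m).source] ∞ k := by
    refine (hPs.div₀ hqs fun y hy ↦ hq hy).congr fun y hy ↦ ?_
    rw [Pi.div_apply, hPk, mul_div_cancel_right₀ _ (hq hy)]
  -- The Leibniz rule for `P = k * squaredArea X Y`, compared with `mvfderiv_sectional`, leaves the
  -- squared area times `dk` equal to zero.
  have hdk {y} (hy : y ∈ (chartAt E m).source) (v : TangentSpace 𝓘(ℝ, E) y) : d% k y v = 0 := by
    have h1 := mvfderiv_sectional hpar hs hXs hYs hy (hk y) v
    rw [← hP, funext hPk, mvfderiv_fun_mul (mdiffAt_of_contMDiffOn hks hs hy)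
      (mdiffAt_of_contMDiffOn hqs hs hy)] at h1
    simp only [add_apply, smul_apply, smul_eq_mul, add_eq_left] at h1
    exact (mul_eq_zero.1 h1).resolve_left (hq hy)
  have hkd : DifferentiableOn ℝ (fun z ↦ k ((extChartAt 𝓘(ℝ, E) m).symm z)) (Metric.ball c r) :=
    ((contDiffOn_comp_extChartAt_symm hks).differentiableOn (by simp)).mono
      fun z hz ↦ ⟨hr hz, symm_mem_source (hr hz)⟩
  refine ⟨k ((extChartAt 𝓘(ℝ, E) m).symm c), fun z hz ↦ ?_⟩
  have hconst := Metric.isOpen_ball.is_const_of_fderiv_eq_zero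
    (convex_ball c r).isPreconnected hkd (fun z hz ↦ by
      ext v
      have hy := symm_mem_source (hr hz)
      have h2 := mvfderiv_eq_fderiv hs hks hy hy (fromCoord m _ v)
      rw [hdk hy, toCoord_fromCoord hy, (extChartAt 𝓘(ℝ, E) m).right_inv (hr hz)] at h2
      exact h2.symm) hz (Metric.mem_ball_self hr0)
  rw [← hconst]
  exact hk _

theorem curvature_fromCoord (hy : y ∈ (chartAt E m).source) (u v w : E) :
    curvature y (fromCoord m y u) (fromCoord m y v) (fromCoord m y w) = fromCoord m y
      (fderiv ℝ (christoffel (E := E) m) (extChartAt 𝓘(ℝ, E) m y) u w v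
        - fderiv ℝ (christoffel (E := E) m) (extChartAt 𝓘(ℝ, E) m y) v w u
        + christoffel m (extChartAt 𝓘(ℝ, E) m y) (christoffel m (extChartAt 𝓘(ℝ, E) m y) w v) u
        - christoffel m (extChartAt 𝓘(ℝ, E) m y)
            (christoffel m (extChartAt 𝓘(ℝ, E) m y) w u) v) := by
  have := FiniteDimensional.complete ℝ E
  have near (v : E) : SmoothNear (chartField m fun _ ↦ v : VField E M) y :=
    (smoothOn_chartField_const m v).smoothNear (chartAt E m).open_source hy
  have hd : DifferentiableAt ℝ (christoffel (E := E) m) (extChartAt 𝓘(ℝ, E) m y) :=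
    ((contDiffOn_christoffel m).contDiffAt ((isOpen_extChartAt_target m).mem_nhds
      (extChartAt_mem_target hy))).differentiableAt (by simp)
  have hd1 (v w : E) : HasFDerivAt (fun z ↦ christoffel (E := E) m z w v) _ _ :=
    (hd.hasFDerivAt.clm_apply (hasFDerivAt_const w _)).clm_apply (hasFDerivAt_const v _)
  have e (v w : E) : (fun y ↦ leviCivita E M (chartField m fun _ ↦ w) y
      (chartField m (fun _ ↦ v) y)) =ᶠ[𝓝 y] chartField m fun z ↦ christoffel m z w v := by
    filter_upwards [(chartAt E m).open_source.mem_nhds hy] with x hx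
    rw [leviCivita_chartField hx (differentiableAt_const _), chartField, chartField,
      toCoord_fromCoord hx]
    simp
    rfl
  have h (u v w : E) : leviCivita E M (fun y ↦ leviCivita E M (chartField m fun _ ↦ w) y
      (chartField m (fun _ ↦ v) y)) y (chartField m (fun _ ↦ u) y) = fromCoord m y
      (fderiv ℝ (christoffel (E := E) m) (extChartAt 𝓘(ℝ, E) m y) u w v + christoffel m
        (extChartAt 𝓘(ℝ, E) m y) (christoffel m (extChartAt 𝓘(ℝ, E) m y) w v) u) := by
    rw [leviCivita_congr (e v w), leviCivita_chartField hy (hd1 v w).differentiableAt,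
      (hd1 v w).fderiv, chartField, toCoord_fromCoord hy]
    simp
  have key := curvature_apply (near u) (near v) (near w)
  rw [curvatureOp, mlieBracket_chartField hy (differentiableAt_const _) (differentiableAt_const _),
    h, h] at key
  refine key.trans ?_
  simp only [fderiv_fun_const, Pi.zero_apply, zero_apply, sub_self, map_zero, sub_zero]
  rw [← map_sub]
  congr 1
  abel

end

end ConstantCurvature

/-! ### Killing fields in constant curvature -/

section KillingSystem

noncomputable section

set_option maxSynthPendingDepth 3
set_option linter.unusedSectionVars false

variable {E : Type*} [NormedAddCommGroup E] [NormedSpace ℝ E]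
  {M : Type*} [TopologicalSpace M] [ChartedSpace E M] [IsManifold 𝓘(ℝ, E) ∞ M]
  {X Y Z V W X' Y' Z' : VField E M} {U U' : Set M} {m x y : M} {f g : M → ℝ}
  [FiniteDimensional ℝ E]
  [RiemannianBundle (fun x : M ↦ TangentSpace 𝓘(ℝ, E) x)]
  [IsContMDiffRiemannianBundle 𝓘(ℝ, E) ∞ E (fun x : M ↦ TangentSpace 𝓘(ℝ, E) x)]

/-- The linear system `∇_v W = -k f v`, `df v = ⟪W, v⟫` for a vector field `W` and a function `f`,
in the preferred chart at `m`. -/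
def killingSystem (m : M) (k : ℝ) (z : E) : E →L[ℝ] (E × ℝ) →L[ℝ] (E × ℝ) :=
  ContinuousLinearMap.flip
    (ContinuousLinearMap.compL ℝ E E (E × ℝ) (ContinuousLinearMap.inl ℝ E ℝ) ∘L
        (-(christoffel m z)) ∘L ContinuousLinearMap.fst ℝ E ℝ
      - k • (ContinuousLinearMap.snd ℝ E ℝ).smulRight (ContinuousLinearMap.inl ℝ E ℝ)
      + ContinuousLinearMap.compL ℝ E ℝ (E × ℝ) (ContinuousLinearMap.inr ℝ E ℝ) ∘L
        chartMetric m z ∘L ContinuousLinearMap.fst ℝ E ℝ)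

theorem killingSystem_apply (m : M) (k : ℝ) (z v : E) (s : E × ℝ) :
    killingSystem m k z v s =
      (-christoffel m z s.1 v - (k * s.2) • v, chartMetric m z s.1 v) := by
  ext
  · simp [killingSystem, mul_smul]
  · simp [killingSystem]

theorem contDiffOn_killingSystem (m : M) (k : ℝ) :
    ContDiffOn ℝ ∞ (killingSystem (E := E) m k) (extChartAt 𝓘(ℝ, E) m).target := by
  refine contDiffOn_clm_apply.2 fun v ↦ contDiffOn_clm_apply.2 fun s ↦ ?_
  simp only [killingSystem_apply]
  exact ((((contDiffOn_christoffel m).clm_apply contDiffOn_const).clm_apply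
    contDiffOn_const).neg.sub contDiffOn_const).prodMk
    (((contDiffOn_chartMetric m).clm_apply contDiffOn_const).clm_apply contDiffOn_const)

theorem fderiv_killingSystem {k : ℝ} {z : E} (hz : z ∈ (extChartAt 𝓘(ℝ, E) m).target)
    (u v : E) (s : E × ℝ) : fderiv ℝ (killingSystem (E := E) m k) z u v s =
      (-fderiv ℝ (christoffel (E := E) m) z u s.1 v,
        fderiv ℝ (chartMetric (E := E) m) z u s.1 v) := by
  have hnhds := (isOpen_extChartAt_target (I := 𝓘(ℝ, E)) m).mem_nhds hz
  have h1 : HasFDerivAt (killingSystem (E := E) m k) _ z :=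
    (((contDiffOn_killingSystem m k).contDiffAt hnhds).differentiableAt (by simp)).hasFDerivAt
  have h2 : HasFDerivAt (christoffel (E := E) m) _ z :=
    (((contDiffOn_christoffel m).contDiffAt hnhds).differentiableAt (by simp)).hasFDerivAt
  have h3 : HasFDerivAt (chartMetric (E := E) m) _ z :=
    (((contDiffOn_chartMetric m).contDiffAt hnhds).differentiableAt (by simp)).hasFDerivAt
  have h4 := (h1.clm_apply (hasFDerivAt_const v z)).clm_apply (hasFDerivAt_const s z)
  have h5 := ((((h2.clm_apply (hasFDerivAt_const s.1 z)).clm_apply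
    (hasFDerivAt_const v z)).neg).sub_const ((k * s.2) • v)).prodMk
    ((h3.clm_apply (hasFDerivAt_const s.1 z)).clm_apply (hasFDerivAt_const v z))
  have e : (fun z ↦ killingSystem (E := E) m k z v s) =
      fun z ↦ (-christoffel m z s.1 v - (k * s.2) • v, chartMetric m z s.1 v) :=
    funext fun z ↦ killingSystem_apply m k z v s
  rw [e] at h4
  have h6 := congrArg (fun L : E →L[ℝ] E × ℝ ↦ L u) (h4.unique h5)
  simpa using! h6

theorem chartMetric_symm (m : M) (z a b : E) : chartMetric m z a b = chartMetric m z b a := by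
  rw [chartMetric_apply, chartMetric_apply]
  exact real_inner_comm _ _

/-- The vector component of the integrability condition says that `R` has constant curvature `k`;
the scalar component follows from metric compatibility and the symmetry of the metric and of the
Christoffel symbols. -/
theorem killingSystem_flat {k : ℝ} {z : E} (hz : z ∈ (extChartAt 𝓘(ℝ, E) m).target)
    (hk : HasCurvature (E := E) ((extChartAt 𝓘(ℝ, E) m).symm z) k) (u v : E) (s : E × ℝ) :
    fderiv ℝ (killingSystem (E := E) m k) z u v s +
        killingSystem m k z v (killingSystem m k z u s) =
      fderiv ℝ (killingSystem (E := E) m k) z v u s +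
        killingSystem m k z u (killingSystem m k z v s) := by
  obtain ⟨w, f⟩ := s
  have hy := symm_mem_source hz
  have hR := curvature_fromCoord hy u v w
  rw [hk, ← map_smul, ← map_smul, ← map_sub, ← map_smul] at hR
  have hR := congrArg (toCoord m _) hR
  rw [toCoord_fromCoord hy, toCoord_fromCoord hy, (extChartAt 𝓘(ℝ, E) m).right_inv hz,
    ← chartMetric_apply, ← chartMetric_apply] at hR
  simp only [fderiv_killingSystem hz, killingSystem_apply, Prod.mk_add_mk, Prod.mk.injEq]
  constructor
  · simp only [map_sub, map_neg, map_smul, sub_apply, neg_apply, smul_apply]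
    rw [christoffel_symm hz v u, ← sub_eq_zero]
    rw [← sub_eq_zero] at hR
    rw [← hR]
    rw [chartMetric_symm m z v w, chartMetric_symm m z u w]
    module
  · simp only [map_sub, map_neg, map_smul, sub_apply, neg_apply, smul_apply,
      fderiv_chartMetric hz]
    rw [christoffel_symm hz u v, chartMetric_symm m z v u]
    ring

/-- A pair of solutions of the Killing system defines a Killing field. -/
theorem isKillingOn_of_solutions {k : ℝ} {c : E} {r : ℝ}
    (hr : Metric.ball c r ⊆ (extChartAt 𝓘(ℝ, E) m).target) {s₁ s₂ : E → E × ℝ}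
    (h₁ : ∀ z ∈ Metric.ball c r, HasFDerivAt s₁ ((killingSystem m k z).flip (s₁ z)) z)
    (h₂ : ∀ z ∈ Metric.ball c r, HasFDerivAt s₂ ((killingSystem m k z).flip (s₂ z)) z) :
    IsKillingOn (chartField m fun z ↦ (s₁ z).2 • (s₂ z).1 - (s₂ z).2 • (s₁ z).1)
      ((chartAt E m).source ∩ extChartAt 𝓘(ℝ, E) m ⁻¹' Metric.ball c r) ∧
    ∀ y ∈ (chartAt E m).source ∩ extChartAt 𝓘(ℝ, E) m ⁻¹' Metric.ball c r,
      leviCivita E M (chartField m fun z ↦ (s₁ z).2 • (s₂ z).1 - (s₂ z).2 • (s₁ z).1) y =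
        elementarySkew (fromCoord m y (s₂ (extChartAt 𝓘(ℝ, E) m y)).1)
          (fromCoord m y (s₁ (extChartAt 𝓘(ℝ, E) m y)).1) := by
  have hA := (contDiffOn_killingSystem (E := E) m k).mono hr
  have hs₁ := contDiffOn_of_hasFDerivAt_clm Metric.isOpen_ball hA h₁
  have hs₂ := contDiffOn_of_hasFDerivAt_clm Metric.isOpen_ball hA h₂
  have hξ : ContDiffOn ℝ ∞ (fun z ↦ (s₁ z).2 • (s₂ z).1 - (s₂ z).2 • (s₁ z).1)
      (Metric.ball c r) := (hs₁.snd.smul hs₂.fst).sub (hs₂.snd.smul hs₁.fst)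
  have hV := smoothOn_chartField (m := m) Metric.isOpen_ball hξ
  have hop := isOpen_extChartAt_preimage_inter m (Metric.isOpen_ball (x := c) (ε := r))
  have key : ∀ y ∈ (chartAt E m).source ∩ extChartAt 𝓘(ℝ, E) m ⁻¹' Metric.ball c r,
      leviCivita E M (chartField m fun z ↦ (s₁ z).2 • (s₂ z).1 - (s₂ z).2 • (s₁ z).1) y =
        elementarySkew (fromCoord m y (s₂ (extChartAt 𝓘(ℝ, E) m y)).1)
          (fromCoord m y (s₁ (extChartAt 𝓘(ℝ, E) m y)).1) := by
    intro y hy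
    ext u
    have hd₁ := h₁ _ hy.2
    have hd₂ := h₂ _ hy.2
    have hξd : HasFDerivAt (fun z ↦ (s₁ z).2 • (s₂ z).1 - (s₂ z).2 • (s₁ z).1) _
        (extChartAt 𝓘(ℝ, E) m y) := (hd₁.snd.smul hd₂.fst).sub (hd₂.snd.smul hd₁.fst)
    rw [elementarySkew_apply, leviCivita_chartField hy.1 hξd.differentiableAt, hξd.fderiv]
    obtain ⟨u, rfl⟩ : ∃ u', u = fromCoord m y u' := ⟨_, (fromCoord_toCoord hy.1 u).symm⟩
    rw [toCoord_fromCoord hy.1, ← chartMetric_extChartAt hy.1, ← chartMetric_extChartAt hy.1,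
      ← map_smul, ← map_smul, ← map_sub]
    congr 1
    -- The two multiples of `u` with coefficient `k f₁ f₂` cancel, as do the Christoffel terms; the
    -- derivatives of `f₁` and `f₂` give the elementary skew map.
    simp only [add_apply, sub_apply, smul_apply, ContinuousLinearMap.comp_apply,
      ContinuousLinearMap.flip_apply, killingSystem_apply, ContinuousLinearMap.smulRight_apply,
      ContinuousLinearMap.coe_fst', ContinuousLinearMap.coe_snd', map_sub, map_smul]
    module
  refine ⟨⟨hV, fun y hy ↦ ?_⟩, key⟩
  rw [lieMetricVanishesAt_iff (hV.mdiffAt hop hy), key y hy]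
  exact isSkew_elementarySkew _ _

theorem LieMetricVanishesAt.congr (hV : SmoothNear V x) (hW : SmoothNear W x) (h : W =ᶠ[𝓝 x] V)
    (hVx : LieMetricVanishesAt V x) : LieMetricVanishesAt W x := by
  rw [lieMetricVanishesAt_iff hV.mdiffAt] at hVx
  rwa [lieMetricVanishesAt_iff hW.mdiffAt, leviCivita_congr h]

theorem IsKillingOn.congr (hU : IsOpen U) (hV : IsKillingOn V U) (h : ∀ y ∈ U, W y = V y) :
    IsKillingOn W U := by
  have hW := hV.1.congr h
  exact ⟨hW, fun x hx ↦ (hV.2 x hx).congr (hV.1.smoothNear hU hx) (hW.smoothNear hU hx)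
    (Filter.eventuallyEq_of_mem (hU.mem_nhds hx) h)⟩

theorem IsKillingOn.isSkew (hU : IsOpen U) (hV : IsKillingOn V U) (hx : x ∈ U) :
    IsSkew (leviCivita E M V x) :=
  (lieMetricVanishesAt_iff (hV.1.mdiffAt hU hx)).1 (hV.2 x hx)

/-! ### Realizing pairs of a value and a skew covariant derivative by Killing fields -/

theorem IsKillingOn.exists_killingFields {U : TopologicalSpace.Opens M}
    (hV : IsKillingOn V (U : Set M)) :
    ∃ W ∈ killingFields (E := E) U, ∀ x ∈ U, W x = V x ∧ leviCivita E M W x = leviCivita E M V x := by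
  classical
  let W : VField E M := fun x ↦ if x ∈ U then V x else 0
  have hW {x} (hx : x ∈ U) : W x = V x := if_pos hx
  refine ⟨W, ⟨hV.congr U.isOpen fun y hy ↦ hW hy, fun x hx ↦ if_neg hx⟩, fun x hx ↦ ⟨hW hx, ?_⟩⟩
  exact leviCivita_congr (Filter.eventuallyEq_of_mem (U.isOpen.mem_nhds hx) fun y hy ↦ hW hy)

/-- The value and the covariant derivative at `x` of the Killing fields on `U`. -/
def killingJet (U : TopologicalSpace.Opens M) (hx : x ∈ U) :
    killingFields (E := E) U →ₗ[ℝ] TangentSpace 𝓘(ℝ, E) x ×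
      (TangentSpace 𝓘(ℝ, E) x →L[ℝ] TangentSpace 𝓘(ℝ, E) x) where
  toFun V := ((V : VField E M) x, leviCivita E M (V : VField E M) x)
  map_add' V W := by
    rw [Submodule.coe_add, leviCivita_add (V.2.1.1.mdiffAt U.isOpen hx)
      (W.2.1.1.mdiffAt U.isOpen hx)]
    rfl
  map_smul' c V := by
    rw [Submodule.coe_smul, leviCivita_const_smul c (V.2.1.1.mdiffAt U.isOpen hx)]
    rfl

theorem killingJet_apply {U : TopologicalSpace.Opens M} (hx : x ∈ U)
    (V : killingFields (E := E) U) :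
    killingJet U hx V = ((V : VField E M) x, leviCivita E M (V : VField E M) x) := rfl

/-- Both halves of the elementary skew maps sum to `Ψ`, the second one by skewness; hence the factor
2. Elementary skew maps therefore span all skew maps. -/
theorem sum_elementarySkew {T : Type*} [NormedAddCommGroup T] [InnerProductSpace ℝ T]
    [FiniteDimensional ℝ T] {Ψ : T →L[ℝ] T} (h : IsSkew Ψ) :
    ∑ i, elementarySkew (Ψ (stdOrthonormalBasis ℝ T i)) (stdOrthonormalBasis ℝ T i) =
      (2 : ℝ) • Ψ := by
  ext x
  have h1 : ∑ i, inner ℝ (stdOrthonormalBasis ℝ T i) x • Ψ (stdOrthonormalBasis ℝ T i) = Ψ x := by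
    conv_rhs => rw [← (stdOrthonormalBasis ℝ T).sum_repr' x]
    simp
  have h2 : ∑ i, inner ℝ (Ψ (stdOrthonormalBasis ℝ T i)) x • stdOrthonormalBasis ℝ T i =
      -Ψ x := by
    rw [← (stdOrthonormalBasis ℝ T).sum_repr' (Ψ x), ← Finset.sum_neg_distrib]
    refine Finset.sum_congr rfl fun i _ ↦ ?_
    rw [eq_neg_of_add_eq_zero_left (h (stdOrthonormalBasis ℝ T i) x), neg_smul]
  simp only [sum_apply, elementarySkew_apply, Finset.sum_sub_distrib, h1, h2, two_smul,
    sub_neg_eq_add, add_apply]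

/-- If the curvature is invariant and parallel, every point has a connected neighborhood on which
there are Killing fields with arbitrary one-jets of infinitesimal isometries. -/
theorem exists_killingFields_of_curvature (hinv : CurvatureInvariant E M)
    (hpar : CurvatureParallel E M) (m : M) :
    ∃ U : TopologicalSpace.Opens M, m ∈ U ∧ IsConnected (U : Set M) ∧ ∀ x ∈ U,
      ∀ (v : TangentSpace 𝓘(ℝ, E) x) (Ψ : TangentSpace 𝓘(ℝ, E) x →L[ℝ] TangentSpace 𝓘(ℝ, E) x),
      IsSkew Ψ → ∃ V ∈ killingFields (E := E) U, V x = v ∧ leviCivita E M V x = Ψ := by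
  have hms := mem_chart_source E m
  have hmt := extChartAt_mem_target (E := E) hms
  obtain ⟨r₀, hr₀, hr₀t⟩ := Metric.isOpen_iff.1 (isOpen_extChartAt_target (I := 𝓘(ℝ, E)) m) _ hmt
  obtain ⟨k, hk⟩ := exists_hasCurvature_ball hinv hpar hr₀t
  have := FiniteDimensional.complete ℝ E
  obtain ⟨r, hr, hrr, hsol⟩ := exists_flat_solution Metric.isOpen_ball
    ((contDiffOn_killingSystem m k).mono hr₀t)
    (fun z hz u v s ↦ killingSystem_flat (hr₀t hz) (hk z hz) u v s) (Metric.mem_ball_self hr₀)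
  have hrt := hrr.trans hr₀t
  set c := extChartAt 𝓘(ℝ, E) m m with hc
  let U : TopologicalSpace.Opens M :=
    ⟨(chartAt E m).source ∩ extChartAt 𝓘(ℝ, E) m ⁻¹' Metric.ball c r,
      isOpen_extChartAt_preimage_inter m Metric.isOpen_ball⟩
  have hmU : m ∈ U := ⟨hms, Metric.mem_ball_self hr⟩
  refine ⟨U, hmU, ⟨⟨m, hmU⟩, ?_⟩, fun x hx v Ψ hΨ ↦ ?_⟩
  · have e : (U : Set M) = (extChartAt 𝓘(ℝ, E) m).symm '' Metric.ball c r := by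
      ext y
      constructor
      · exact fun hy ↦ ⟨_, hy.2, (extChartAt 𝓘(ℝ, E) m).left_inv (by simpa using hy.1)⟩
      · rintro ⟨z, hz, rfl⟩
        refine ⟨symm_mem_source (hrt hz), ?_⟩
        rwa [mem_preimage, (extChartAt 𝓘(ℝ, E) m).right_inv (hrt hz)]
    rw [e]
    exact (convex_ball c r).isPreconnected.image _ ((continuousOn_extChartAt_symm m).mono hrt)
  -- Take the solutions of the flat system with values `(a, α)` and `(b, β)` at `x`.
  have pair (a b : TangentSpace 𝓘(ℝ, E) x) (α β : ℝ) :
      (α • b - β • a, elementarySkew b a) ∈ LinearMap.range (killingJet (E := E) U hx) := by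
    obtain ⟨s₁, hs₁, h₁⟩ := hsol _ hx.2 (toCoord m x a, α)
    obtain ⟨s₂, hs₂, h₂⟩ := hsol _ hx.2 (toCoord m x b, β)
    obtain ⟨hV, hVL⟩ := isKillingOn_of_solutions hrt h₁ h₂
    obtain ⟨W, hW, hWV⟩ := IsKillingOn.exists_killingFields (U := U) hV
    refine ⟨⟨W, hW⟩, ?_⟩
    rw [killingJet_apply]
    refine Prod.ext ?_ ?_
    · refine (hWV x hx).1.trans ?_
      rw [chartField, hs₁, hs₂, map_sub, map_smul, map_smul, fromCoord_toCoord hx.1,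
        fromCoord_toCoord hx.1]
    · refine (hWV x hx).2.trans ((hVL x hx).trans ?_)
      rw [hs₁, hs₂, fromCoord_toCoord hx.1, fromCoord_toCoord hx.1]
  have hmem : (v, Ψ) ∈ LinearMap.range (killingJet (E := E) U hx) := by
    -- This pair gives `(v, 0)`. Pairs with zero scalar parts give `(0, Ψ)` after summing over an
    -- orthonormal basis and halving.
    have h1 := pair 0 v 1 0
    have h2 := Submodule.smul_mem _ (1 / 2 : ℝ) (Submodule.sum_mem _
      fun (i : Fin (Module.finrank ℝ (TangentSpace 𝓘(ℝ, E) x))) (_ : i ∈ Finset.univ) ↦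
        pair (stdOrthonormalBasis ℝ (TangentSpace 𝓘(ℝ, E) x) i)
          (Ψ (stdOrthonormalBasis ℝ (TangentSpace 𝓘(ℝ, E) x) i)) 0 0)
    convert Submodule.add_mem _ h1 h2 using 1
    refine Prod.ext ?_ ?_
    · simp [Prod.fst_sum]
    · have h0 : elementarySkew v 0 = 0 := by ext; simp [elementarySkew_apply]
      simp only [Prod.snd_add, Prod.smul_snd, Prod.snd_sum, h0, zero_add]
      rw [sum_elementarySkew hΨ, smul_smul]
      simp
  obtain ⟨V, hV⟩ := hmem
  exact ⟨V, V.2, congrArg Prod.fst hV, congrArg Prod.snd hV⟩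

end

end KillingSystem

/-! ### Killing fields are determined by their one-jet at a point -/

section Uniqueness

noncomputable section

set_option maxSynthPendingDepth 3
set_option linter.unusedSectionVars false

/-- Grönwall uniqueness along the segment from `p` to `z`. -/
theorem eq_zero_of_norm_fderiv_le {E G : Type*} [NormedAddCommGroup E] [NormedSpace ℝ E]
    [NormedAddCommGroup G] [NormedSpace ℝ G] {f : E → G} {f' : E → E →L[ℝ] G} {s : Set E} {K : ℝ}
    (hs : Convex ℝ s) (hf : ∀ z ∈ s, HasFDerivAt f (f' z) z) (hK : ∀ z ∈ s, ‖f' z‖ ≤ K * ‖f z‖)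
    {p : E} (hp : p ∈ s) (h0 : f p = 0) {z : E} (hz : z ∈ s) : f z = 0 := by
  have hmem (t : ℝ) (ht : t ∈ Icc (0 : ℝ) 1) : p + t • (z - p) ∈ s :=
    hs.add_smul_sub_mem hp hz ht
  have hd (t : ℝ) (ht : t ∈ Icc (0 : ℝ) 1) :
      HasDerivAt (fun t : ℝ ↦ f (p + t • (z - p))) (f' (p + t • (z - p)) (z - p)) t := by
    refine (hf _ (hmem t ht)).comp_hasDerivAt t ?_
    simpa using ((hasDerivAt_id t).smul_const (z - p)).const_add p
  have := eq_zero_of_abs_deriv_le_mul_abs_self_of_eq_zero_right (K := K * ‖z - p‖)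
    (fun t ht ↦ (hd t ht).continuousAt.continuousWithinAt)
    (fun t ht ↦ (hd t (Ico_subset_Icc_self ht)).hasDerivWithinAt) (by simpa using h0)
    (fun t ht ↦ by
      refine ((f' _).le_opNorm _).trans ?_
      rw [mul_right_comm]
      exact mul_le_mul_of_nonneg_right (hK _ (hmem t (Ico_subset_Icc_self ht))) (norm_nonneg _))
    1 (right_mem_Icc.2 zero_le_one)
  simpa using this

variable {E : Type*} [NormedAddCommGroup E] [NormedSpace ℝ E]
  {M : Type*} [TopologicalSpace M] [ChartedSpace E M] [IsManifold 𝓘(ℝ, E) ∞ M]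
  {X Y Z V W X' Y' Z' : VField E M} {U U' : Set M} {m x y : M} {f g : M → ℝ}
  [FiniteDimensional ℝ E]
  [RiemannianBundle (fun x : M ↦ TangentSpace 𝓘(ℝ, E) x)]
  [IsContMDiffRiemannianBundle 𝓘(ℝ, E) ∞ E (fun x : M ↦ TangentSpace 𝓘(ℝ, E) x)]

/-- The second derivatives of the components of a Killing field are determined by the components
and their first derivatives. -/
theorem IsKillingOn.fderiv_fderiv_chartRep (hU : IsOpen U) (hV : IsKillingOn V U) (hyU : y ∈ U)
    (hy : y ∈ (chartAt E m).source) (a b : E) :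
    fderiv ℝ (fderiv ℝ (chartRep m V)) (extChartAt 𝓘(ℝ, E) m y) a b =
      fderiv ℝ (chartRep m V) (extChartAt 𝓘(ℝ, E) m y)
          (christoffel m (extChartAt 𝓘(ℝ, E) m y) b a) -
        fderiv ℝ (christoffel (E := E) m) (extChartAt 𝓘(ℝ, E) m y)
          (chartRep m V (extChartAt 𝓘(ℝ, E) m y)) b a -
        christoffel m (extChartAt 𝓘(ℝ, E) m y) b
          (fderiv ℝ (chartRep m V) (extChartAt 𝓘(ℝ, E) m y) a) -
        christoffel m (extChartAt 𝓘(ℝ, E) m y)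
          (fderiv ℝ (chartRep m V) (extChartAt 𝓘(ℝ, E) m y) b) a := by
  have := FiniteDimensional.complete ℝ E
  have hs := (chartAt E m).open_source
  have hop := hU.inter hs
  have hF (v : E) : SmoothOn (chartField m fun _ ↦ v : VField E M) (U ∩ (chartAt E m).source) :=
    (smoothOn_chartField_const m v).mono inter_subset_right
  have h := (hV.mono inter_subset_left).mlieBracket_leviCivita hop (hF a) (hF b) ⟨hyU, hy⟩
  set ξ := chartRep m V with hξ
  have hξs {x} (hxU : x ∈ U) (hx : x ∈ (chartAt E m).source) :
      ContDiffAt ℝ ∞ ξ (extChartAt 𝓘(ℝ, E) m x) := hV.1.contDiffAt_chartRep hU hxU hx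
  have hξd := (hξs hyU hy).differentiableAt (by simp)
  have hξd' : DifferentiableAt ℝ (fderiv ℝ ξ) (extChartAt 𝓘(ℝ, E) m y) :=
    ((hξs hyU hy).fderiv_right (m := ∞) (by simp)).differentiableAt (by simp)
  have hΓ : DifferentiableAt ℝ (christoffel (E := E) m) (extChartAt 𝓘(ℝ, E) m y) :=
    ((contDiffOn_christoffel m).contDiffAt ((isOpen_extChartAt_target m).mem_nhds
      (extChartAt_mem_target hy))).differentiableAt (by simp)
  have hΓd : HasFDerivAt (fun z ↦ christoffel (E := E) m z b a) _ (extChartAt 𝓘(ℝ, E) m y) :=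
    (hΓ.hasFDerivAt.clm_apply (hasFDerivAt_const b _)).clm_apply (hasFDerivAt_const a _)
  have hDd : HasFDerivAt (fun z ↦ -fderiv ℝ ξ z b) _ (extChartAt 𝓘(ℝ, E) m y) :=
    (hξd'.hasFDerivAt.clm_apply (hasFDerivAt_const b _)).neg
  have e1 : (fun y ↦ leviCivita E M (chartField m fun _ ↦ b) y
      (chartField m (fun _ ↦ a) y)) =ᶠ[𝓝 y] chartField m fun z ↦ christoffel m z b a := by
    filter_upwards [hs.mem_nhds hy] with x hx
    rw [leviCivita_chartField hx (differentiableAt_const _), chartField, chartField,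
      toCoord_fromCoord hx]
    simp
    rfl
  have e2 {x} (hxU : x ∈ U) (hx : x ∈ (chartAt E m).source) (v : E) :
      mlieBracket 𝓘(ℝ, E) V (chartField m fun _ ↦ v) x =
        chartField m (fun z ↦ -fderiv ℝ ξ z v) x := by
    -- The second-order equation is the affine property of `V`, tested on two coordinate fields.
    rw [mlieBracket_congr (chartField_chartRep_eventuallyEq hx V)
      (Filter.EventuallyEq.refl _ (chartField m fun _ ↦ v)),
      mlieBracket_chartField hx ((hξs hxU hx).differentiableAt (by simp))
        (differentiableAt_const _)]
    simp only [fderiv_fun_const, Pi.zero_apply, zero_apply, zero_sub]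
    rfl
  have e3 : mlieBracket 𝓘(ℝ, E) V (chartField m fun _ ↦ b) =ᶠ[𝓝 y]
      chartField m fun z ↦ -fderiv ℝ ξ z b := by
    filter_upwards [hop.mem_nhds ⟨hyU, hy⟩] with x hx
    exact e2 hx.1 hx.2 b
  rw [mlieBracket_congr (chartField_chartRep_eventuallyEq hy V) e1,
    mlieBracket_chartField hy hξd hΓd.differentiableAt, hΓd.fderiv, e2 hyU hy a,
    leviCivita_congr e3, leviCivita_chartField hy (differentiableAt_const _),
    leviCivita_chartField hy hDd.differentiableAt, hDd.fderiv, ← map_add] at h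
  have h := congrArg (toCoord m y) h
  rw [toCoord_fromCoord hy, toCoord_fromCoord hy] at h
  simp only [chartField, toCoord_fromCoord hy, fderiv_fun_const, Pi.zero_apply, zero_apply,
    zero_add, map_neg, add_apply, neg_apply, ContinuousLinearMap.comp_apply,
    ContinuousLinearMap.flip_apply, map_zero] at h
  rw [← sub_eq_zero] at h ⊢
  rw [← h]
  abel

/-- Every point has a neighborhood over which a Killing field vanishes as soon as its one-jet
vanishes at some point. -/
theorem IsKillingOn.exists_isOpen_forall_eq_zero (hU : IsOpen U) (hV : IsKillingOn V U)
    (hm : m ∈ U) : ∃ N : Set M, IsOpen N ∧ m ∈ N ∧ N ⊆ U ∧ ∀ x ∈ N, V x = 0 →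
      leviCivita E M V x = 0 → ∀ y ∈ N, V y = 0 ∧ leviCivita E M V y = 0 := by
  have hms := mem_chart_source E m
  set c := extChartAt 𝓘(ℝ, E) m m with hc
  have hct : c ∈ (extChartAt 𝓘(ℝ, E) m).target := extChartAt_mem_target hms
  set ξ := chartRep m V with hξ
  have hop := isOpen_target_inter_preimage (E := E) m hU
  have hcmem : c ∈ (extChartAt 𝓘(ℝ, E) m).target ∩ (extChartAt 𝓘(ℝ, E) m).symm ⁻¹' U := by
    refine ⟨hct, ?_⟩
    rw [mem_preimage, hc, extChartAt_to_inv (I := 𝓘(ℝ, E))]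
    exact hm
  have hΓ : ContDiffAt ℝ ∞ (christoffel (E := E) m) c :=
    (contDiffOn_christoffel m).contDiffAt ((isOpen_extChartAt_target m).mem_nhds hct)
  obtain ⟨K₁, hK₁⟩ := hΓ.continuousAt.norm.isBoundedUnder_le
  obtain ⟨K₂, hK₂⟩ := (hΓ.fderiv_right (m := ∞) (by simp)).continuousAt.norm.isBoundedUnder_le
  obtain ⟨r, hr, hball⟩ := Metric.mem_nhds_iff.1 (Filter.inter_mem (hop.mem_nhds hcmem)
    (Filter.inter_mem (Filter.eventually_map.1 hK₁) (Filter.eventually_map.1 hK₂)))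
  have hsub {x} (hx : x ∈ (chartAt E m).source ∩ extChartAt 𝓘(ℝ, E) m ⁻¹' Metric.ball c r) :
      x ∈ U := by
    have := (hball hx.2).1.2
    rwa [mem_preimage, (extChartAt 𝓘(ℝ, E) m).left_inv (by simpa using hx.1)] at this
  refine ⟨(chartAt E m).source ∩ extChartAt 𝓘(ℝ, E) m ⁻¹' Metric.ball c r,
    isOpen_extChartAt_preimage_inter m Metric.isOpen_ball, ⟨hms, Metric.mem_ball_self hr⟩,
    fun x hx ↦ hsub hx, fun x hx hx0 hx1 y hy ↦ ?_⟩
  have hξs : ContDiffOn ℝ ∞ ξ (Metric.ball c r) :=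
    (contDiffOn_chartRep hU hV.1).mono fun z hz ↦ (hball hz).1
  have hξa {z} (hz : z ∈ Metric.ball c r) : ContDiffAt ℝ ∞ ξ z :=
    hξs.contDiffAt (Metric.isOpen_ball.mem_nhds hz)
  have hK₁0 : 0 ≤ K₁ := (norm_nonneg _).trans (hball (Metric.mem_ball_self hr)).2.1
  have hK₂0 : 0 ≤ K₂ := (norm_nonneg _).trans (hball (Metric.mem_ball_self hr)).2.2
  have hd (z : E) (hz : z ∈ Metric.ball c r) : HasFDerivAt (fun z ↦ (ξ z, fderiv ℝ ξ z))
      ((fderiv ℝ ξ z).prod (fderiv ℝ (fderiv ℝ ξ) z)) z :=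
    ((hξa hz).differentiableAt (by simp)).hasFDerivAt.prodMk
      (((hξa hz).fderiv_right (m := ∞) (by simp)).differentiableAt (by simp)).hasFDerivAt
  -- In the constant, `1` bounds the first component, `K₂` the term with the derivative of the
  -- Christoffel symbols, and `3 * K₁` the three terms with the symbols themselves.
  have hbound (z : E) (hz : z ∈ Metric.ball c r) :
      ‖(fderiv ℝ ξ z).prod (fderiv ℝ (fderiv ℝ ξ) z)‖ ≤
        (1 + K₂ + 3 * K₁) * ‖(ξ z, fderiv ℝ ξ z)‖ := by
    set N := ‖(ξ z, fderiv ℝ ξ z)‖ with hN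
    have hN1 : ‖ξ z‖ ≤ N := norm_fst_le (ξ z, fderiv ℝ ξ z)
    have hN2 : ‖fderiv ℝ ξ z‖ ≤ N := norm_snd_le (ξ z, fderiv ℝ ξ z)
    have hN0 : 0 ≤ N := norm_nonneg _
    have hG1 : ‖christoffel (E := E) m z‖ ≤ K₁ := (hball hz).2.1
    have hG2 : ‖fderiv ℝ (christoffel (E := E) m) z‖ ≤ K₂ := (hball hz).2.2
    have hzt := (hball hz).1.1
    have h2 : ‖fderiv ℝ (fderiv ℝ ξ) z‖ ≤ (K₂ + 3 * K₁) * N := by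
      refine ContinuousLinearMap.opNorm_le_bound₂ _ (by positivity) fun a b ↦ ?_
      have heq := hV.fderiv_fderiv_chartRep hU (hball hz).1.2 (symm_mem_source hzt) a b
      rw [(extChartAt 𝓘(ℝ, E) m).right_inv hzt] at heq
      rw [heq]
      have b1 : ‖christoffel m z b a‖ ≤ K₁ * ‖b‖ * ‖a‖ :=
        (ContinuousLinearMap.le_opNorm₂ _ b a).trans (by gcongr)
      have b2 : ‖fderiv ℝ ξ z (christoffel m z b a)‖ ≤ N * (K₁ * ‖b‖ * ‖a‖) :=
        (ContinuousLinearMap.le_opNorm _ _).trans (by gcongr)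
      have b3 : ‖fderiv ℝ (christoffel (E := E) m) z (ξ z) b a‖ ≤ K₂ * N * ‖b‖ * ‖a‖ := by
        refine (ContinuousLinearMap.le_opNorm₂ _ b a).trans ?_
        gcongr
        exact (ContinuousLinearMap.le_opNorm _ _).trans (by gcongr)
      have b4 (v : E) : ‖fderiv ℝ ξ z v‖ ≤ N * ‖v‖ :=
        (ContinuousLinearMap.le_opNorm _ _).trans (by gcongr)
      have b5 : ‖christoffel m z b (fderiv ℝ ξ z a)‖ ≤ K₁ * ‖b‖ * (N * ‖a‖) :=
        (ContinuousLinearMap.le_opNorm₂ _ _ _).trans (by gcongr; exact b4 a)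
      have b6 : ‖christoffel m z (fderiv ℝ ξ z b) a‖ ≤ K₁ * (N * ‖b‖) * ‖a‖ :=
        (ContinuousLinearMap.le_opNorm₂ _ _ _).trans (by gcongr; exact b4 b)
      refine (norm_sub_le _ _).trans ((add_le_add ((norm_sub_le _ _).trans
        (add_le_add ((norm_sub_le _ _).trans (add_le_add b2 b3)) b5)) b6).trans (le_of_eq ?_))
      ring
    refine ContinuousLinearMap.opNorm_le_bound _ (by positivity) fun a ↦ ?_
    rw [ContinuousLinearMap.prod_apply, Prod.norm_mk]
    refine max_le ?_ ?_
    · refine (ContinuousLinearMap.le_opNorm _ _).trans ?_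
      gcongr
      nlinarith
    · refine (ContinuousLinearMap.le_opNorm _ _).trans ?_
      gcongr
      refine h2.trans ?_
      nlinarith
  have hVx := hV.1.mdiffAt hU (hsub hx)
  have hVy := hV.1.mdiffAt hU (hsub hy)
  have hzero : (fun z ↦ (ξ z, fderiv ℝ ξ z)) (extChartAt 𝓘(ℝ, E) m x) = 0 := by
    have h0 : ξ (extChartAt 𝓘(ℝ, E) m x) = 0 := by
      rw [hξ, chartRep_extChartAt hx.1, hx0, map_zero]
    refine Prod.ext h0 (ContinuousLinearMap.ext fun u ↦ ?_)
    have h1 := toCoord_leviCivita hx.1 hVx (fromCoord m x u)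
    rw [hx1, hx0, toCoord_fromCoord hx.1] at h1
    simpa using h1.symm
  have hzero' := eq_zero_of_norm_fderiv_le (convex_ball c r) hd hbound hx.2 hzero hy.2
  have h0 : ξ (extChartAt 𝓘(ℝ, E) m y) = 0 := congrArg Prod.fst hzero'
  have h1 : fderiv ℝ ξ (extChartAt 𝓘(ℝ, E) m y) = 0 := congrArg Prod.snd hzero'
  have hVy0 : V y = 0 := by
    rw [← fromCoord_toCoord hy.1 (V y), ← chartRep_extChartAt hy.1, ← hξ, h0, map_zero]
  refine ⟨hVy0, ContinuousLinearMap.ext fun u ↦ ?_⟩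
  rw [← fromCoord_toCoord hy.1 (leviCivita E M V y u), toCoord_leviCivita hy.1 hVy, ← hξ, h1, hVy0]
  simp

/-- The set where the one-jet vanishes is open and closed in `U`: on the neighborhoods supplied by
the local statement the jet vanishes everywhere or nowhere. -/
theorem IsKillingOn.eq_zero_of_isPreconnected (hU : IsOpen U) (hc : IsPreconnected U)
    (hV : IsKillingOn V U) (hx : x ∈ U) (h0 : V x = 0) (h1 : leviCivita E M V x = 0)
    (hy : y ∈ U) : V y = 0 := by
  let S : Set M := {y | y ∈ U ∧ V y = 0 ∧ leviCivita E M V y = 0}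
  have hS : IsOpen S := isOpen_iff_mem_nhds.2 fun y hy ↦ by
    obtain ⟨N, hN, hyN, hNU, h⟩ := hV.exists_isOpen_forall_eq_zero hU hy.1
    exact Filter.mem_of_superset (hN.mem_nhds hyN)
      fun z hz ↦ ⟨hNU hz, h y hyN hy.2.1 hy.2.2 z hz⟩
  have hS' : IsOpen (U \ S) := isOpen_iff_mem_nhds.2 fun y hy ↦ by
    obtain ⟨N, hN, hyN, hNU, h⟩ := hV.exists_isOpen_forall_eq_zero hU hy.1
    exact Filter.mem_of_superset (hN.mem_nhds hyN)
      fun z hz ↦ ⟨hNU hz, fun hzS ↦ hy.2 ⟨hy.1, h z hz hzS.2.1 hzS.2.2 y hyN⟩⟩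
  have := hc.subset_left_of_subset_union hS hS' disjoint_sdiff_right
    (fun z hz ↦ (em (z ∈ S)).imp id fun h ↦ ⟨hz, h⟩) ⟨x, hx, hx, h0, h1⟩
  exact (this hy).2.1

end

end Uniqueness

/-! ### Locally maximally homogeneous metrics -/

/-! ### Dimension of the space of skew-symmetric endomorphisms -/

section SkewDimension

noncomputable section

variable (T : Type*) [NormedAddCommGroup T] [InnerProductSpace ℝ T]

/-- The space of skew-symmetric endomorphisms. -/
def skewSubmodule : Submodule ℝ (T →L[ℝ] T) where
  carrier := {A | IsSkew A}
  zero_mem' v w := by simp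
  add_mem' {A B} hA hB v w := by
    have h1 := hA v w
    have h2 := hB v w
    simp only [add_apply, inner_add_left, inner_add_right]
    linarith
  smul_mem' c A hA v w := by
    have h1 := hA v w
    simp only [smul_apply, inner_smul_left, inner_smul_right, conj_trivial]
    linear_combination c * h1

variable [FiniteDimensional ℝ T]

/-- The entries below the diagonal of a skew-symmetric endomorphism. -/
def skewEntries : skewSubmodule T →ₗ[ℝ] ((Σ i : Fin (Module.finrank ℝ T), Fin i) → ℝ) where
  toFun A p := inner ℝ (A.1 (stdOrthonormalBasis ℝ T p.1))
    (stdOrthonormalBasis ℝ T ⟨p.2, p.2.2.trans p.1.2⟩)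
  map_add' A B := by ext p; simp [inner_add_left]
  map_smul' c A := by ext p; simp [inner_smul_left]

theorem isSkew_of_basis {A : T →L[ℝ] T} (h : ∀ i j,
    inner ℝ (A (stdOrthonormalBasis ℝ T i)) (stdOrthonormalBasis ℝ T j) +
      inner ℝ (stdOrthonormalBasis ℝ T i) (A (stdOrthonormalBasis ℝ T j)) = 0) : IsSkew A := by
  intro v w
  rw [← (stdOrthonormalBasis ℝ T).sum_repr' v, ← (stdOrthonormalBasis ℝ T).sum_repr' w]
  simp only [map_sum, map_smul, sum_inner, inner_sum, inner_smul_left, inner_smul_right,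
    ← Finset.sum_add_distrib, ← mul_add]
  refine Finset.sum_eq_zero fun i _ ↦ mul_eq_zero_of_right _ (Finset.sum_eq_zero fun j _ ↦ ?_)
  rw [h, mul_zero]

theorem skewEntries_injective : Function.Injective (skewEntries T) := by
  refine (injective_iff_map_eq_zero _).2 fun A hA ↦ ?_
  have hlt {i j : Fin (Module.finrank ℝ T)} (hij : j < i) :
      inner ℝ (A.1 (stdOrthonormalBasis ℝ T i)) (stdOrthonormalBasis ℝ T j) = 0 :=
    congrFun hA ⟨i, ⟨j, hij⟩⟩
  have hskew (i j : Fin (Module.finrank ℝ T)) :=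
    A.2 (stdOrthonormalBasis ℝ T i) (stdOrthonormalBasis ℝ T j)
  have hall (i j : Fin (Module.finrank ℝ T)) :
      inner ℝ (A.1 (stdOrthonormalBasis ℝ T i)) (stdOrthonormalBasis ℝ T j) = 0 := by
    have h := hskew i j
    rw [real_inner_comm (A.1 (stdOrthonormalBasis ℝ T j))] at h
    rcases lt_trichotomy i j with hij | rfl | hij
    · rw [hlt hij] at h
      linarith
    · linarith
    · exact hlt hij
  refine Subtype.ext (ContinuousLinearMap.coe_injective
    ((stdOrthonormalBasis ℝ T).toBasis.ext fun i ↦ ?_))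
  rw [OrthonormalBasis.coe_toBasis]
  refine ((stdOrthonormalBasis ℝ T).sum_repr' (A.1 _)).symm.trans
    (Finset.sum_eq_zero fun j _ ↦ ?_)
  rw [real_inner_comm, hall, zero_smul]

theorem skewEntries_surjective : Function.Surjective (skewEntries T) := by
  intro a
  -- The skew matrix with the prescribed entries below the diagonal.
  let B (i j : Fin (Module.finrank ℝ T)) : ℝ :=
    if h : j < i then a ⟨i, ⟨j, h⟩⟩ else if h : i < j then -a ⟨j, ⟨i, h⟩⟩ else 0
  have hB (i j) : B i j + B j i = 0 := by
    rcases lt_trichotomy i j with hij | rfl | hij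
    · simp [B, hij, hij.not_gt]
    · simp [B]
    · simp [B, hij, hij.not_gt]
  let A : T →L[ℝ] T := LinearMap.toContinuousLinearMap
    ((stdOrthonormalBasis ℝ T).toBasis.constr ℝ fun i ↦ ∑ j, B i j • stdOrthonormalBasis ℝ T j)
  have hA (i) : A (stdOrthonormalBasis ℝ T i) = ∑ j, B i j • stdOrthonormalBasis ℝ T j := by
    have := (stdOrthonormalBasis ℝ T).toBasis.constr_basis ℝ
      (fun i ↦ ∑ j, B i j • stdOrthonormalBasis ℝ T j) i
    rwa [OrthonormalBasis.coe_toBasis] at this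
  have hAB (i j) :
      inner ℝ (A (stdOrthonormalBasis ℝ T i)) (stdOrthonormalBasis ℝ T j) = B i j := by
    rw [hA]
    simp [sum_inner, inner_smul_left, OrthonormalBasis.inner_eq_ite]
  refine ⟨⟨A, isSkew_of_basis T fun i j ↦ ?_⟩, ?_⟩
  · rw [real_inner_comm (A (stdOrthonormalBasis ℝ T j)), hAB, hAB, hB]
  · ext ⟨i, j, hj⟩
    exact (hAB i ⟨j, hj.trans i.2⟩).trans (dif_pos (show (⟨j, hj.trans i.2⟩ : Fin _) < i from hj))

theorem finrank_prod_skewSubmodule : Module.finrank ℝ (T × skewSubmodule T) =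
    Module.finrank ℝ T * (Module.finrank ℝ T + 1) / 2 := by
  have h := (LinearEquiv.ofBijective _
    ⟨skewEntries_injective T, skewEntries_surjective T⟩).finrank_eq
  rw [Module.finrank_prod, h, Module.finrank_fintype_fun_eq_card, Fintype.card_sigma]
  simp only [Fintype.card_fin]
  -- There are `0 + 1 + ⋯ + (n - 1)` entries below the diagonal; the summand `n` from `T` extends
  -- the sum by one term.
  rw [Fin.sum_univ_eq_sum_range (fun i ↦ i), add_comm, ← Finset.sum_range_succ,
    Finset.sum_range_id, mul_comm, Nat.add_sub_cancel]

end

end SkewDimension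

/-! ### Maximal dimension as surjectivity of the jet map -/

section Homogeneous

noncomputable section

set_option maxSynthPendingDepth 3
set_option linter.unusedSectionVars false

variable {E : Type*} [NormedAddCommGroup E] [NormedSpace ℝ E]
  {M : Type*} [TopologicalSpace M] [ChartedSpace E M] [IsManifold 𝓘(ℝ, E) ∞ M]
  {x : M}
  [FiniteDimensional ℝ E]
  [RiemannianBundle (fun x : M ↦ TangentSpace 𝓘(ℝ, E) x)]
  [IsContMDiffRiemannianBundle 𝓘(ℝ, E) ∞ E (fun x : M ↦ TangentSpace 𝓘(ℝ, E) x)]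

/-- The value and the skew-symmetric covariant derivative at `x` of the Killing fields on `U`. -/
def killingSkewJet (U : TopologicalSpace.Opens M) (hx : x ∈ U) :
    killingFields (E := E) U →ₗ[ℝ]
      TangentSpace 𝓘(ℝ, E) x × skewSubmodule (TangentSpace 𝓘(ℝ, E) x) :=
  (LinearMap.fst ℝ _ _ ∘ₗ killingJet (E := E) U hx).prod
    ((LinearMap.snd ℝ _ _ ∘ₗ killingJet (E := E) U hx).codRestrict (skewSubmodule (TangentSpace 𝓘(ℝ, E) x))
      fun V : killingFields (E := E) U ↦ IsKillingOn.isSkew (E := E) U.isOpen V.2.1 hx)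

theorem killingSkewJet_injective {U : TopologicalSpace.Opens M} (hU : IsConnected (U : Set M))
    (hx : x ∈ U) : Function.Injective (killingSkewJet (E := E) U hx) := by
  refine (injective_iff_map_eq_zero _).2 fun V hV ↦ Subtype.ext (funext fun y ↦ ?_)
  by_cases hy : y ∈ U
  · exact V.2.1.eq_zero_of_isPreconnected U.isOpen hU.isPreconnected hx (congrArg Prod.fst hV)
      (congrArg Subtype.val (congrArg Prod.snd hV)) hy
  · exact V.2.2 y hy

/-- The jet map is injective on connected sets, into a space of dimension `n(n+1)/2`. Injectivity
also gives finite dimension, so that `finrank` is a genuine dimension and not the default `0`. -/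
theorem finrank_killingFields_iff {U : TopologicalSpace.Opens M} (hU : IsConnected (U : Set M))
    (hx : x ∈ U) :
    Module.finrank ℝ (killingFields (E := E) U) =
      Module.finrank ℝ E * (Module.finrank ℝ E + 1) / 2 ↔
    Function.Surjective (killingSkewJet (E := E) U hx) := by
  have hinj := killingSkewJet_injective (E := E) hU hx
  have hfin : FiniteDimensional ℝ (killingFields (E := E) U) :=
    FiniteDimensional.of_injective _ hinj
  have hdim := finrank_prod_skewSubmodule (TangentSpace 𝓘(ℝ, E) x)
  change _ = Module.finrank ℝ E * (Module.finrank ℝ E + 1) / 2 at hdim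
  rw [← hdim]
  exact ⟨fun h ↦ (LinearMap.injective_iff_surjective_of_finrank_eq_finrank h).1 hinj,
    fun h ↦ (LinearEquiv.ofBijective _ ⟨hinj, h⟩).finrank_eq⟩

theorem locallyMaximallyHomogeneous_iff : LocallyMaximallyHomogeneous E M ↔
    CurvatureInvariant E M ∧ CurvatureParallel E M := by
  constructor
  · intro h
    have hall (x : M) : HasAllKillingJets E x := by
      intro v Ψ hΨ
      obtain ⟨U, hx, hU, hdim⟩ := h x
      obtain ⟨V, hV⟩ := (finrank_killingFields_iff hU hx).1 hdim (v, ⟨Ψ, hΨ⟩)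
      exact ⟨U, V, U.isOpen, hx, V.2.1, congrArg Prod.fst hV,
        congrArg Subtype.val (congrArg Prod.snd hV)⟩
    exact ⟨curvatureInvariant_of_hasAllKillingJets hall,
      curvatureParallel_of_hasAllKillingJets hall⟩
  · rintro ⟨hinv, hpar⟩ m
    obtain ⟨U, hm, hU, h⟩ := exists_killingFields_of_curvature hinv hpar m
    refine ⟨U, hm, hU, (finrank_killingFields_iff hU hm).2 ?_⟩
    rintro ⟨v, Ψ, hΨ⟩
    obtain ⟨V, hV, hv, hVΨ⟩ := h m hm v Ψ hΨ
    exact ⟨⟨V, hV⟩, Prod.ext hv (Subtype.ext hVΨ)⟩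

end

end Homogeneous

/-! ### Parallel sections of the Cartan algebroid -/

section Symmetric

noncomputable section

set_option maxSynthPendingDepth 3
set_option linter.unusedSectionVars false

variable {E : Type*} [NormedAddCommGroup E] [NormedSpace ℝ E]
  {M : Type*} [TopologicalSpace M] [ChartedSpace E M] [IsManifold 𝓘(ℝ, E) ∞ M]
  {V Y : VField E M} {U : Set M} {x : M}
  [FiniteDimensional ℝ E]

/-- Parallelism over `U` is tested on fields smooth on all of `U`, so local extensions must be cut
off by a bump function; this is where the Hausdorff property enters. -/
theorem exists_smoothOn_univ [T2Space M] (v : TangentSpace 𝓘(ℝ, E) x) :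
    ∃ Y : VField E M, SmoothOn Y univ ∧ Y x = v := by
  let ψ : SmoothBumpFunction 𝓘(ℝ, E) x := Classical.arbitrary _
  refine ⟨(ψ : M → ℝ) • (FiberBundle.extend E v : VField E M), ?_, ?_⟩
  · exact (ContMDiffOn.smul_section_of_tsupport ψ.contMDiff.contMDiffOn (chartAt E x).open_source
      ψ.tsupport_subset_chartAt_source (smoothOn_extend v)).contMDiffOn
  · simp

theorem jet_zero : jet (0 : VField E M) x = 0 := by
  have hx := mem_chart_source E x
  have hzero : chartRep x (0 : VField E M) = fun _ ↦ 0 := funext fun z ↦ map_zero _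
  rw [jet_eq (smoothOn_zero.mdiffAt isOpen_univ (mem_univ x)), hzero]
  refine Prod.ext rfl (ContinuousLinearMap.ext fun u ↦ ?_)
  simp

theorem endSmoothOn_zero (hU : IsOpen U) : EndSmoothOn (0 : EndField E M) U :=
  endSmoothOn_of_apply hU fun _ _ _ ↦ smoothOn_zero

theorem kappa_zero (hU : IsOpen U) (hY : SmoothOn Y U) (hx : x ∈ U) :
    kappa Y (0 : EndField E M) x = 0 := by
  refine ContinuousLinearMap.ext fun u ↦ ?_
  have hZ := (smoothOn_extend u).mono (inter_subset_right (s := U))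
  have h := kappa_apply (hU.inter (chartAt E x).open_source) (hY.mono inter_subset_left)
    (endSmoothOn_zero (hU.inter (chartAt E x).open_source)) hZ ⟨hx, mem_chart_source E x⟩
  have e : (fun y ↦ (0 : EndField E M) y ((FiberBundle.extend E u : VField E M) y)) =
      (0 : VField E M) := rfl
  rw [e, mlieBracket_zero_right] at h
  simpa using h

variable [RiemannianBundle (fun x : M ↦ TangentSpace 𝓘(ℝ, E) x)]
  [IsContMDiffRiemannianBundle 𝓘(ℝ, E) ∞ E (fun x : M ↦ TangentSpace 𝓘(ℝ, E) x)]

/-- Whether `L_V σ` vanishes at `x` depends only on the jet, through `∇V x`; any representative may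
be tested. -/
theorem mem_isometryJets_iff (hV : SmoothNear V x) :
    jet V x ∈ isometryJets (E := E) x ↔ LieMetricVanishesAt V x := by
  refine ⟨?_, fun h ↦ ⟨V, hV, h, rfl⟩⟩
  rintro ⟨W, hW, hWx, h⟩
  rw [lieMetricVanishesAt_iff hW.mdiffAt] at hWx
  rw [lieMetricVanishesAt_iff hV.mdiffAt]
  rwa [← ((jet_eq_jet_iff hW.mdiffAt hV.mdiffAt).1 h).2]

/-- In the anchor component of `∇_Y s` the two brackets cancel and only `-φ(Y)` remains. -/
theorem JetSection.IsParallelOn.endo_eq_zero [T2Space M] {s : JetSection E M}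
    (hs : s.IsParallelOn U) (hx : x ∈ U) : s.endo x = 0 := by
  refine ContinuousLinearMap.ext fun u ↦ ?_
  obtain ⟨Y, hY, rfl⟩ := exists_smoothOn_univ u
  have h : mlieBracket 𝓘(ℝ, E) s.field Y x - s.endo x (Y x) + mlieBracket 𝓘(ℝ, E) Y s.field x +
      0 = 0 := congrArg Prod.fst (hs Y (hY.mono (subset_univ U)) x hx)
  rw [mlieBracket_swap_apply] at h
  have h2 : s.endo x (Y x) = -(-mlieBracket 𝓘(ℝ, E) Y s.field x - s.endo x (Y x) +
    mlieBracket 𝓘(ℝ, E) Y s.field x + 0) := by abel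
  rw [h2, h]
  simp

theorem JetSection.IsIsometrySectionOn.isKillingOn [T2Space M] {s : JetSection E M}
    (hU : IsOpen U) (hs : s.IsIsometrySectionOn U) (hp : s.IsParallelOn U) :
    IsKillingOn s.field U ∧ ∀ x ∈ U, s.eval x = jet s.field x := by
  have heval (x : M) (hx : x ∈ U) : s.eval x = jet s.field x := by
    rw [JetSection.eval, hp.endo_eq_zero hx]
    exact add_zero _
  refine ⟨⟨hs.smooth_field, fun x hx ↦ ?_⟩, heval⟩
  rw [← mem_isometryJets_iff (hs.smooth_field.smoothNear hU hx), ← heval x hx]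
  exact hs.mem x hx

/-- The one-jets of a Killing field form a parallel section. -/
theorem IsKillingOn.isParallelOn (hU : IsOpen U) (hV : IsKillingOn V U) :
    (⟨V, 0⟩ : JetSection E M).IsParallelOn U := by
  have := FiniteDimensional.complete ℝ E
  intro Y hY x hx
  have had : (⟨V, 0⟩ : JetSection E M).ad Y = mlieBracket 𝓘(ℝ, E) V Y := by
    ext y
    exact sub_zero _
  have hfield : (cartanConnection Y ⟨V, 0⟩).field = 0 := by
    ext y
    change (⟨V, 0⟩ : JetSection E M).ad Y y + mlieBracket 𝓘(ℝ, E) Y V y = 0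
    rw [had, mlieBracket_swap_apply, neg_add_cancel]
  have hendo : (cartanConnection Y ⟨V, 0⟩).endo x = 0 := by
    change -leviCivita E M ((⟨V, 0⟩ : JetSection E M).ad Y) x + (((0 : EndField E M) x ∘L
      (-leviCivita E M Y x) - (-leviCivita E M Y x) ∘L (0 : EndField E M) x) +
      kappa Y (0 : EndField E M) x - kappa V (fun x ↦ -leviCivita E M Y x) x) = 0
    rw [had, kappa_zero hU hY hx]
    refine ContinuousLinearMap.ext fun u ↦ ?_
    have hop := hU.inter (chartAt E x).open_source
    have hx' : x ∈ U ∩ (chartAt E x).source := ⟨hx, mem_chart_source E x⟩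
    have hZ := (smoothOn_extend u).mono (inter_subset_right (s := U))
    have hu : (FiberBundle.extend E u : VField E M) x = u := by simp
    rw [← hu]
    generalize (FiberBundle.extend E u : VField E M) = Z at hZ
    have hV := hV.mono (inter_subset_left (t := (chartAt E x).source))
    have hY := hY.mono (inter_subset_left (t := (chartAt E x).source))
    have hφ : EndSmoothOn (fun x ↦ -leviCivita E M Y x) (U ∩ (chartAt E x).source) :=
      endSmoothOn_of_apply hop fun m _ v ↦
        (SmoothOn.leviCivita (hop.inter (chartAt E m).open_source)
          ((smoothOn_chartField_const m v).mono inter_subset_right)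
          (hY.mono inter_subset_left)).neg
    have hk := kappa_apply hop hV.1 hφ hZ hx'
    have e : (fun y ↦ (-leviCivita E M Y y) (Z y)) =
        (0 : VField E M) - fun y ↦ leviCivita E M Y y (Z y) := by
      ext y; simp
    -- The affine property gives `κ_V(∇Y) = ∇[V, Y]`, which is exactly what cancels the term coming
    -- from the splitting.
    rw [e, bracket_sub_right (smoothOn_zero.mdiffAt hop hx') ((hZ.leviCivita hop hY).mdiffAt hop hx'),
      mlieBracket_zero_right, hV.mlieBracket_leviCivita hop hZ hY hx',
      mlieBracket_swap_apply (V := Z)] at hk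
    simp only [add_apply, sub_apply, neg_apply, zero_apply, ContinuousLinearMap.comp_apply, hk,
      Pi.zero_apply, map_zero, map_neg]
    abel
  rw [JetSection.eval, hfield, hendo, jet_zero]
  exact add_zero _

/-- Parallel sections of the algebroid are the prolongations `J¹V` of Killing fields, so local
symmetry supplies all Killing jets. Conversely, the Killing fields produced by constant curvature
prolong to the required parallel sections. -/
theorem locallySymmetric_iff [T2Space M] : LocallySymmetric E M ↔
    CurvatureInvariant E M ∧ CurvatureParallel E M := by
  constructor
  · intro h
    have hall (x : M) : HasAllKillingJets E x := by
      intro v Ψ hΨ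
      obtain ⟨U, hx, -, hs⟩ := h x
      -- `W` need only satisfy the Killing equation at `x`: its jet there is the element of the
      -- fiber to be reached by a parallel section.
      obtain ⟨W, hW, hWv, hWΨ⟩ := exists_smoothNear_leviCivita v Ψ
      obtain ⟨s, hs, hp, hsx⟩ := hs x hx (jet W x) ((mem_isometryJets_iff hW).2
        ((lieMetricVanishesAt_iff hW.mdiffAt).2 (by rw [hWΨ]; exact hΨ)))
      obtain ⟨hV, heval⟩ := hs.isKillingOn U.isOpen hp
      rw [heval x hx, jet_eq_jet_iff (hV.1.mdiffAt U.isOpen hx) hW.mdiffAt, hWv, hWΨ] at hsx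
      exact ⟨U, s.field, U.isOpen, hx, hV, hsx⟩
    exact ⟨curvatureInvariant_of_hasAllKillingJets hall,
      curvatureParallel_of_hasAllKillingJets hall⟩
  · rintro ⟨hinv, hpar⟩ m
    obtain ⟨U, hm, hU, h⟩ := exists_killingFields_of_curvature hinv hpar m
    refine ⟨U, hm, hU, fun x hx ξ hξ ↦ ?_⟩
    obtain ⟨W, hW, hWx, rfl⟩ := hξ
    obtain ⟨V, ⟨hV, -⟩, hVW⟩ := h x hx (W x) (leviCivita E M W x)
      ((lieMetricVanishesAt_iff hW.mdiffAt).1 hWx)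
    have heval (y : M) : (⟨V, 0⟩ : JetSection E M).eval y = jet V y := add_zero _
    refine ⟨⟨V, 0⟩, ⟨hV.1, endSmoothOn_zero U.isOpen, fun y hy ↦ ?_⟩,
      hV.isParallelOn U.isOpen, ?_⟩
    · rw [heval, mem_isometryJets_iff (hV.1.smoothNear U.isOpen hy)]
      exact hV.2 y hy
    · rw [heval, jet_eq_jet_iff (hV.1.mdiffAt U.isOpen hx) hW.mdiffAt]
      exact hVW

end

end Symmetric

end RiemannCartan

theorem corollary3p3 {E : Type*} [NormedAddCommGroup E] [NormedSpace ℝ E] [FiniteDimensional ℝ E]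
    {M : Type*} [TopologicalSpace M] [T2Space M] [ChartedSpace E M] [IsManifold 𝓘(ℝ, E) ∞ M]
    [RiemannianBundle (fun x : M ↦ TangentSpace 𝓘(ℝ, E) x)]
    [IsContMDiffRiemannianBundle 𝓘(ℝ, E) ∞ E (fun x : M ↦ TangentSpace 𝓘(ℝ, E) x)] :
    (RiemannCartan.LocallyMaximallyHomogeneous E M ↔
      RiemannCartan.CurvatureInvariant E M ∧ RiemannCartan.CurvatureParallel E M) ∧
    (RiemannCartan.LocallySymmetric E M ↔
      RiemannCartan.CurvatureInvariant E M ∧ RiemannCartan.CurvatureParallel E M) := by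
  exact ⟨RiemannCartan.locallyMaximallyHomogeneous_iff, RiemannCartan.locallySymmetric_iff⟩
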